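/- Let $0<r_i<r_e$, let $\Omega=\{x\in\mathbb R^2:|x-(r_e,0)|<r_e\}$ and, for $0<\epsilon<r_e-r_i$, let $D=D_\epsilon=\{x:|x-(r_i+\epsilon,0)|<r_i\}$. Let $g\in C^{1,\delta}(\partial\Omega)$ with $\delta>1/2$ and $\int_{\partial\Omega}g\,d\sigma=0$. For $k>0$ let $u=u_{\epsilon,k}$ be a solution (unique up to an additive constant), continuous on $\overline\Omega$, of $$\Delta u=0\ \text{in } D\cup(\Omega\setminus\overline D),\quad u|_+=u|_-\ \text{ and }\ \frac{\partial u}{\partial\nu}\Big|_+=k\frac{\partial u}{\partial\nu}\Big|_-\ \text{on }\partial D,\quad \frac{\partial u}{\partial\nu}\Big|_-=g\ \text{on }\partial\Omega ,$$ where $\nu$ is the outward unit normal and $+$, $-$ denote limits from outside and inside. Notation. $H(x)=-\frac1\pi\int_{\partial\Omega}\ln|x-\zeta|\,g(\zeta)\,d\sigma(\zeta)$; $\tau=\frac{k-1}{k+1}$; $r_*=\sqrt{\frac{2r_ir_e}{r_e-r_i}}$; $\beta=\frac{r_*(-\ln|\tau|)}{4\sqrt\epsilon}$; $c_i=\frac{r_e^2-r_i^2-(r_e-r_i-\epsilon)^2}{2(r_e-r_i-\epsilon)}$;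 $x_0=c_i-r_i-\epsilon$; $\alpha=\sqrt{c_i^2-r_i^2}$; $\xi_i=\frac12\ln\frac{c_i+\alpha}{c_i-\alpha}$. The bipolar coordinates $\xi\in\mathbb R$, $\theta\in(-\pi,\pi]$ of $x=(x_1,x_2)$ are given by $e^{\xi+i\theta}=\frac{\alpha+z}{\alpha-z}$ with $z=x_1+x_0+ix_2$ (the coordinates are centred after translating $\Omega$ and $D$ by $(x_0,0)$), and $\mathbf e_\xi=\nabla\xi/|\nabla\xi|$, $\mathbf e_\theta=\nabla\theta/|\nabla\theta|$. Finally $$P(w;\beta)=\int_0^\infty\frac{w\,e^{-(\beta+1)t}}{(1+we^{-t})^2}\,dt,\qquad |w|<1,\ \beta>0 .$$ Theorem. (1) $\nabla u$ can blow up only when both $\epsilon\to0$ and $k\to0$: for all $\epsilon_0,k_0>0$ there is a constant $C$ such that $|\nabla u|\le C$ in $D\cup(\Omega\setminus\overline D)$ for all $\epsilon\in(0,r_e-r_i)$ and $k>0$ with $\epsilon\ge\epsilon_0$ or $k\ge k_0$. (2) $\nabla H(x)$ converges as $x\to(0,0)$ within $\Omega$; write $(C_1,C_2)$ for the limit, i.e.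 $C_1=\frac{\partial H}{\partial x_1}(0,0)$, $C_2=\frac{\partial H}{\partial x_2}(0,0)$. Put $P_D=P(e^{-(\xi+2\xi_i)-i\theta};\beta)$ and $P_S=P(e^{-(2\xi_i-\xi)-i\theta};\beta)$. Then for $0<k<1$ and $0<\epsilon<r_e-r_i$ $$\nabla u\cdot\mathbf e_\xi=\begin{cases}-\dfrac{r_*\tau}{\sqrt\epsilon}(\cosh\xi+\cos\theta)\big[C_1\Re P_D+C_2\Im P_D\big]+O(1)&\text{in }D,\\[2mm] O(1)&\text{in }\Omega\setminus\overline D,\end{cases}$$ $$\nabla u\cdot\mathbf e_\theta=\begin{cases}\dfrac{r_*\tau}{\sqrt\epsilon}(\cosh\xi+\cos\theta)\big[C_1\Im P_D-C_2\Re P_D\big]+O(1)&\text{in }D,\\[2mm] \dfrac{r_*\tau}{\sqrt\epsilon}(\cosh\xi+\cos\theta)\big[C_1\Im P_S-C_2\Re P_S\big]+O(1)&\text{in }\Omega\setminus\overline D,\end{cases}$$ (in $D$ away from the pole $z=\alpha$, where the coordinates are undefined), where each $O(1)$ is bounded in absolute value by a constant depending only on $r_i,r_e,\delta,g$, and not on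 $\epsilon$, $k$ or the point. -/

import Mathlib

open Filter Topology Metric

/-!
The plane `ℝ²` is identified with `ℂ` (regarded as a real inner product space), the point
`(x₁, x₂)` being `x₁ + i x₂`.
-/

namespace CoreShell

noncomputable section

/-! ### The two disks -/

/-- The exterior disk `Ω`: radius `rₑ`, centre `(rₑ, 0)`; it does not depend on `ε`. -/
def Om (re : ℝ) : Set ℂ := ball (re : ℂ) re

/-- The inclusion `D`: radius `rᵢ`, centre `(rᵢ + ε, 0)`. -/
def Incl (ri ε : ℝ) : Set ℂ := ball ((ri + ε : ℝ) : ℂ) ri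

/-- The shell, `Ω` minus the closure of `D`. -/
def Shell (re ri ε : ℝ) : Set ℂ := Om re \ closedBall ((ri + ε : ℝ) : ℂ) ri

/-! ### The transmission problem -/

/-- Outward unit normal of the circle with centre `c` and radius `R` at its point `x`. -/
def normal (c : ℂ) (R : ℝ) (x : ℂ) : ℂ := R⁻¹ • (x - c)

/-- `∂u/∂ν|₋ (x) = a`: the normal derivative taken from inside the circle. -/
def HasInnerNormalDeriv (u : ℂ → ℝ) (c : ℂ) (R : ℝ) (x : ℂ) (a : ℝ) : Prop :=
  Tendsto (fun t : ℝ => inner ℝ (gradient u (x - t • normal c R x)) (normal c R x))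
    (𝓝[>] 0) (𝓝 a)

/-- `∂u/∂ν|₊ (x) = a`: the normal derivative taken from outside the circle. -/
def HasOuterNormalDeriv (u : ℂ → ℝ) (c : ℂ) (R : ℝ) (x : ℂ) (a : ℝ) : Prop :=
  Tendsto (fun t : ℝ => inner ℝ (gradient u (x + t • normal c R x)) (normal c R x))
    (𝓝[>] 0) (𝓝 a)

/-- `u` is a (classical) solution of the Neumann transmission problem with conductivity `k` in the
inclusion and flux `g` on `∂Ω`. Continuity on the closed disk contains the condition
`u|₊ = u|₋` on `∂D`. -/
structure IsSolution (re ri ε k : ℝ) (g : ℂ → ℝ) (u : ℂ → ℝ) : Prop where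
  continuousOn : ContinuousOn u (closedBall (re : ℂ) re)
  harmonic_incl : InnerProductSpace.HarmonicOnNhd u (Incl ri ε)
  harmonic_shell : InnerProductSpace.HarmonicOnNhd u (Shell re ri ε)
  transmission : ∀ x ∈ sphere ((ri + ε : ℝ) : ℂ) ri, ∃ a : ℝ,
    HasInnerNormalDeriv u ((ri + ε : ℝ) : ℂ) ri x a ∧
    HasOuterNormalDeriv u ((ri + ε : ℝ) : ℂ) ri x (k * a)
  neumann : ∀ x ∈ sphere (re : ℂ) re, HasInnerNormalDeriv u (re : ℂ) re x (g x)

/-! ### The boundary datum and the background field -/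

/-- `g ∈ C^{1,δ}(∂Ω)`, in terms of the angular parametrization `t ↦ rₑ + rₑ e^{it}` of `∂Ω`. -/
def IsC1Holder (re δ : ℝ) (g : ℂ → ℝ) : Prop :=
  ContDiff ℝ 1 (fun t : ℝ => g (circleMap (re : ℂ) re t)) ∧
  ∃ K : ℝ, ∀ s t : ℝ,
    |deriv (fun t : ℝ => g (circleMap (re : ℂ) re t)) s -
      deriv (fun t : ℝ => g (circleMap (re : ℂ) re t)) t| ≤ K * |s - t| ^ δ

/-- `∫_{∂Ω} g dσ = 0`. -/
def IsMeanZero (re : ℝ) (g : ℂ → ℝ) : Prop :=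
  ∫ t in (0 : ℝ)..(2 * Real.pi), g (circleMap (re : ℂ) re t) * re = 0

/-- Single layer potential over the circle with centre `c` and radius `R`:
`(1/2π) ∫ ln|x - ζ| φ(ζ) dσ(ζ)`. -/
def singleLayer (c : ℂ) (R : ℝ) (φ : ℂ → ℝ) (x : ℂ) : ℝ :=
  1 / (2 * Real.pi) * ∫ t in (0 : ℝ)..(2 * Real.pi),
    Real.log ‖x - circleMap c R t‖ * φ (circleMap c R t) * R

/-- `H = -2 S_{∂Ω}[g]`. -/
def bgField (re : ℝ) (g : ℂ → ℝ) (x : ℂ) : ℝ := -2 * singleLayer (re : ℂ) re g x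

/-! ### Constants of the geometry and bipolar coordinates -/

/-- First coordinate of the centre of the translated inclusion. -/
def ci (re ri ε : ℝ) : ℝ := (re ^ 2 - ri ^ 2 - (re - ri - ε) ^ 2) / (2 * (re - ri - ε))

/-- First coordinate of the centre of the translated exterior disk. -/
def ce (re ri ε : ℝ) : ℝ := ci re ri ε + re - ri - ε

/-- Length of the translation along the first axis. -/
def shift (re ri ε : ℝ) : ℝ := ce re ri ε - re

/-- The poles of the bipolar coordinates are `(±α, 0)`. -/
def alpha (re ri ε : ℝ) : ℝ :=
  √(ε * (2 * ri + ε) * (2 * re - ε) * (2 * re - 2 * ri - ε)) / (2 * (re - ri - ε))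

/-- The value of the coordinate `ξ` on `∂D`. -/
def xii (re ri ε : ℝ) : ℝ :=
  1 / 2 * Real.log ((ci re ri ε + alpha re ri ε) / (ci re ri ε - alpha re ri ε))

/-- `e^{ξ + iθ} = (α + z) / (α - z)`, where `z` is the translate of the point `x`. -/
def expBipolar (re ri ε : ℝ) (x : ℂ) : ℂ :=
  ((alpha re ri ε : ℂ) + (x + (shift re ri ε : ℂ))) /
    ((alpha re ri ε : ℂ) - (x + (shift re ri ε : ℂ)))

/-- The bipolar coordinate `ξ` of the point `x`. -/
def xi (re ri ε : ℝ) (x : ℂ) : ℝ := Real.log ‖expBipolar re ri ε x‖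

/-- The bipolar coordinate `θ ∈ (-π, π]` of the point `x`. -/
def theta (re ri ε : ℝ) (x : ℂ) : ℝ := Complex.arg (expBipolar re ri ε x)

/-- `∇ξ` at `x`. -/
def gradXi (re ri ε : ℝ) (x : ℂ) : ℂ := gradient (xi re ri ε) x

/-- `∇θ` at `x`, computed with the branch of `θ - θ(x)` that vanishes at `x`, so that the jump of
the principal value at `θ = π` plays no role. -/
def gradTheta (re ri ε : ℝ) (x : ℂ) : ℂ :=
  gradient (fun y => Complex.arg (expBipolar re ri ε y / expBipolar re ri ε x)) x

/-- `e_ξ = ∇ξ / |∇ξ|`. -/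
def eXi (re ri ε : ℝ) (x : ℂ) : ℂ := ‖gradXi re ri ε x‖⁻¹ • gradXi re ri ε x

/-- `e_θ = ∇θ / |∇θ|`. -/
def eTheta (re ri ε : ℝ) (x : ℂ) : ℂ := ‖gradTheta re ri ε x‖⁻¹ • gradTheta re ri ε x

/-! ### The quantities in the asymptotic formulas -/

/-- `r_* = √(2 rᵢ rₑ / (rₑ - rᵢ))`. -/
def rStar (re ri : ℝ) : ℝ := √(2 * ri * re / (re - ri))

/-- `τ = (k - 1) / (k + 1)`. -/
def tau (k : ℝ) : ℝ := (k - 1) / (k + 1)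

/-- `β = r_* (-ln|τ|) / (4 √ε)`. -/
def beta (re ri ε k : ℝ) : ℝ := rStar re ri * (-Real.log |tau k|) / (4 * √ε)

/-- `P(z; β) = ∫₀^∞ z e^{-(β+1)t} / (1 + z e^{-t})² dt`, for `|z| < 1` and `β > 0`. -/
def P (z : ℂ) (β : ℝ) : ℂ :=
  ∫ t in Set.Ioi (0 : ℝ),
    z * (Real.exp (-(β + 1) * t) : ℂ) / (1 + z * (Real.exp (-t) : ℂ)) ^ 2

/-- `P(e^{-(ξ + 2ξᵢ) - iθ}; β)` at the point `x`. -/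
def PIncl (re ri ε k : ℝ) (x : ℂ) : ℂ :=
  P (Complex.exp (-((xi re ri ε x + 2 * xii re ri ε : ℝ) : ℂ)
    - Complex.I * (theta re ri ε x : ℂ))) (beta re ri ε k)

/-- `P(e^{-(2ξᵢ - ξ) - iθ}; β)` at the point `x`. -/
def PShell (re ri ε k : ℝ) (x : ℂ) : ℂ :=
  P (Complex.exp (-((2 * xii re ri ε - xi re ri ε x : ℝ) : ℂ)
    - Complex.I * (theta re ri ε x : ℂ))) (beta re ri ε k)

/-- The factor `(r_* τ / √ε) (cosh ξ + cos θ)` at the point `x`. -/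
def amp (re ri ε k : ℝ) (x : ℂ) : ℝ :=
  rStar re ri * tau k / √ε * (Real.cosh (xi re ri ε x) + Real.cos (theta re ri ε x))

end

end CoreShell

open CoreShell

namespace CoreShell

open InnerProductSpace Set MeasureTheory
open scoped ComplexConjugate

/-! ### Harnack's inequality and the Hopf boundary lemma -/

/-! The solution is computed exactly by the method of images, and the sum of the images is then
compared with a Laplace transform.

Exact solution. If `F` is holomorphic, the gradient of `Re F` is the conjugate of `F'`. Let `F` be
holomorphic in Ω with real part `H` (`complexField`) and `Φ = F'` (`cauchyField`). Let `T` be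
inversion in ∂Ω followed by inversion in ∂D. In the variable ζ = e^{ξ+iθ} both circles are level
sets of |ζ|, so `T` is the multiplication of ζ by a constant q = `ratio` > 1. The series S = Σ (-τ)ⁿ
F∘Tⁿ satisfies S = F - τ S∘T. Put u = (1-τ) Re S in D and u = Re (F - τ S∘T) - τ Re S(x*) in the
shell, x* being the inversion of x in ∂D. The functional equation gives continuity across ∂D and the
flux condition with k(1-τ) = 1+τ; on ∂Ω the two image families have opposite fluxes, so the flux is
that of `H`, namely g (`isSolution_imageSolution`). By Hopf's lemma any two solutions have the same
gradient (`IsSolution.gradient_eq`), so the formula holds for every solution.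

Reduction to a kernel. As a complex number the unit vector e_ξ is K(1), where K(s) = N v/(1+v)² with
v = sζ and N = |1+ζ|²/|ζ| = 2(cosh ξ + cos θ). The chain rule gives (Tⁿ)' K(1) = K(qⁿ), so the
components of the gradient are real and imaginary parts of sums Σ (-τ)ⁿ Φ(Tⁿx) K(s qⁿ) along one ray
(`raySum`). The decisive fact is that K has bounded variation on s ≥ 1 uniformly in ζ: its
increments are dominated by those of a monotone function with values in [-9, 0]
(`norm_rayKernel_sub_le`, `rayMajorant_bounds`).

Consequences. For τ ≥ 0 the sum with constant weights alternates and is bounded by summation by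
parts; for -ρ ≤ τ ≤ 0 with ρ < 1 it converges geometrically; for ε bounded below it is at most a
constant times 1/(q-1). This is part (1), once `Φ` is replaced by its boundary value c at 0 in the
alternating case. The replacement costs O(1): `Φ` is Lipschitz, the image point with coordinate v
lies within O(α |1-v|/|1+v|) of 0 up to the translation, |K| |1-v|/|1+v| is the logarithmic
derivative of K, and α is of order at most q-1 (`norm_raySum_sub_le`).

For τ < 0 write -τ = e^{-βh} with h = log q. The sum times h is a Riemann sum for ∫ e^{-βt} K(e^t)
dt with error O(h) (`norm_tsum_sub_rayIntegral_le`). Finally 1/h differs from κ = r_*/(4√ε) by O(1),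
and the integral is N P because z/(1+z)² is invariant under z ↦ 1/z (`weight_mul_P`). In D a single
sum survives and gives both components. In the shell two sums with the same limit form Y combine to
-τ(Y - conj Y), which is purely imaginary, and therefore only the e_θ component can blow up. -/

theorem harnack {h : ℂ → ℝ} {c w : ℂ} {R : ℝ} (hh : HarmonicContOnCl h (ball c R))
    (hpos : ∀ z ∈ closedBall c R, 0 ≤ h z) (hw : w ∈ ball c R) :
    (R - ‖w - c‖) / (R + ‖w - c‖) * h c ≤ h w ∧
      h w ≤ (R + ‖w - c‖) / (R - ‖w - c‖) * h c := by
  have hR : 0 < R := pos_of_mem_ball hw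
  have hcont : ContinuousOn h (sphere c |R|) := by
    rw [abs_of_pos hR]
    exact hh.continuousOn_ball.mono sphere_subset_closedBall
  have hint : CircleIntegrable h c R := hcont.circleIntegrable'
  have hav : Real.circleAverage h c R = h c := by
    apply InnerProductSpace.HarmonicContOnCl.circleAverage_eq
    rwa [abs_of_pos hR]
  have hkint : CircleIntegrable ((Complex.re ∘ herglotzRieszKernel c w) • h) c R := by
    apply ContinuousOn.circleIntegrable'
    exact (Complex.continuous_re.comp_continuousOn
      (continuousOn_herglotzRieszKernel_sphere hw)).smul hcont
  -- Poisson's formula. Both inequalities follow from the pointwise bounds for the Poisson kernel,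
  -- integrated against the nonnegative boundary values, whose mean is `h c`.
  have hpois := hh.circleAverage_re_herglotzRieszKernel_smul hw
  have hsm : ∀ a : ℝ, Real.circleAverage (fun z => a * h z) c R = a * h c := by
    intro a
    have := Real.circleAverage_fun_smul (a := a) (f := h) (c := c) (R := R)
    simpa [hav] using this
  have hcint : ∀ a : ℝ, CircleIntegrable (fun z => a * h z) c R := by
    intro a
    exact (continuousOn_const.mul hcont).circleIntegrable'
  constructor
  · rw [← hsm, ← hpois]
    apply Real.circleAverage_mono (hcint _) hkint
    intro z hz
    rw [abs_of_pos hR] at hz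
    have := le_re_herglotzRieszKernel hz hw
    exact mul_le_mul_of_nonneg_right this (hpos z (sphere_subset_closedBall hz))
  · rw [← hsm, ← hpois]
    apply Real.circleAverage_mono hkint (hcint _)
    intro z hz
    rw [abs_of_pos hR] at hz
    have := re_herglotzRieszKernel_le hz hw
    exact mul_le_mul_of_nonneg_right this (hpos z (sphere_subset_closedBall hz))

theorem norm_normal {c x : ℂ} {R : ℝ} (hR : 0 < R) (hx : x ∈ sphere c R) :
    ‖normal c R x‖ = 1 := by
  rw [normal, norm_smul, norm_inv, Real.norm_of_nonneg hR.le, mem_sphere_iff_norm.1 hx,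
    inv_mul_cancel₀ hR.ne']

theorem eq_center_add_normal {c x : ℂ} {R : ℝ} (hR : 0 < R) :
    x = c + R • normal c R x := by
  rw [normal, smul_smul, mul_inv_cancel₀ hR.ne', one_smul]; ring

/-- Along a segment, the one-sided derivative at the end point is the limit of the
derivatives in the interior. -/
theorem hasDerivWithinAt_ray {u : ℂ → ℝ} {x n : ℂ} {a T : ℝ} (hT : 0 < T)
    (hd : ∀ t ∈ Ioo 0 T, DifferentiableAt ℝ u (x + t • n))
    (hc : ContinuousWithinAt (fun t : ℝ => u (x + t • n)) (Ioo 0 T) 0)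
    (ha : Tendsto (fun t : ℝ => inner ℝ (gradient u (x + t • n)) n) (𝓝[>] 0) (𝓝 a)) :
    HasDerivWithinAt (fun t : ℝ => u (x + t • n)) a (Ici 0) 0 := by
  have hder : ∀ t ∈ Ioo 0 T, HasDerivAt (fun t : ℝ => u (x + t • n))
      (inner ℝ (gradient u (x + t • n)) n) t := by
    intro t ht
    have h1 := (hd t ht).hasFDerivAt
    have h2 : HasDerivAt (fun t : ℝ => x + t • n) n t := by
      simpa using ((hasDerivAt_id t).smul_const n).const_add x
    have := h1.comp_hasDerivAt t h2
    rwa [inner_gradient_left]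
  refine hasDerivWithinAt_Ici_of_tendsto_deriv (s := Ioo 0 T)
    (fun t ht => (hder t ht).differentiableAt.differentiableWithinAt) hc
    (Ioo_mem_nhdsGT hT) (ha.congr' ?_)
  filter_upwards [Ioo_mem_nhdsGT hT] with t ht
  exact (hder t ht).deriv.symm

/-- A one-sided derivative at a maximum. -/
theorem le_of_hasDerivWithinAt_of_le {φ : ℝ → ℝ} {a m T : ℝ} (hT : 0 < T)
    (h : HasDerivWithinAt φ a (Ici 0) 0) (hle : ∀ t ∈ Ioo 0 T, φ t ≤ φ 0 + m * t) : a ≤ m := by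
  have h2 := (hasDerivWithinAt_iff_tendsto_slope' (by simp)).1 h.Ioi_of_Ici
  refine le_of_tendsto h2 ?_
  filter_upwards [Ioo_mem_nhdsGT hT] with t ht
  rw [slope_def_field, sub_zero, div_le_iff₀ ht.1]
  linarith [hle t ht]

/-- The Hopf boundary lemma on a disk. -/
theorem hopf {v : ℂ → ℝ} {c x : ℂ} {R M a : ℝ} (hR : 0 < R)
    (hv : HarmonicContOnCl v (ball c R)) (hM : ∀ z ∈ closedBall c R, v z ≤ M)
    (hx : x ∈ sphere c R) (hvx : v x = M) (ha : HasInnerNormalDeriv v c R x a) :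
    (∀ z ∈ ball c R, v z = M) ∨ 0 < a := by
  set n := normal c R x with hn
  have hnn : ‖n‖ = 1 := norm_normal hR hx
  have hxc : x = c + R • n := eq_center_add_normal hR
  have hh : HarmonicContOnCl (fun z => M - v z) (ball c R) :=
    (harmonicContOnCl_const (c := M)).sub hv
  have hpos : ∀ z ∈ closedBall c R, 0 ≤ M - v z := fun z hz => sub_nonneg.2 (hM z hz)
  -- Either the centre attains the maximum, and the upper Harnack bound forces `v = M` in the disk,
  -- or `M - v c > 0`, and the lower bound makes `M - v` grow at least linearly in the distance to
  -- the circle.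
  have hc0 := hpos c (mem_closedBall_self hR.le)
  rcases hc0.eq_or_lt with h0 | h0
  · left
    intro z hz
    have h1 := (harnack hh hpos hz).2
    have h2 := hpos z (ball_subset_closedBall hz)
    simp only [← h0, mul_zero] at h1
    linarith
  right
  have hmem : ∀ t ∈ Ioo 0 R, x + t • (-n) ∈ ball c R ∧ ‖x + t • (-n) - c‖ = R - t := by
    intro t ht
    have e : x + t • (-n) - c = (R - t) • n := by
      rw [hxc, sub_smul, smul_neg]; abel
    have e2 : ‖x + t • (-n) - c‖ = R - t := by
      rw [e, norm_smul, hnn, mul_one, Real.norm_of_nonneg (by linarith [ht.2])]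
    refine ⟨?_, e2⟩
    rw [mem_ball_iff_norm, e2]; linarith [ht.1]
  have hd : HasDerivWithinAt (fun t : ℝ => v (x + t • (-n))) (-a) (Ici 0) 0 := by
    apply hasDerivWithinAt_ray hR
    · intro t ht
      exact hv.differentiableAt (hmem t ht).1
    · have h1 : ContinuousWithinAt v (closedBall c R) (x + (0 : ℝ) • (-n)) := by
        rw [zero_smul, add_zero]
        exact hv.continuousOn_ball x (sphere_subset_closedBall hx)
      refine h1.comp (t := closedBall c R) (f := fun t : ℝ => x + t • (-n))
        (by fun_prop) ?_
      intro t ht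
      exact ball_subset_closedBall (hmem t ht).1
    · refine (Tendsto.neg ha).congr fun t => ?_
      rw [inner_neg_right, smul_neg, sub_eq_add_neg]
  -- At depth `t` the lower Harnack factor is t/(2R - t), which is at least t/(2R).
  have hle : -a ≤ -((M - v c) / (2 * R)) := by
    refine le_of_hasDerivWithinAt_of_le hR hd fun t ht => ?_
    have h1 := (harnack hh hpos (hmem t ht).1).1
    rw [(hmem t ht).2] at h1
    simp only [zero_smul, add_zero, hvx]
    have h3 : t / (2 * R) * (M - v c) ≤ (R - (R - t)) / (R + (R - t)) * (M - v c) := by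
      apply mul_le_mul_of_nonneg_right _ h0.le
      rw [sub_sub_cancel]
      apply div_le_div_of_nonneg_left ht.1.le <;> linarith [ht.1, ht.2]
    have h4 : t / (2 * R) * (M - v c) = (M - v c) / (2 * R) * t := by ring
    linarith
  have : 0 < (M - v c) / (2 * R) := by positivity
  linarith


/-! ### Uniqueness for the transmission problem -/

section Uniqueness

variable {re ri ε k : ℝ}

theorem isOpen_Shell : IsOpen (Shell re ri ε) := isOpen_ball.sdiff isClosed_closedBall

theorem isOpen_Incl : IsOpen (Incl ri ε) := isOpen_ball

theorem norm_re_sub_center (hε' : ε < re - ri) :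
    ‖((ri + ε : ℝ) : ℂ) - (re : ℂ)‖ = re - ri - ε := by
  rw [← Complex.ofReal_sub, Complex.norm_real, Real.norm_eq_abs, abs_of_neg (by linarith)]; ring

theorem closedBall_incl_subset (hε : 0 < ε) (hε' : ε < re - ri) :
    closedBall ((ri + ε : ℝ) : ℂ) ri ⊆ Om re := by
  intro z hz
  rw [mem_closedBall_iff_norm] at hz
  rw [Om, mem_ball_iff_norm]
  have := norm_add_le (z - ((ri + ε : ℝ) : ℂ)) (((ri + ε : ℝ) : ℂ) - (re : ℂ))
  rw [norm_re_sub_center hε', sub_add_sub_cancel] at this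
  linarith

theorem sub_normal_mem_Incl (hri : 0 < ri) {x : ℂ}
    (hx : x ∈ sphere ((ri + ε : ℝ) : ℂ) ri) {t : ℝ} (ht : t ∈ Ioo 0 ri) :
    x - t • normal ((ri + ε : ℝ) : ℂ) ri x ∈ Incl ri ε := by
  have e := eq_center_add_normal (c := ((ri + ε : ℝ) : ℂ)) (x := x) hri
  have hn := norm_normal hri hx
  set n := normal ((ri + ε : ℝ) : ℂ) ri x
  have e2 : x - t • n - ((ri + ε : ℝ) : ℂ) = (ri - t) • n := by
    nth_rewrite 1 [e]; rw [sub_smul]; abel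
  rw [Incl, mem_ball_iff_norm, e2, norm_smul, hn, mul_one, Real.norm_of_nonneg] <;>
    linarith [ht.1, ht.2]

theorem add_normal_mem_Shell (hri : 0 < ri) (hε' : ε < re - ri) {x : ℂ}
    (hx : x ∈ sphere ((ri + ε : ℝ) : ℂ) ri) {t : ℝ} (ht : t ∈ Ioo 0 ε) :
    x + t • normal ((ri + ε : ℝ) : ℂ) ri x ∈ Shell re ri ε := by
  have e := eq_center_add_normal (c := ((ri + ε : ℝ) : ℂ)) (x := x) hri
  have hn := norm_normal hri hx
  set n := normal ((ri + ε : ℝ) : ℂ) ri x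
  have e2 : x + t • n - ((ri + ε : ℝ) : ℂ) = (ri + t) • n := by
    nth_rewrite 1 [e]; rw [add_smul]; abel
  have e3 : ‖x + t • n - ((ri + ε : ℝ) : ℂ)‖ = ri + t := by
    rw [e2, norm_smul, hn, mul_one, Real.norm_of_nonneg]; linarith [ht.1]
  refine ⟨?_, ?_⟩
  · rw [Om, mem_ball_iff_norm]
    have := norm_add_le (x + t • n - ((ri + ε : ℝ) : ℂ)) (((ri + ε : ℝ) : ℂ) - (re : ℂ))
    rw [norm_re_sub_center hε', sub_add_sub_cancel, e3] at this
    linarith [ht.2]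
  · rw [mem_closedBall_iff_norm, e3]; linarith [ht.1]

theorem le_norm_sub_center (hε' : ε < re - ri) {x : ℂ}
    (hx : x ∈ sphere (re : ℂ) re) : ri + ε ≤ ‖x - ((ri + ε : ℝ) : ℂ)‖ := by
  have := norm_add_le (x - ((ri + ε : ℝ) : ℂ)) (((ri + ε : ℝ) : ℂ) - (re : ℂ))
  rw [norm_re_sub_center hε', sub_add_sub_cancel, mem_sphere_iff_norm.1 hx] at this
  linarith

/-- An interior ball condition: points of ∂Ω are at distance at least ε from D, so a tangent disk of
diameter ε fits in the shell. This makes the Hopf lemma for disks applicable at ∂Ω. -/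
theorem ball_tangent_subset_Shell (hre : 0 < re) (hε : 0 < ε) (hε' : ε < re - ri)
    (hri : 0 < ri) {x : ℂ} (hx : x ∈ sphere (re : ℂ) re) :
    ball (x - (ε / 2) • normal (re : ℂ) re x) (ε / 2) ⊆ Shell re ri ε := by
  intro z hz
  have e := eq_center_add_normal (c := (re : ℂ)) (x := x) hre
  have hn := norm_normal hre hx
  set n := normal (re : ℂ) re x
  rw [mem_ball_iff_norm] at hz
  refine ⟨?_, ?_⟩
  · rw [Om, mem_ball_iff_norm]
    have h1 := norm_add_le (z - (x - (ε / 2) • n)) (x - (ε / 2) • n - re)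
    have e2 : x - (ε / 2) • n - (re : ℂ) = (re - ε / 2) • n := by
      nth_rewrite 1 [e]; rw [sub_smul]; abel
    rw [sub_add_sub_cancel, e2, norm_smul, hn, mul_one, Real.norm_of_nonneg (by linarith)] at h1
    linarith
  · rw [mem_closedBall_iff_norm, not_le]
    have h1 := le_norm_sub_center hε' hx
    have h2 : x - ((ri + ε : ℝ) : ℂ) =
        -(z - (x - (ε / 2) • n)) + (ε / 2) • n + (z - ((ri + ε : ℝ) : ℂ)) := by abel
    have h3 := norm_add₃_le (a := -(z - (x - (ε / 2) • n))) (b := (ε / 2) • n)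
      (c := z - ((ri + ε : ℝ) : ℂ))
    rw [← h2, norm_neg, norm_smul, hn, Real.norm_of_nonneg (by linarith)] at h3
    linarith

theorem sub_normal_mem_Shell (hre : 0 < re) (hε : 0 < ε) (hε' : ε < re - ri)
    (hri : 0 < ri) {x : ℂ} (hx : x ∈ sphere (re : ℂ) re) {t : ℝ} (ht : t ∈ Ioo 0 ε) :
    x - t • normal (re : ℂ) re x ∈ Shell re ri ε := by
  apply ball_tangent_subset_Shell hre hε hε' hri hx
  have hn := norm_normal hre hx
  set n := normal (re : ℂ) re x
  have e : x - t • n - (x - (ε / 2) • n) = (ε / 2 - t) • n := by rw [sub_smul]; abel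
  rw [mem_ball_iff_norm, e, norm_smul, hn, mul_one, Real.norm_eq_abs, abs_lt]
  constructor <;> linarith [ht.1, ht.2]

theorem gradient_sub {u v : ℂ → ℝ} {x : ℂ} (hu : DifferentiableAt ℝ u x)
    (hv : DifferentiableAt ℝ v x) : gradient (u - v) x = gradient u x - gradient v x := by
  simp only [gradient, fderiv_sub hu hv, map_sub]

theorem gradient_neg {u : ℂ → ℝ} {x : ℂ} : gradient (-u) x = -gradient u x := by
  simp only [gradient, fderiv_neg, map_neg]

theorem HasInnerNormalDeriv.neg {u : ℂ → ℝ} {c x : ℂ} {R a : ℝ}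
    (h : HasInnerNormalDeriv u c R x a) : HasInnerNormalDeriv (-u) c R x (-a) := by
  refine (Tendsto.neg h).congr fun t => ?_
  rw [gradient_neg, inner_neg_left]

theorem HasOuterNormalDeriv.neg {u : ℂ → ℝ} {c x : ℂ} {R a : ℝ}
    (h : HasOuterNormalDeriv u c R x a) : HasOuterNormalDeriv (-u) c R x (-a) := by
  refine (Tendsto.neg h).congr fun t => ?_
  rw [gradient_neg, inner_neg_left]

theorem IsSolution.neg {g u : ℂ → ℝ} (h : IsSolution re ri ε k g u) :
    IsSolution re ri ε k (-g) (-u) where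
  continuousOn := h.continuousOn.neg
  harmonic_incl := h.harmonic_incl.neg
  harmonic_shell := h.harmonic_shell.neg
  transmission x hx := by
    obtain ⟨a, h1, h2⟩ := h.transmission x hx
    refine ⟨-a, h1.neg, ?_⟩
    rw [mul_neg]; exact h2.neg
  neumann x hx := (h.neumann x hx).neg

theorem _root_.InnerProductSpace.HarmonicAt.differentiableAt' {u : ℂ → ℝ} {x : ℂ}
    (h : HarmonicAt u x) : DifferentiableAt ℝ u x := h.1.differentiableAt (by norm_num)

theorem HasInnerNormalDeriv.sub {u v : ℂ → ℝ} {c x : ℂ} {R a b T : ℝ} (hT : 0 < T)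
    (hu : ∀ t ∈ Ioo 0 T, DifferentiableAt ℝ u (x - t • normal c R x))
    (hv : ∀ t ∈ Ioo 0 T, DifferentiableAt ℝ v (x - t • normal c R x))
    (h : HasInnerNormalDeriv u c R x a) (h' : HasInnerNormalDeriv v c R x b) :
    HasInnerNormalDeriv (u - v) c R x (a - b) := by
  refine (Tendsto.sub h h').congr' ?_
  filter_upwards [Ioo_mem_nhdsGT hT] with t ht
  rw [gradient_sub (hu t ht) (hv t ht), inner_sub_left]

theorem HasOuterNormalDeriv.sub {u v : ℂ → ℝ} {c x : ℂ} {R a b T : ℝ} (hT : 0 < T)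
    (hu : ∀ t ∈ Ioo 0 T, DifferentiableAt ℝ u (x + t • normal c R x))
    (hv : ∀ t ∈ Ioo 0 T, DifferentiableAt ℝ v (x + t • normal c R x))
    (h : HasOuterNormalDeriv u c R x a) (h' : HasOuterNormalDeriv v c R x b) :
    HasOuterNormalDeriv (u - v) c R x (a - b) := by
  refine (Tendsto.sub h h').congr' ?_
  filter_upwards [Ioo_mem_nhdsGT hT] with t ht
  rw [gradient_sub (hu t ht) (hv t ht), inner_sub_left]

theorem IsSolution.sub (hri : 0 < ri) (hε : 0 < ε) (hε' : ε < re - ri) {g g' u v : ℂ → ℝ}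
    (hu : IsSolution re ri ε k g u) (hv : IsSolution re ri ε k g' v) :
    IsSolution re ri ε k (g - g') (u - v) where
  continuousOn := hu.continuousOn.sub hv.continuousOn
  harmonic_incl := hu.harmonic_incl.sub hv.harmonic_incl
  harmonic_shell := hu.harmonic_shell.sub hv.harmonic_shell
  transmission x hx := by
    obtain ⟨a, h1, h2⟩ := hu.transmission x hx
    obtain ⟨b, h3, h4⟩ := hv.transmission x hx
    refine ⟨a - b, h1.sub hri ?_ ?_ h3, ?_⟩
    · exact fun t ht => (hu.harmonic_incl _ (sub_normal_mem_Incl hri hx ht)).differentiableAt'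
    · exact fun t ht => (hv.harmonic_incl _ (sub_normal_mem_Incl hri hx ht)).differentiableAt'
    rw [mul_sub]
    refine h2.sub hε ?_ ?_ h4
    · exact fun t ht =>
        (hu.harmonic_shell _ (add_normal_mem_Shell hri hε' hx ht)).differentiableAt'
    · exact fun t ht =>
        (hv.harmonic_shell _ (add_normal_mem_Shell hri hε' hx ht)).differentiableAt'
  neumann x hx := by
    have hre : 0 < re := by linarith
    refine (hu.neumann x hx).sub hε ?_ ?_ (hv.neumann x hx)
    · exact fun t ht =>
        (hu.harmonic_shell _ (sub_normal_mem_Shell hre hε hε' hri hx ht)).differentiableAt'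
    · exact fun t ht =>
        (hv.harmonic_shell _ (sub_normal_mem_Shell hre hε hε' hri hx ht)).differentiableAt'

/-- A solution with vanishing flux is equal to its maximum on the inclusion. -/
theorem IsSolution.eq_max_on_incl (hri : 0 < ri) (hε : 0 < ε) (hε' : ε < re - ri)
    (hk : 0 < k) {w : ℂ → ℝ} (hw : IsSolution re ri ε k 0 w) :
    ∃ M, (∀ z ∈ closedBall (re : ℂ) re, w z ≤ M) ∧ ∀ z ∈ Incl ri ε, w z = M := by
  have hre : 0 < re := by linarith
  set c : ℂ := ((ri + ε : ℝ) : ℂ) with hc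
  obtain ⟨x₁, hx₁, hmax⟩ := (isCompact_closedBall (re : ℂ) re).exists_isMaxOn
    ⟨_, mem_closedBall_self hre.le⟩ hw.continuousOn
  set M := w x₁ with hMdef
  have hM : ∀ z ∈ closedBall (re : ℂ) re, w z ≤ M := fun z hz => hmax hz
  refine ⟨M, hM, ?_⟩
  have hE : IsCompact (closedBall (re : ℂ) re ∩ w ⁻¹' {M}) :=
    (isCompact_closedBall (re : ℂ) re).of_isClosed_subset
      (hw.continuousOn.preimage_isClosed_of_isClosed isClosed_closedBall isClosed_singleton)
      inter_subset_left
  -- A maximum point nearest to the centre of the inclusion. From a maximum point outside the closed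
  -- inclusion one could move towards `c` and remain at the maximum, so this choice replaces a
  -- connectedness argument for the shell.
  obtain ⟨x, ⟨hxK, hxM⟩, hmin⟩ := hE.exists_isMinOn ⟨x₁, hx₁, rfl⟩
    (f := fun z => ‖z - c‖) (by fun_prop)
  have hxM : w x = M := hxM
  have hnear : ∀ z ∈ closedBall (re : ℂ) re, w z = M → ‖x - c‖ ≤ ‖z - c‖ :=
    fun z hz hzM => hmin ⟨hz, hzM⟩
  have hsub : closedBall c ri ⊆ closedBall (re : ℂ) re :=
    (closedBall_incl_subset hε hε').trans ball_subset_closedBall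
  have hD : HarmonicContOnCl w (ball c ri) :=
    HarmonicContOnCl.mk_ball hw.harmonic_incl (hw.continuousOn.mono hsub)
  have key : x ∈ closedBall c ri := by
    by_contra hxD
    rw [mem_closedBall_iff_norm, not_le] at hxD
    rcases (mem_closedBall_iff_norm.1 hxK).lt_or_eq with hlt | heq
    · have hxS : x ∈ Shell re ri ε :=
        ⟨by rwa [Om, mem_ball_iff_norm], by rwa [mem_closedBall_iff_norm, not_le]⟩
      obtain ⟨r, hr, hrS⟩ := Metric.isOpen_iff.1 isOpen_Shell x hxS
      have hh : HarmonicContOnCl (fun z => M - w z) (ball x (r / 2)) := by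
        refine (harmonicContOnCl_const (c := M)).sub ?_
        refine HarmonicContOnCl.mk_ball (hw.harmonic_shell.mono ?_) (hw.continuousOn.mono ?_)
        · exact (ball_subset_ball (by linarith)).trans hrS
        · exact (closedBall_subset_ball (by linarith)).trans
            (hrS.trans (sdiff_subset.trans ball_subset_closedBall))
      have hpos : ∀ z ∈ closedBall x (r / 2), 0 ≤ M - w z := fun z hz => sub_nonneg.2
        (hM z (ball_subset_closedBall (hrS (closedBall_subset_ball (by linarith) hz)).1))
      have hxc : 0 < ‖x - c‖ := by linarith
      -- A short step towards `c`, of length at most r/4, stays in the disk on which `M - w` is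
      -- nonnegative and vanishes at the centre, hence vanishes identically.
      set l := min (1 / 2) (r / 4 / ‖x - c‖) with hl
      have hl0 : 0 < l := by positivity
      have hl1 : l ≤ 1 / 2 := min_le_left _ _
      have hl2 : l * ‖x - c‖ ≤ r / 4 := by
        rw [← le_div_iff₀ hxc]; exact min_le_right _ _
      have hzmem : x - l • (x - c) ∈ ball x (r / 2) := by
        rw [mem_ball_iff_norm, sub_sub_cancel_left, norm_neg, norm_smul,
          Real.norm_of_nonneg hl0.le]
        linarith
      have h1 := (harnack hh hpos hzmem).2
      simp only [hxM, sub_self, mul_zero] at h1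
      have h2 := hpos _ (ball_subset_closedBall hzmem)
      have h3 := hnear _ (ball_subset_closedBall
        (hrS (ball_subset_ball (by linarith) hzmem)).1) (by linarith)
      have e : x - l • (x - c) - c = (1 - l) • (x - c) := by rw [sub_smul, one_smul]; abel
      rw [e, norm_smul, Real.norm_of_nonneg (by linarith)] at h3
      nlinarith
    · have hxs : x ∈ sphere (re : ℂ) re := mem_sphere_iff_norm.2 heq
      have hn := norm_normal hre hxs
      have hxe := eq_center_add_normal (c := (re : ℂ)) (x := x) hre
      have hnc := hw.neumann x hxs
      have hsb := ball_tangent_subset_Shell hre hε hε' hri hxs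
      set n := normal (re : ℂ) re x with hndef
      have hn' : normal (x - (ε / 2) • n) (ε / 2) x = n := by
        rw [normal, sub_sub_cancel, smul_smul, inv_mul_cancel₀ (by positivity), one_smul]
      have hcl : closedBall (x - (ε / 2) • n) (ε / 2) ⊆ closedBall (re : ℂ) re := by
        rw [← closure_ball _ (by positivity)]
        exact closure_minimal (hsb.trans (sdiff_subset.trans ball_subset_closedBall))
          isClosed_closedBall
      have hx' : x ∈ sphere (x - (ε / 2) • n) (ε / 2) := by
        rw [mem_sphere_iff_norm, sub_sub_cancel, norm_smul, hn, mul_one,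
          Real.norm_of_nonneg (by positivity)]
      -- The flux is 0, so Hopf leaves only the case `w = M` on the tangent disk. Its centre is then
      -- a maximum point, and it is closer to `c` because the inner product of `x - c` with the
      -- normal is at least ri + ε.
      have hopf' := hopf (v := w) (M := M) (a := 0) (half_pos hε)
        (HarmonicContOnCl.mk_ball (hw.harmonic_shell.mono hsb) (hw.continuousOn.mono hcl))
        (fun z hz => hM z (hcl hz)) hx' hxM (by
          rw [HasInnerNormalDeriv, hn']; exact hnc)
      rcases hopf' with h | h
      · have h3 := hnear _ (hcl (mem_closedBall_self (by positivity)))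
          (h _ (mem_ball_self (by positivity)))
        have e : x - (ε / 2) • n - c = (x - c) - (ε / 2) • n := by abel
        have h4 : re - (re - ri - ε) ≤ inner ℝ (x - c) n := by
          have e5 : x - c = re • n - (c - re) := by nth_rewrite 1 [hxe]; abel
          rw [e5, inner_sub_left, real_inner_smul_left, real_inner_self_eq_norm_sq, hn]
          have := real_inner_le_norm (c - re) n
          rw [hn, norm_re_sub_center hε'] at this
          linarith
        have h5 := norm_sub_sq_real (x - c) ((ε / 2) • n)
        rw [← e, real_inner_smul_right, norm_smul, hn, Real.norm_of_nonneg (by positivity)] at h5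
        have h6 := pow_le_pow_left₀ (norm_nonneg _) h3 2
        nlinarith
      · exact lt_irrefl _ h
  have hMD : ∀ z ∈ closedBall c ri, w z ≤ M := fun z hz => hM z (hsub hz)
  rcases (mem_closedBall_iff_norm.1 key).lt_or_eq with hlt | heq
  · have hxball : x ∈ ball c ri := mem_ball_iff_norm.2 hlt
    have hh : HarmonicContOnCl (fun z => M - w z) (ball c ri) :=
      (harmonicContOnCl_const (c := M)).sub hD
    have hpos : ∀ z ∈ closedBall c ri, 0 ≤ M - w z := fun z hz => sub_nonneg.2 (hMD z hz)
    have h1 := (harnack hh hpos hxball).1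
    simp only [hxM, sub_self] at h1
    have h2 : 0 < (ri - ‖x - c‖) / (ri + ‖x - c‖) :=
      div_pos (by linarith) (by positivity)
    have h3 : M - w c = 0 := le_antisymm (by
      by_contra h; push Not at h; nlinarith [mul_pos h2 h]) (hpos c (mem_closedBall_self hri.le))
    intro z hz
    have h4 := (harnack hh hpos hz).2
    have h5 := hpos z (ball_subset_closedBall hz)
    simp only [h3, mul_zero] at h4
    linarith
  · have hxs : x ∈ sphere c ri := mem_sphere_iff_norm.2 heq
    obtain ⟨a, hin, hout⟩ := hw.transmission x hxs
    rcases hopf hri hD hMD hxs hxM hin with h | h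
    · exact h
    exfalso
    have hmem := fun t (ht : t ∈ Ioo 0 ε) => add_normal_mem_Shell hri hε' hxs ht
    set n := normal c ri x with hndef
    -- Hopf from inside gives `a > 0`; by transmission the outward derivative `k * a` on the shell
    -- side is positive too, which is impossible at a maximum.
    have hd : HasDerivWithinAt (fun t : ℝ => w (x + t • n)) (k * a) (Ici 0) 0 := by
      apply hasDerivWithinAt_ray hε
      · exact fun t ht => (hw.harmonic_shell _ (hmem t ht)).differentiableAt'
      · have h1 : ContinuousWithinAt w (closedBall (re : ℂ) re) (x + (0 : ℝ) • n) := by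
          rw [zero_smul, add_zero]
          exact hw.continuousOn x hxK
        refine h1.comp (t := closedBall (re : ℂ) re) (f := fun t : ℝ => x + t • n)
          (by fun_prop) ?_
        intro t ht
        exact ball_subset_closedBall (hmem t ht).1
      · exact hout
    have := le_of_hasDerivWithinAt_of_le (m := 0) hε hd fun t ht => by
      simp only [zero_smul, add_zero, zero_mul, hxM]
      exact hM _ (ball_subset_closedBall (hmem t ht).1)
    nlinarith [mul_pos hk h]

/-- Two solutions of the transmission problem have the same gradient. -/
theorem IsSolution.gradient_eq (hri : 0 < ri) (hε : 0 < ε) (hε' : ε < re - ri)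
    (hk : 0 < k) {g u v : ℂ → ℝ} (hu : IsSolution re ri ε k g u)
    (hv : IsSolution re ri ε k g v) {x : ℂ} (hx : x ∈ Incl ri ε ∪ Shell re ri ε) :
    gradient u x = gradient v x := by
  have hw := hu.sub hri hε hε' hv
  rw [sub_self] at hw
  have hw' := hw.neg
  rw [neg_zero] at hw'
  -- Applied to the difference and to its negative, the lemma places both the maximum and the
  -- minimum on the inclusion, where the function is constant; the two values agree.
  obtain ⟨M, hM, hMi⟩ := hw.eq_max_on_incl hri hε hε' hk
  obtain ⟨M', hM', hMi'⟩ := hw'.eq_max_on_incl hri hε hε' hk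
  have hc : ((ri + ε : ℝ) : ℂ) ∈ Incl ri ε := mem_ball_self hri
  have h1 := hMi _ hc
  have h2 := hMi' _ hc
  simp only [Pi.neg_apply] at h2
  have hconst : ∀ z ∈ closedBall (re : ℂ) re, (u - v) z = M := fun z hz => by
    have h3 := hM z hz
    have h4 := hM' z hz
    simp only [Pi.neg_apply] at h4
    linarith
  have hnhds : Incl ri ε ∪ Shell re ri ε ∈ 𝓝 x := (isOpen_Incl.union isOpen_Shell).mem_nhds hx
  have hsub : Incl ri ε ∪ Shell re ri ε ⊆ closedBall (re : ℂ) re :=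
    union_subset (ball_subset_closedBall.trans
      ((closedBall_incl_subset hε hε').trans ball_subset_closedBall))
      (sdiff_subset.trans ball_subset_closedBall)
  have h5 : gradient (u - v) x = 0 := by
    have : (u - v) =ᶠ[𝓝 x] fun _ => M := by
      filter_upwards [hnhds] with z hz using hconst z (hsub hz)
    rw [this.gradient_eq, gradient_fun_const]
  have hd : ∀ {f : ℂ → ℝ}, IsSolution re ri ε k g f → DifferentiableAt ℝ f x := fun hf =>
    hx.elim (fun h => (hf.harmonic_incl x h).differentiableAt')
      (fun h => (hf.harmonic_shell x h).differentiableAt')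
  rw [gradient_sub (hd hu) (hd hv)] at h5
  exact sub_eq_zero.1 h5

end Uniqueness

/-! ### Holomorphic functions and gradients of their real parts -/

/-- The Cauchy–Riemann equations. With this identification every directional derivative below is the
real part of a product of complex numbers. -/
theorem hasGradientAt_re {F : ℂ → ℂ} {F' x : ℂ} (h : HasDerivAt F F' x) :
    HasGradientAt (fun y => (F y).re) (conj F') x := by
  rw [hasGradientAt_iff_hasFDerivAt]
  have h1 := Complex.reCLM.hasFDerivAt.comp x (h.hasFDerivAt.restrictScalars ℝ)
  convert! h1 using 1
  ext v
  simp [Complex.inner, mul_comm]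

theorem inner_conj_left (a b : ℂ) : inner ℝ (conj a) b = (a * b).re := by
  simp [Complex.inner, mul_comm]

/-! ### Differentiation of integrals depending on a complex parameter -/

theorem hasDerivAt_integral_param {K K' : ℂ → ℝ → ℂ} {U : Set ℂ} (hU : IsOpen U) {a b : ℝ}
    (hK : ∀ x ∈ U, Continuous (K x))
    (hK' : ContinuousOn (Function.uncurry K') (U ×ˢ univ))
    (hd : ∀ x ∈ U, ∀ t, HasDerivAt (fun y => K y t) (K' x t) x) {x : ℂ} (hx : x ∈ U) :
    HasDerivAt (fun y => ∫ t in a..b, K y t) (∫ t in a..b, K' x t) x := by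
  obtain ⟨r, hr, hrU⟩ := Metric.isOpen_iff.1 hU x hx
  have hsub : closedBall x (r / 2) ⊆ U := (closedBall_subset_ball (by linarith)).trans hrU
  have hcomp : IsCompact (closedBall x (r / 2) ×ˢ uIcc a b) :=
    (isCompact_closedBall _ _).prod isCompact_uIcc
  obtain ⟨C, hC⟩ := hcomp.exists_bound_of_continuousOn
    (hK'.mono (prod_mono hsub (subset_univ _)))
  refine (intervalIntegral.hasDerivAt_integral_of_dominated_loc_of_deriv_le (𝕜 := ℂ)
    (s := closedBall x (r / 2)) (bound := fun _ => C)
    (closedBall_mem_nhds _ (by positivity)) ?_ ((hK x hx).intervalIntegrable _ _) ?_ ?_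
    (by simp) ?_).2
  · filter_upwards [hU.mem_nhds hx] with y hy using (hK y hy).aestronglyMeasurable
  · have : Continuous (K' x) := by
      have := hK'.comp_continuous (f := fun t : ℝ => (x, t)) (by fun_prop)
        (fun t => ⟨hx, mem_univ _⟩)
      exact this
    exact this.aestronglyMeasurable
  · refine Eventually.of_forall fun t ht y hy => ?_
    exact hC (y, t) ⟨hy, uIoc_subset_uIcc ht⟩
  · exact Eventually.of_forall fun t _ y hy => hd y (hsub hy) t

/-! ### Elementary facts on the boundary circle -/

/-- The chord has length 2R |sin((s - t)/2)|, and Jordan's inequality applies since |s - t|/2 ≤ π/2.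
-/
theorem norm_circleMap_sub_circleMap_ge {R : ℝ} {c : ℂ} (hR : 0 < R) {s t : ℝ}
    (h : |s - t| ≤ Real.pi) :
    2 * R / Real.pi * |s - t| ≤ ‖circleMap c R s - circleMap c R t‖ := by
  have e : circleMap c R s - circleMap c R t =
      R * Complex.exp (t * Complex.I) * (Complex.exp (Complex.I * ((s - t : ℝ) : ℂ)) - 1) := by
    simp only [circleMap]
    rw [mul_sub, mul_assoc (R : ℂ), ← Complex.exp_add]
    have : (t : ℂ) * Complex.I + Complex.I * ((s - t : ℝ) : ℂ) = s * Complex.I := by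
      push_cast; ring
    rw [this]; ring
  rw [e, norm_mul, norm_mul, Complex.norm_exp_ofReal_mul_I, Complex.norm_real,
    Real.norm_of_nonneg hR.le, Complex.norm_exp_I_mul_ofReal_sub_one, norm_mul,
    Real.norm_eq_abs, Real.norm_eq_abs, abs_two, mul_one]
  have h1 : 2 / Real.pi * (|s - t| / 2) ≤ |Real.sin ((s - t) / 2)| := by
    have h2 : |Real.sin ((s - t) / 2)| = Real.sin (|s - t| / 2) := by
      rw [← abs_of_pos (show (0 : ℝ) < 2 by norm_num), ← abs_div, abs_of_pos
        (show (0 : ℝ) < 2 by norm_num)]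
      apply Real.abs_sin_eq_sin_abs_of_abs_le_pi
      rw [abs_div, abs_two]; linarith [abs_nonneg (s - t)]
    rw [h2]
    exact Real.mul_le_sin (by positivity) (by linarith)
  calc 2 * R / Real.pi * |s - t| = R * (2 * (2 / Real.pi * (|s - t| / 2))) := by ring
    _ ≤ _ := by gcongr

/-- The point of the circle with angle `t` is a nearest one to `x`, so the triangle inequality
through `x` costs only a factor 2. The bound is uniform as `x` approaches the circle. -/
theorem norm_circleMap_sub_circleMap_le_of_ray {R ρ t s : ℝ} {c x : ℂ} (hρ : 0 ≤ ρ)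
    (hρR : ρ ≤ R) (hx : x = circleMap c ρ t) :
    ‖circleMap c R s - circleMap c R t‖ ≤ 2 * ‖circleMap c R s - x‖ ∧
      R - ρ ≤ ‖circleMap c R s - x‖ := by
  have h1 : ‖circleMap c R s - c‖ = R := by
    rw [circleMap_sub_center, norm_circleMap_zero, abs_of_nonneg (by linarith)]
  have h2 : ‖x - c‖ = ρ := by
    rw [hx, circleMap_sub_center, norm_circleMap_zero, abs_of_nonneg hρ]
  have h3 : R - ρ ≤ ‖circleMap c R s - x‖ := by
    have := norm_sub_norm_le (circleMap c R s - c) (x - c)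
    rw [h1, h2, sub_sub_sub_cancel_right] at this
    exact this
  have h4 : ‖circleMap c R t - x‖ = R - ρ := by
    have : circleMap c R t - x = circleMap 0 (R - ρ) t := by
      rw [hx]; simp only [circleMap]; push_cast; ring
    rw [this, norm_circleMap_zero, abs_of_nonneg (by linarith)]
  refine ⟨?_, h3⟩
  calc ‖circleMap c R s - circleMap c R t‖
      = ‖(circleMap c R s - x) - (circleMap c R t - x)‖ := by rw [sub_sub_sub_cancel_right]
    _ ≤ ‖circleMap c R s - x‖ + ‖circleMap c R t - x‖ := norm_sub_le _ _
    _ ≤ _ := by rw [h4]; linarith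

theorem circleMap_ne_of_mem_ball {R : ℝ} {c x : ℂ} (hx : x ∈ ball c R) (t : ℝ) :
    x - circleMap c R t ≠ 0 := by
  rw [sub_ne_zero]
  rintro rfl
  have hR := pos_of_mem_ball hx
  rw [mem_ball_iff_norm, circleMap_sub_center, norm_circleMap_zero, abs_of_pos hR] at hx
  exact lt_irrefl _ hx

theorem exists_eq_circleMap (c x : ℂ) : ∃ t : ℝ, x = circleMap c ‖x - c‖ t :=
  ⟨Complex.arg (x - c), by
    rw [circleMap, Complex.norm_mul_exp_arg_mul_I]; ring⟩

/-- With dt = dz/(i(z - c)) the integrand has poles at `c` and `x` whose residues cancel; for `x =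
c` there is a double pole without residue. Hence a constant may be subtracted from the density of a
Cauchy type integral taken in the angle. -/
theorem integral_inv_sub_circleMap {R : ℝ} {c x : ℂ} (hx : x ∈ ball c R) :
    ∫ t in (0 : ℝ)..(2 * Real.pi), (x - circleMap c R t)⁻¹ = 0 := by
  have hR := pos_of_mem_ball hx
  have hne := fun t => circleMap_ne_of_mem_ball hx t
  have hne' : ∀ t, circleMap c R t - c ≠ 0 := fun t => by
    simpa using circleMap_ne_center hR.ne' (c := c) (θ := t) |> sub_ne_zero.2
  have h1 : (∮ z in C(c, R), (z - c)⁻¹ * (x - z)⁻¹) =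
      Complex.I * ∫ t in (0 : ℝ)..(2 * Real.pi), (x - circleMap c R t)⁻¹ := by
    rw [circleIntegral, ← intervalIntegral.integral_const_mul]
    refine intervalIntegral.integral_congr fun t _ => ?_
    simp only [deriv_circleMap, smul_eq_mul]
    rw [circleMap_sub_center] at *
    have : circleMap 0 R t ≠ 0 := by simpa using hne' t
    field_simp
  have h2 : (∮ z in C(c, R), (z - c)⁻¹ * (x - z)⁻¹) = 0 := by
    by_cases hxc : x = c
    · subst hxc
      have := circleIntegral.integral_sub_zpow_of_ne (n := -2) (by norm_num) x x R
      have e : (fun z : ℂ => (z - x)⁻¹ * (x - z)⁻¹) = fun z => (-1 : ℂ) • ((z - x) ^ (-2 : ℤ)) := by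
        funext z
        rw [smul_eq_mul, neg_one_mul, ← neg_sub z x, inv_neg, mul_neg, ← mul_inv, ← sq]; rfl
      rw [e, circleIntegral.integral_smul, this, smul_zero]
    · have hxc' : x - c ≠ 0 := sub_ne_zero.2 hxc
      have e : EqOn (fun z : ℂ => (z - c)⁻¹ * (x - z)⁻¹)
          (fun z => (x - c)⁻¹ • ((z - c)⁻¹ - (z - x)⁻¹)) (sphere c R) := by
        intro z hz
        have h3 : z - c ≠ 0 := by
          intro h; rw [mem_sphere_iff_norm, h, norm_zero] at hz; exact hR.ne hz
        have h4 : z - x ≠ 0 := by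
          intro h
          rw [sub_eq_zero] at h
          subst h
          exact (mem_ball.1 hx).ne hz
        have h5 : x - z ≠ 0 := by rwa [← neg_ne_zero, neg_sub]
        simp only [smul_eq_mul]
        rw [← neg_sub x z, inv_neg]
        field_simp
        ring
      rw [circleIntegral.integral_congr hR.le e, circleIntegral.integral_smul,
        circleIntegral.integral_sub, circleIntegral.integral_sub_inv_of_mem_ball hx,
        circleIntegral.integral_sub_inv_of_mem_ball (mem_ball_self hR), sub_self, smul_zero]
      · apply ContinuousOn.circleIntegrable hR.le
        refine ContinuousOn.inv₀ (by fun_prop) fun z hz h => ?_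
        rw [mem_sphere_iff_norm, h, norm_zero] at hz; exact hR.ne hz
      · apply ContinuousOn.circleIntegrable hR.le
        refine ContinuousOn.inv₀ (by fun_prop) fun z hz h => ?_
        rw [sub_eq_zero] at h
        subst h
        exact (mem_ball.1 hx).ne hz
  rw [h2] at h1
  exact (mul_eq_zero.1 h1.symm).resolve_left Complex.I_ne_zero

/-- A Cauchy type integral with a periodic Hölder density, measured along the angle, is bounded
in the disk. -/
theorem exists_bound_integral_div_sub_circleMap {R δ K L : ℝ} {c : ℂ} (hR : 0 < R) (hδ : 0 < δ)
    (hK : 0 ≤ K) (hL : 0 ≤ L)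
    {p : ℝ → ℂ} (hp : Continuous p) (hper : Function.Periodic p (2 * Real.pi))
    (hH : ∀ s t, ‖p s - p t‖ ≤ K * |s - t| ^ δ + L * |s - t|) :
    ∃ C, ∀ x ∈ ball c R,
      ‖∫ t in (0 : ℝ)..(2 * Real.pi), p t / (x - circleMap c R t)‖ ≤ C := by
  have hpi := Real.pi_pos
  have hR' := hR.ne'
  set bd : ℝ → ℝ := fun s => Real.pi / R * (K * |s| ^ (δ - 1) + L) with hbd
  refine ⟨∫ s in (-Real.pi)..Real.pi, bd s, fun x hx => ?_⟩
  obtain ⟨t₀, ht₀⟩ := exists_eq_circleMap c x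
  set ρ := ‖x - c‖
  have hρ : 0 ≤ ρ := norm_nonneg _
  have hρR : ρ ≤ R := (mem_ball_iff_norm.1 hx).le
  have hne := fun t => circleMap_ne_of_mem_ball hx t
  have hcinv : Continuous fun t => (x - circleMap c R t)⁻¹ :=
    Continuous.inv₀ (by fun_prop) hne
  -- Subtracting the value of `p` at the angle of `x` makes the numerator vanish at the nearest
  -- point of the circle. With |x - ζ| ≥ (R/π)|s| the quotient is dominated by |s|^(δ - 1) plus a
  -- constant, which is integrable.
  have e1 : ∫ t in (0 : ℝ)..(2 * Real.pi), p t / (x - circleMap c R t) =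
      ∫ t in (0 : ℝ)..(2 * Real.pi), (p t - p t₀) / (x - circleMap c R t) := by
    have h1 : ∀ t, (p t - p t₀) / (x - circleMap c R t) =
        p t / (x - circleMap c R t) - p t₀ * (x - circleMap c R t)⁻¹ := fun t => by
      rw [sub_div, div_eq_mul_inv (p t₀)]
    simp_rw [h1]
    rw [intervalIntegral.integral_sub, intervalIntegral.integral_const_mul,
      integral_inv_sub_circleMap hx, mul_zero, sub_zero]
    · exact ((hp.mul hcinv)).intervalIntegrable _ _
    · exact (continuous_const.mul hcinv).intervalIntegrable _ _
  have hper2 : Function.Periodic (fun t => (p t - p t₀) / (x - circleMap c R t))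
      (2 * Real.pi) := fun t => by
    simp only [hper t, periodic_circleMap c R t]
  have e2 : ∫ t in (0 : ℝ)..(2 * Real.pi), (p t - p t₀) / (x - circleMap c R t) =
      ∫ s in (-Real.pi)..Real.pi, (p (s + t₀) - p t₀) / (x - circleMap c R (s + t₀)) := by
    rw [intervalIntegral.integral_comp_add_right
      (fun t => (p t - p t₀) / (x - circleMap c R t))]
    have := hper2.intervalIntegral_add_eq 0 (-Real.pi + t₀)
    rw [zero_add] at this
    rw [this]; congr 1; ring
  rw [e1, e2]
  have hi : IntervalIntegrable (fun s : ℝ => |s| ^ (δ - 1)) volume (-Real.pi) Real.pi := by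
    have h0 : IntervalIntegrable (fun s : ℝ => |s| ^ (δ - 1)) volume 0 Real.pi := by
      refine (intervalIntegral.intervalIntegrable_rpow' (r := δ - 1) (by linarith)).congr ?_
      intro s hs
      rw [uIoc_of_le hpi.le] at hs
      simp only [abs_of_pos hs.1]
    have h1 : IntervalIntegrable (fun s : ℝ => |s| ^ (δ - 1)) volume (-Real.pi) 0 := by
      have := (h0.comp_sub_left 0).symm
      simpa using this
    exact h1.trans h0
  refine intervalIntegral.norm_integral_le_of_norm_le (by linarith)
    (Eventually.of_forall fun s hs => ?_) ?_
  · have hsabs : |s| ≤ Real.pi := abs_le.2 ⟨hs.1.le, hs.2⟩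
    rw [norm_div]
    have h1 := norm_circleMap_sub_circleMap_ge (c := c) hR (s := s + t₀) (t := t₀)
      (by simpa using hsabs)
    have h2 := (norm_circleMap_sub_circleMap_le_of_ray (s := s + t₀) hρ hρR ht₀).1
    rw [add_sub_cancel_right] at h1
    have h3 : R / Real.pi * |s| ≤ ‖x - circleMap c R (s + t₀)‖ := by
      rw [norm_sub_rev]
      have : 2 * R / Real.pi * |s| = 2 * (R / Real.pi * |s|) := by ring
      linarith
    have h4 := hH (s + t₀) t₀
    rw [add_sub_cancel_right] at h4
    rcases eq_or_ne s 0 with rfl | hs0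
    · simp only [zero_add, sub_self, norm_zero, zero_div]
      positivity
    · have hs0' : 0 < |s| := abs_pos.2 hs0
      rw [div_le_iff₀ (lt_of_lt_of_le (by positivity) h3)]
      refine h4.trans ?_
      have h5 : |s| ^ δ = |s| ^ (δ - 1) * |s| := by
        rw [← Real.rpow_add_one hs0'.ne', sub_add_cancel]
      calc K * |s| ^ δ + L * |s| = bd s * (R / Real.pi * |s|) := by
            rw [h5]; simp only [hbd]; field_simp
        _ ≤ _ := by
            apply mul_le_mul_of_nonneg_left h3
            simp only [hbd]; positivity
  · exact ((hi.const_mul K).add (by simp)).const_mul _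

/-! ### The holomorphic background field -/

/-- The Cauchy integral whose conjugate is the gradient of `bgField`. -/
noncomputable def cauchyField (re : ℝ) (g : ℂ → ℝ) (x : ℂ) : ℂ :=
  ∫ t in (0 : ℝ)..(2 * Real.pi),
    (x - circleMap re re t)⁻¹ * ((-(re / Real.pi * g (circleMap re re t)) : ℝ) : ℂ)

/-- The derivative of `cauchyField`. -/
noncomputable def cauchyFieldDeriv (re : ℝ) (g : ℂ → ℝ) (x : ℂ) : ℂ :=
  ∫ t in (0 : ℝ)..(2 * Real.pi),
    (-((x - circleMap re re t) ^ 2)⁻¹) * ((-(re / Real.pi * g (circleMap re re t)) : ℝ) : ℂ)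

/-- A holomorphic function with real part `bgField`. -/
noncomputable def complexField (re : ℝ) (g : ℂ → ℝ) (x : ℂ) : ℂ :=
  ∫ t in (0 : ℝ)..(2 * Real.pi),
    Complex.log (1 + -((x - re) / (circleMap re re t - re))) *
      ((-(re / Real.pi * g (circleMap re re t)) : ℝ) : ℂ)

section BackgroundField

variable {re : ℝ} {g : ℂ → ℝ}

theorem continuousOn_sub_circleMap_inv : ContinuousOn
    (Function.uncurry fun (x : ℂ) (t : ℝ) => (x - circleMap re re t)⁻¹) (Om re ×ˢ univ) := by
  refine ContinuousOn.inv₀ (Continuous.continuousOn ?_) ?_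
  · exact continuous_fst.sub ((continuous_circleMap _ _).comp continuous_snd)
  · rintro ⟨x, t⟩ ⟨hx, -⟩
    exact circleMap_ne_of_mem_ball hx t

theorem norm_div_circleMap_lt_one {x : ℂ} (hx : x ∈ Om re) (t : ℝ) :
    ‖-((x - re) / (circleMap re re t - re))‖ < 1 := by
  have hre : 0 < re := pos_of_mem_ball hx
  rw [norm_neg, norm_div, circleMap_sub_center, norm_circleMap_zero, abs_of_pos hre,
    div_lt_one hre]
  exact mem_ball_iff_norm.1 hx

theorem circleMap_sub_center_ne_zero (hre : 0 < re) (t : ℝ) :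
    circleMap (re : ℂ) re t - re ≠ 0 :=
  sub_ne_zero.2 (circleMap_ne_center hre.ne')

theorem continuous_weight (hg : Continuous fun t : ℝ => g (circleMap (re : ℂ) re t)) :
    Continuous fun t : ℝ => ((-(re / Real.pi * g (circleMap re re t)) : ℝ) : ℂ) :=
  Complex.continuous_ofReal.comp (continuous_const.mul hg).neg

theorem hasDerivAt_complexField (hg : Continuous fun t : ℝ => g (circleMap (re : ℂ) re t))
    {x : ℂ} (hx : x ∈ Om re) : HasDerivAt (complexField re g) (cauchyField re g x) x := by
  have hre : 0 < re := pos_of_mem_ball hx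
  have hne := circleMap_sub_center_ne_zero hre
  refine hasDerivAt_integral_param (U := Om re) isOpen_ball
    (K' := fun (x : ℂ) (t : ℝ) => (x - circleMap re re t)⁻¹ *
      ((-(re / Real.pi * g (circleMap re re t)) : ℝ) : ℂ)) ?_ ?_ ?_ hx
  · intro y hy
    refine Continuous.mul (Continuous.clog ?_ fun t =>
      Complex.mem_slitPlane_of_norm_lt_one (norm_div_circleMap_lt_one hy t))
      (continuous_weight hg)
    refine continuous_const.add (Continuous.neg (Continuous.div continuous_const
      (by fun_prop) hne))
  · exact continuousOn_sub_circleMap_inv.mul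
      ((continuous_weight hg).comp continuous_snd).continuousOn
  · intro y hy t
    have h1 : HasDerivAt (fun y : ℂ => 1 + -((y - re) / (circleMap re re t - re)))
        (-(1 / (circleMap re re t - re))) y :=
      ((((hasDerivAt_id y).sub_const (re : ℂ)).div_const _).neg).const_add 1
    have h2 := (h1.clog (Complex.mem_slitPlane_of_norm_lt_one
      (norm_div_circleMap_lt_one hy t))).mul_const
      ((-(re / Real.pi * g (circleMap re re t)) : ℝ) : ℂ)
    convert! h2 using 2
    have h3 := circleMap_ne_of_mem_ball hy t
    have h4 := hne t
    have h5 : (1 : ℂ) + -((y - re) / (circleMap re re t - re)) =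
        -(y - circleMap re re t) / (circleMap re re t - re) := by
      field_simp; ring
    rw [h5]
    field_simp

theorem hasDerivAt_cauchyField (hg : Continuous fun t : ℝ => g (circleMap (re : ℂ) re t))
    {x : ℂ} (hx : x ∈ Om re) : HasDerivAt (cauchyField re g) (cauchyFieldDeriv re g x) x := by
  refine hasDerivAt_integral_param (U := Om re) isOpen_ball
    (K' := fun (x : ℂ) (t : ℝ) => (-((x - circleMap re re t) ^ 2)⁻¹) *
      ((-(re / Real.pi * g (circleMap re re t)) : ℝ) : ℂ)) ?_ ?_ ?_ hx
  · intro y hy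
    exact (Continuous.inv₀ (by fun_prop) fun t => circleMap_ne_of_mem_ball hy t).mul
      (continuous_weight hg)
  · refine ContinuousOn.mul ?_ ((continuous_weight hg).comp continuous_snd).continuousOn
    refine ((continuousOn_sub_circleMap_inv (re := re)).pow 2).neg.congr ?_
    rintro ⟨y, t⟩ -
    simp [Function.uncurry]
  · intro y hy t
    have h3 := circleMap_ne_of_mem_ball hy t
    have h1 := (((hasDerivAt_id y).sub_const (circleMap (re : ℂ) re t)).inv h3).mul_const
      ((-(re / Real.pi * g (circleMap re re t)) : ℝ) : ℂ)
    convert! h1 using 2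
    simp only [id]
    rw [neg_div, one_div]

/-- On the circle ln|x - ζ| = ln re + Re log(1 - (x - re)/(ζ - re)), and the mean zero condition
removes the constant. The normalisation keeps the argument of the logarithm in the unit disk about
1, where the principal branch is holomorphic. -/
theorem bgField_eq_re (hg : Continuous fun t : ℝ => g (circleMap (re : ℂ) re t))
    (hg0 : IsMeanZero re g) {x : ℂ} (hx : x ∈ Om re) :
    bgField re g x = (complexField re g x).re := by
  have hre : 0 < re := pos_of_mem_ball hx
  have hne := circleMap_sub_center_ne_zero hre
  have hcont : Continuous fun t => Complex.log (1 + -((x - re) / (circleMap re re t - re))) :=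
    Continuous.clog (continuous_const.add (Continuous.neg (Continuous.div continuous_const
      (by fun_prop) hne))) fun t =>
      Complex.mem_slitPlane_of_norm_lt_one (norm_div_circleMap_lt_one hx t)
  have h1 : (complexField re g x).re = ∫ t in (0 : ℝ)..(2 * Real.pi),
      (Complex.log (1 + -((x - re) / (circleMap re re t - re))) *
      ((-(re / Real.pi * g (circleMap re re t)) : ℝ) : ℂ)).re := by
    have := Complex.reCLM.intervalIntegral_comp_comm (μ := volume) (a := 0)
      (b := 2 * Real.pi) ((hcont.mul (continuous_weight hg)).intervalIntegrable _ _)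
    exact this.symm
  have h2 : ∀ t, Real.log ‖x - circleMap re re t‖ * g (circleMap re re t) * re =
      Real.log re * (g (circleMap re re t) * re) + -Real.pi *
      (Complex.log (1 + -((x - re) / (circleMap re re t - re))) *
      ((-(re / Real.pi * g (circleMap re re t)) : ℝ) : ℂ)).re := fun t => by
    have h3 := circleMap_ne_of_mem_ball hx t
    have h4 := hne t
    have h5 : (1 : ℂ) + -((x - re) / (circleMap re re t - re)) =
        -(x - circleMap re re t) / (circleMap re re t - re) := by
      field_simp; ring
    rw [Complex.re_mul_ofReal, Complex.log_re, h5, norm_div, norm_neg, circleMap_sub_center,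
      norm_circleMap_zero, abs_of_pos hre, Real.log_div (norm_ne_zero_iff.2 h3) hre.ne']
    field_simp [Real.pi_ne_zero]
    ring
  rw [bgField, singleLayer, h1]
  simp_rw [h2]
  rw [intervalIntegral.integral_add, intervalIntegral.integral_const_mul,
    intervalIntegral.integral_const_mul, show (∫ t in (0 : ℝ)..(2 * Real.pi),
      g (circleMap (re : ℂ) re t) * re) = 0 from hg0]
  · field_simp [Real.pi_ne_zero]; ring
  · exact (continuous_const.mul (hg.mul continuous_const)).intervalIntegrable _ _
  · exact (continuous_const.mul (Complex.continuous_re.comp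
      (hcont.mul (continuous_weight hg)))).intervalIntegrable _ _

theorem hasGradientAt_bgField (hg : Continuous fun t : ℝ => g (circleMap (re : ℂ) re t))
    (hg0 : IsMeanZero re g) {x : ℂ} (hx : x ∈ Om re) :
    HasGradientAt (bgField re g) (conj (cauchyField re g x)) x := by
  refine (hasGradientAt_re (hasDerivAt_complexField hg hx)).congr_of_eventuallyEq ?_
  filter_upwards [isOpen_ball.mem_nhds hx] with y hy using bgField_eq_re hg hg0 hy

theorem exists_bound_of_periodic {E : Type*} [NormedAddCommGroup E] {f : ℝ → E} {T : ℝ}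
    (hT : 0 < T) (hf : Continuous f) (hp : Function.Periodic f T) : ∃ C, ∀ t, ‖f t‖ ≤ C := by
  obtain ⟨C, hC⟩ := isCompact_Icc.exists_bound_of_continuousOn (s := Icc 0 T) hf.continuousOn
  refine ⟨C, fun t => ?_⟩
  obtain ⟨y, hy, h⟩ := hp.exists_mem_Ico₀ hT t
  rw [h]; exact hC y ⟨hy.1, hy.2.le⟩

theorem periodic_boundary : Function.Periodic (fun t : ℝ => g (circleMap (re : ℂ) re t))
    (2 * Real.pi) := fun t => by simp only [periodic_circleMap (re : ℂ) re t]

theorem periodic_deriv {f : ℝ → ℝ} {T : ℝ} (h : Function.Periodic f T) :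
    Function.Periodic (deriv f) T := fun t => by
  rw [← deriv_comp_add_const]
  congr 1
  funext s
  exact h s

theorem lipschitz_boundary {δ : ℝ} (hg : IsC1Holder re δ g) :
    ∃ B, 0 ≤ B ∧ (∀ t, ‖deriv (fun t : ℝ => g (circleMap (re : ℂ) re t)) t‖ ≤ B) ∧
      ∀ s t, |g (circleMap (re : ℂ) re s) - g (circleMap (re : ℂ) re t)| ≤ B * |s - t| := by
  obtain ⟨B, hB⟩ := exists_bound_of_periodic Real.two_pi_pos (hg.1.continuous_deriv le_rfl)
    (periodic_deriv periodic_boundary)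
  refine ⟨B, (norm_nonneg _).trans (hB 0), hB, fun s t => ?_⟩
  have := Convex.norm_image_sub_le_of_norm_deriv_le (𝕜 := ℝ) (s := univ)
    (f := fun t : ℝ => g (circleMap (re : ℂ) re t)) (x := t) (y := s)
    (fun x _ => (hg.1.differentiable (by norm_num)) x) (fun x _ => hB x) convex_univ
    (mem_univ _) (mem_univ _)
  simpa using this

/-- The derivative of the background field is bounded: this is where the Hölder regularity
of the flux is used. -/
theorem exists_bound_cauchyFieldDeriv (hre : 0 < re) {δ : ℝ} (hδ : 0 < δ)
    (hg : IsC1Holder re δ g) : ∃ L, 0 ≤ L ∧ ∀ x ∈ Om re, ‖cauchyFieldDeriv re g x‖ ≤ L := by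
  set G : ℝ → ℝ := fun t : ℝ => g (circleMap (re : ℂ) re t) with hG
  have hGd : ∀ t, HasDerivAt G (deriv G t) t := fun t =>
    ((hg.1.differentiable (by norm_num)) t).hasDerivAt
  have hGc : Continuous G := hg.1.continuous
  have hG'c : Continuous (deriv G) := hg.1.continuous_deriv le_rfl
  obtain ⟨B, hB0, hB, hLip⟩ := lipschitz_boundary hg
  obtain ⟨K, hK⟩ := hg.2
  -- Integration by parts in the angle. The derivative of G e^{-it}/(x - ζ) is p/(x - ζ) + i re G/(x
  -- - ζ)² with p = e^{-it}(G' - iG). The double pole is thus traded for a simple one with a Hölder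
  -- density, and the boundary terms cancel by periodicity.
  set q : ℝ → ℂ := fun t => ((deriv G t : ℝ) : ℂ) - Complex.I * G t with hq
  set e : ℝ → ℂ := fun t => Complex.exp (-(t * Complex.I)) with he
  set p : ℝ → ℂ := fun t => e t * q t with hp
  have hqc : Continuous q := by simp only [hq]; fun_prop
  have hec : Continuous e := by simp only [he]; fun_prop
  have hqper : Function.Periodic q (2 * Real.pi) := fun t => by
    simp only [hq, (periodic_deriv (periodic_boundary (re := re) (g := g))) t,
      hG, periodic_circleMap (re : ℂ) re t]
  have heper : Function.Periodic e (2 * Real.pi) := fun t => by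
    simp only [he]
    rw [Complex.exp_eq_exp_iff_exists_int]
    exact ⟨-1, by push_cast; ring⟩
  have hpper : Function.Periodic p (2 * Real.pi) := heper.mul hqper
  obtain ⟨Q, hQ⟩ := exists_bound_of_periodic Real.two_pi_pos hqc hqper
  have hQ0 : 0 ≤ Q := (norm_nonneg _).trans (hQ 0)
  have he1 : ∀ t, ‖e t‖ = 1 := fun t => by
    simp only [he]
    rw [← neg_mul, ← Complex.ofReal_neg, Complex.norm_exp_ofReal_mul_I]
  have heL : ∀ s t, ‖e s - e t‖ ≤ |s - t| := fun s t => by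
    have : e s - e t = e t * (Complex.exp (Complex.I * ((t - s : ℝ) : ℂ)) - 1) := by
      simp only [he]
      rw [mul_sub, ← Complex.exp_add, mul_one]; congr 2; push_cast; ring
    rw [this, norm_mul, he1, one_mul, abs_sub_comm]
    exact Real.norm_exp_I_mul_ofReal_sub_one_le
  have hH : ∀ s t, ‖p s - p t‖ ≤ |K| * |s - t| ^ δ + (B + Q) * |s - t| := fun s t => by
    have e1 : p s - p t = e s * (((deriv G s - deriv G t : ℝ) : ℂ) -
        Complex.I * ((G s - G t : ℝ) : ℂ)) + (e s - e t) * q t := by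
      simp only [hp, hq]; push_cast; ring
    rw [e1]
    refine (norm_add_le _ _).trans ?_
    rw [norm_mul, norm_mul, he1, one_mul]
    have h1 := norm_sub_le ((deriv G s - deriv G t : ℝ) : ℂ)
      (Complex.I * ((G s - G t : ℝ) : ℂ))
    rw [norm_mul, Complex.norm_I, one_mul, Complex.norm_real, Complex.norm_real] at h1
    have h2 : ‖deriv G s - deriv G t‖ ≤ |K| * |s - t| ^ δ :=
      (hK s t).trans (mul_le_mul_of_nonneg_right (le_abs_self K)
        (Real.rpow_nonneg (abs_nonneg _) _))
    have h3 : ‖G s - G t‖ ≤ B * |s - t| := hLip s t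
    have h4 := mul_le_mul (heL s t) (hQ t) (norm_nonneg _) (abs_nonneg _)
    linarith
  obtain ⟨C, hC⟩ := exists_bound_integral_div_sub_circleMap (c := (re : ℂ)) hre hδ
    (abs_nonneg K) (add_nonneg hB0 hQ0) (hec.mul hqc) hpper hH
  refine ⟨|C| / Real.pi, by positivity, fun x hx => ?_⟩
  have hne := fun t => circleMap_ne_of_mem_ball hx t
  have hcinv : Continuous fun t => (x - circleMap re re t)⁻¹ :=
    Continuous.inv₀ (by fun_prop) hne
  set A : ℝ → ℂ := fun t => p t / (x - circleMap re re t) with hA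
  set A2 : ℝ → ℂ := fun t => (-((x - circleMap re re t) ^ 2)⁻¹) *
      ((-(re / Real.pi * g (circleMap re re t)) : ℝ) : ℂ) with hA2
  have hAc : Continuous A := by
    simp only [hA, div_eq_mul_inv]; exact (hec.mul hqc).mul hcinv
  have hA2c : Continuous A2 := by
    refine Continuous.mul ?_ (continuous_weight hGc)
    refine ((hcinv.pow 2).neg).congr fun t => by simp
  have hW : ∀ t, HasDerivAt (fun t : ℝ => (G t : ℂ) * e t * (x - circleMap re re t)⁻¹)
      (A t + (Complex.I * Real.pi) * A2 t) t := fun t => by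
    have h1 : HasDerivAt (fun t : ℝ => (G t : ℂ)) ((deriv G t : ℝ) : ℂ) t :=
      (hGd t).ofReal_comp
    have h2 : HasDerivAt e (e t * (-(1 * Complex.I))) t :=
      (((hasDerivAt_id t).ofReal_comp.mul_const Complex.I).neg).cexp
    have h3 : HasDerivAt (fun t : ℝ => x - circleMap re re t)
        (-(circleMap 0 re t * Complex.I)) t :=
      (hasDerivAt_circleMap (re : ℂ) re t).const_sub x
    have h4 := (h1.mul h2).mul (h3.inv (hne t))
    convert! h4 using 1
    have h5 : e t * circleMap 0 re t = re := by
      simp only [he, circleMap]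
      rw [zero_add, mul_left_comm, ← Complex.exp_add, neg_add_cancel, Complex.exp_zero, mul_one]
    have h6 := hne t
    simp only [hA, hA2, hp, hq, Pi.inv_apply, Pi.mul_apply]
    have hpi : (Real.pi : ℂ) ≠ 0 := Complex.ofReal_ne_zero.2 Real.pi_ne_zero
    push_cast
    field_simp
    have h7 : e t * circleMap 0 re t * Complex.I = re * Complex.I := by rw [h5]
    linear_combination (-(g (circleMap re re t) : ℂ)) * h7
  have hA2c' : Continuous fun t => (Complex.I * Real.pi) * A2 t := continuous_const.mul hA2c
  have hint := intervalIntegral.integral_eq_sub_of_hasDerivAt (a := 0) (b := 2 * Real.pi)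
    (fun t _ => hW t) ((hAc.add hA2c').intervalIntegrable _ _)
  have hends : (G (2 * Real.pi) : ℂ) * e (2 * Real.pi) * (x - circleMap re re (2 * Real.pi))⁻¹ -
      (G 0 : ℂ) * e 0 * (x - circleMap re re 0)⁻¹ = 0 := by
    have h1 := heper 0
    have h2 := periodic_boundary (re := re) (g := g) 0
    have h3 := periodic_circleMap (re : ℂ) re 0
    rw [zero_add] at h1 h2 h3
    rw [h1, h3, show G (2 * Real.pi) = G 0 from h2, sub_self]
  rw [hends, intervalIntegral.integral_add (hAc.intervalIntegrable _ _)
    (hA2c'.intervalIntegrable _ _), intervalIntegral.integral_const_mul] at hint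
  have hval : (Complex.I * Real.pi) * cauchyFieldDeriv re g x =
      -∫ t in (0 : ℝ)..(2 * Real.pi), A t := by
    rw [cauchyFieldDeriv]; linear_combination hint
  have hn := congrArg norm hval
  rw [norm_mul, norm_mul, Complex.norm_I, one_mul, Complex.norm_real, norm_neg,
    Real.norm_of_nonneg Real.pi_pos.le] at hn
  rw [le_div_iff₀ Real.pi_pos, mul_comm, hn]
  exact (hC x hx).trans (le_abs_self C)

/-- Lipschitz continuity of the flux with respect to the chord distance. -/
theorem chord_lipschitz (hre : 0 < re) {δ : ℝ} (hg : IsC1Holder re δ g) :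
    ∃ B, 0 ≤ B ∧ ∀ s t, |g (circleMap (re : ℂ) re s) - g (circleMap (re : ℂ) re t)| ≤
      B * ‖circleMap (re : ℂ) re s - circleMap (re : ℂ) re t‖ := by
  obtain ⟨B, hB0, -, hLip⟩ := lipschitz_boundary hg
  have hpi := Real.pi_pos
  refine ⟨B * (Real.pi / (2 * re)), by positivity, fun s t => ?_⟩
  obtain ⟨y, hy, h⟩ := (periodic_circleMap (re : ℂ) re).exists_mem_Ico Real.two_pi_pos s
    (t - Real.pi)
  rw [h]
  have h1 : |y - t| ≤ Real.pi := abs_le.2 ⟨by linarith [hy.1], by linarith [hy.2]⟩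
  have h2 := norm_circleMap_sub_circleMap_ge (c := (re : ℂ)) hre h1
  refine (hLip y t).trans ?_
  rw [mul_assoc]
  apply mul_le_mul_of_nonneg_left _ hB0
  calc |y - t| = Real.pi / (2 * re) * (2 * re / Real.pi * |y - t|) := by field_simp
    _ ≤ _ := by gcongr

/-- The identity (x - re)/(x - ζ) = (1 - Herglotz kernel)/2, with the constant removed by the mean
zero condition. It turns the Neumann condition for `H` into the boundary behaviour of the Poisson
integral of `g`. -/
theorem re_cauchyField_mul (hg : Continuous fun t : ℝ => g (circleMap (re : ℂ) re t))
    (hg0 : IsMeanZero re g) {x : ℂ} (hx : x ∈ Om re) :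
    (cauchyField re g x * (x - re)).re = re * Real.circleAverage
      (poissonKernel (re : ℂ) x • g) (re : ℂ) re := by
  have hre : 0 < re := pos_of_mem_ball hx
  have hne := fun t => circleMap_ne_of_mem_ball hx t
  have hcinv : Continuous fun t => (x - circleMap re re t)⁻¹ :=
    Continuous.inv₀ (by fun_prop) hne
  have hPc : Continuous fun t => poissonKernel (re : ℂ) x (circleMap (re : ℂ) re t) := by
    simp only [poissonKernel_def]
    refine Continuous.div (by fun_prop) (by fun_prop) fun t => ?_
    have := hne t
    rw [sub_sub_sub_cancel_right, norm_sub_rev]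
    positivity
  have h1 : (cauchyField re g x * (x - re)).re = ∫ t in (0 : ℝ)..(2 * Real.pi),
      ((x - circleMap re re t)⁻¹ * ((-(re / Real.pi * g (circleMap re re t)) : ℝ) : ℂ) *
        (x - re)).re := by
    rw [cauchyField, ← intervalIntegral.integral_mul_const]
    exact (Complex.reCLM.intervalIntegral_comp_comm (μ := volume) (a := 0)
      (b := 2 * Real.pi) (((hcinv.mul (continuous_weight hg)).mul
        continuous_const).intervalIntegrable _ _)).symm
  have h2 : ∀ t, ((x - circleMap re re t)⁻¹ *
      ((-(re / Real.pi * g (circleMap re re t)) : ℝ) : ℂ) * (x - re)).re =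
      re / (2 * Real.pi) * (poissonKernel (re : ℂ) x (circleMap (re : ℂ) re t) *
        g (circleMap (re : ℂ) re t)) +
      -(1 / (2 * Real.pi)) * (g (circleMap re re t) * re) := fun t => by
    rw [poissonKernel_eq_re_herglotzRieszKernel, Function.comp_apply, herglotzRieszKernel_def]
    have h3 := hne t
    have h3' : (circleMap (re : ℂ) re t - re) - (x - re) ≠ 0 := by
      rw [sub_sub_sub_cancel_right]; rw [← neg_ne_zero, neg_sub]; exact h3
    have e : (x - circleMap re re t)⁻¹ * (x - re) = (1 / 2 : ℝ) *
        (1 - ((circleMap (re : ℂ) re t - re) + (x - re)) /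
          ((circleMap (re : ℂ) re t - re) - (x - re))) := by
      push_cast
      rw [sub_sub_sub_cancel_right] at h3' ⊢
      rw [← neg_sub (circleMap (re : ℂ) re t) x, inv_neg]
      field_simp
      ring
    rw [mul_right_comm, e, Complex.re_mul_ofReal, Complex.re_ofReal_mul, Complex.sub_re,
      Complex.one_re]
    field_simp
    ring
  rw [h1]
  simp_rw [h2]
  rw [intervalIntegral.integral_add, intervalIntegral.integral_const_mul,
    intervalIntegral.integral_const_mul, show (∫ t in (0 : ℝ)..(2 * Real.pi),
      g (circleMap (re : ℂ) re t) * re) = 0 from hg0, Real.circleAverage_def]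
  · simp only [smul_eq_mul, mul_zero, add_zero, Pi.smul_apply']
    rw [← mul_assoc, div_eq_mul_inv]
  · exact (continuous_const.mul (hPc.mul hg)).intervalIntegrable _ _
  · exact (continuous_const.mul (hg.mul continuous_const)).intervalIntegrable _ _

theorem circleAverage_poissonKernel {x : ℂ} (hx : x ∈ Om re) (a : ℝ) :
    Real.circleAverage (poissonKernel (re : ℂ) x • fun _ => a) (re : ℂ) re = a :=
  HarmonicContOnCl.circleAverage_poissonKernel_smul (harmonicContOnCl_const (c := a)) hx

/-- The Neumann boundary condition for the background field. -/
theorem tendsto_re_cauchyField_normal (hre : 0 < re) {δ : ℝ} (hg : IsC1Holder re δ g)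
    (hg0 : IsMeanZero re g) {x : ℂ} (hx : x ∈ sphere (re : ℂ) re) :
    Tendsto (fun t : ℝ => (cauchyField re g (x - t • normal re re x) * normal re re x).re)
      (𝓝[>] 0) (𝓝 (g x)) := by
  have hgc := hg.1.continuous
  obtain ⟨B, hB0, hB⟩ := chord_lipschitz hre hg
  obtain ⟨s₀, hs₀⟩ := exists_eq_circleMap (re : ℂ) x
  rw [mem_sphere_iff_norm.1 hx] at hs₀
  set n : ℂ := normal re re x with hn
  have hnn : ‖n‖ = 1 := norm_normal hre hx
  have hxe : x = re + re • n := eq_center_add_normal hre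
  have hsub : ∀ t : ℝ, x - t • n - re = (re - t) • n := fun t => by
    nth_rewrite 1 [hxe]; rw [sub_smul]; abel
  have hnorm : ∀ t ∈ Ioo 0 re, ‖x - t • n - re‖ = re - t := fun t ht => by
    rw [hsub, norm_smul, hnn, mul_one, Real.norm_of_nonneg (by linarith [ht.2])]
  have hmem : ∀ t ∈ Ioo 0 re, x - t • n ∈ Om re := fun t ht => by
    rw [Om, mem_ball_iff_norm, hnorm t ht]; linarith [ht.1]
  have hray : ∀ t, x - t • n = circleMap (re : ℂ) (re - t) s₀ := fun t => by
    have h1 : re • n = re * Complex.exp (s₀ * Complex.I) := by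
      have : re • n = x - re := by rw [eq_sub_iff_add_eq, add_comm]; exact hxe.symm
      rw [this, hs₀, circleMap]; ring
    have h2 : n = Complex.exp (s₀ * Complex.I) := by
      rw [Complex.real_smul] at h1
      exact mul_left_cancel₀ (Complex.ofReal_ne_zero.2 hre.ne') h1
    rw [hxe, circleMap, ← h2, Complex.real_smul, Complex.real_smul]; push_cast; ring
  have hPc : ∀ t ∈ Ioo 0 re, Continuous fun s =>
      poissonKernel (re : ℂ) (x - t • n) (circleMap (re : ℂ) re s) := fun t ht => by
    simp only [poissonKernel_def]
    refine Continuous.div (by fun_prop) (by fun_prop) fun s => ?_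
    have := circleMap_ne_of_mem_ball (hmem t ht) s
    rw [sub_sub_sub_cancel_right, norm_sub_rev]
    positivity
  -- The Poisson integral of g - g(x) vanishes in the limit, by dominated convergence. Let d be the
  -- distance from the boundary point to the point at depth t. Since t ≤ d, the kernel is at most 2
  -- re/d, while |g - g(x)| ≤ 2Bd, so 4 B re is a bound.
  have key : Tendsto (fun t : ℝ => ∫ s in (0 : ℝ)..(2 * Real.pi),
      poissonKernel (re : ℂ) (x - t • n) (circleMap (re : ℂ) re s) *
        (g (circleMap (re : ℂ) re s) - g x)) (𝓝[>] 0)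
      (𝓝 (∫ s in (0 : ℝ)..(2 * Real.pi), (0 : ℝ))) := by
    refine intervalIntegral.tendsto_integral_filter_of_dominated_convergence
      (bound := fun _ => 4 * B * re) ?_ ?_ (by simp) ?_
    · filter_upwards [Ioo_mem_nhdsGT hre] with t ht
      exact ((hPc t ht).mul (hgc.sub continuous_const)).aestronglyMeasurable
    · filter_upwards [Ioo_mem_nhdsGT hre] with t ht
      refine Eventually.of_forall fun s _ => ?_
      obtain ⟨h1, h2⟩ := norm_circleMap_sub_circleMap_le_of_ray (R := re) (s := s)
        (by linarith [ht.2]) (by linarith [ht.1]) (hray t)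
      rw [sub_sub_cancel] at h2
      have h3 := hB s s₀
      rw [← hs₀] at h3 h1
      rw [norm_mul, poissonKernel_def, hnorm t ht, sub_sub_sub_cancel_right, norm_div, norm_pow,
        norm_norm, circleMap_sub_center, norm_circleMap_zero, sq_abs, Real.norm_eq_abs,
        Real.norm_eq_abs]
      set d := ‖circleMap (re : ℂ) re s - (x - t • n)‖
      have hd : 0 < d := lt_of_lt_of_le ht.1 h2
      have h4 : |re ^ 2 - (re - t) ^ 2| ≤ 2 * re * d := by
        have h5 := ht.1
        have h6 := ht.2
        rw [abs_of_nonneg (by nlinarith)]; nlinarith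
      calc |re ^ 2 - (re - t) ^ 2| / d ^ 2 * |g (circleMap (re : ℂ) re s) - g x|
          ≤ (2 * re * d) / d ^ 2 * (B * (2 * d)) := by
            gcongr
            exact h3.trans (by gcongr)
        _ = 4 * B * re := by field_simp; ring
    · refine Eventually.of_forall fun s _ => ?_
      by_cases hs : circleMap (re : ℂ) re s = x
      · rw [hs]; simp
      have hc : ContinuousAt (fun t : ℝ =>
          poissonKernel (re : ℂ) (x - t • n) (circleMap (re : ℂ) re s) *
          (g (circleMap (re : ℂ) re s) - g x)) 0 := by
        simp only [poissonKernel_def]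
        refine ContinuousAt.mul (ContinuousAt.div (by fun_prop) (by fun_prop) ?_)
          continuousAt_const
        rw [zero_smul, sub_zero, sub_sub_sub_cancel_right]
        have := sub_ne_zero.2 hs
        positivity
      have h0 : poissonKernel (re : ℂ) (x - (0 : ℝ) • n) (circleMap (re : ℂ) re s) *
          (g (circleMap (re : ℂ) re s) - g x) = 0 := by
        rw [poissonKernel_def, zero_smul, sub_zero, mem_sphere_iff_norm.1 hx,
          circleMap_sub_center, norm_circleMap_zero, abs_of_pos hre, sub_self, zero_div, zero_mul]
      have := hc.tendsto
      rw [h0] at this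
      exact this.mono_left nhdsWithin_le_nhds
  rw [intervalIntegral.integral_zero] at key
  have hlim : Tendsto (fun t : ℝ => re / (re - t) * ((2 * Real.pi)⁻¹ *
      (∫ s in (0 : ℝ)..(2 * Real.pi),
      poissonKernel (re : ℂ) (x - t • n) (circleMap (re : ℂ) re s) *
        (g (circleMap (re : ℂ) re s) - g x)) + g x)) (𝓝[>] 0) (𝓝 (g x)) := by
    have h1 : Tendsto (fun t : ℝ => re / (re - t)) (𝓝[>] 0) (𝓝 1) := by
      have : ContinuousAt (fun t : ℝ => re / (re - t)) 0 :=
        ContinuousAt.div (by fun_prop) (by fun_prop) (by simpa using hre.ne')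
      have h2 := this.tendsto
      rw [sub_zero, div_self hre.ne'] at h2
      exact h2.mono_left nhdsWithin_le_nhds
    have := h1.mul ((key.const_mul (2 * Real.pi)⁻¹).add_const (g x))
    simpa using this
  refine hlim.congr' ?_
  filter_upwards [Ioo_mem_nhdsGT hre] with t ht
  have hrt : 0 < re - t := by linarith [ht.2]
  have h1 := re_cauchyField_mul hgc hg0 (hmem t ht)
  have h2 := circleAverage_poissonKernel (hmem t ht) (g x)
  rw [hsub, Complex.real_smul (x := re - t), mul_left_comm, Complex.re_ofReal_mul] at h1
  have h3 : (cauchyField re g (x - t • n) * n).re = re / (re - t) * Real.circleAverage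
      (poissonKernel (re : ℂ) (x - t • n) • g) (re : ℂ) re := by
    field_simp
    linarith
  rw [h3]
  congr 1
  nth_rewrite 2 [← h2]
  rw [Real.circleAverage_def, Real.circleAverage_def, smul_eq_mul, smul_eq_mul, ← mul_add,
    ← intervalIntegral.integral_add]
  · congr 1
    refine intervalIntegral.integral_congr fun s _ => ?_
    simp only [Pi.smul_apply', smul_eq_mul, Pi.mul_apply]
    ring
  · exact ((hPc t ht).mul (hgc.sub continuous_const)).intervalIntegrable _ _
  · exact ((hPc t ht).mul continuous_const).intervalIntegrable _ _

/-- The properties of the background field used below. -/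
theorem exists_background (hre : 0 < re) {δ : ℝ} (hδ : 0 < δ) (hg : IsC1Holder re δ g)
    (hg0 : IsMeanZero re g) : ∃ (c : ℂ) (L B : ℝ), 0 ≤ L ∧ 0 ≤ B ∧
      (∀ x ∈ Om re, ‖cauchyField re g x‖ ≤ B) ∧
      (∀ x ∈ Om re, ‖cauchyField re g x - c‖ ≤ L * ‖x‖) ∧
      Tendsto (fun x => gradient (bgField re g) x) (𝓝[Om re] 0) (𝓝 (conj c)) := by
  have hgc := hg.1.continuous
  obtain ⟨L, hL0, hL⟩ := exists_bound_cauchyFieldDeriv hre hδ hg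
  have hlip : LipschitzOnWith ⟨L, hL0⟩ (cauchyField re g) (Om re) :=
    Convex.lipschitzOnWith_of_nnnorm_hasDerivWithin_le (𝕜 := ℂ)
      (f' := cauchyFieldDeriv re g) (convex_ball _ _)
      (fun x hx => (hasDerivAt_cauchyField hgc hx).hasDerivWithinAt) (fun x hx => hL x hx)
  have h0 : (0 : ℂ) ∈ closure (Om re) := by
    rw [Om, closure_ball _ hre.ne', mem_closedBall_iff_norm, zero_sub, norm_neg,
      Complex.norm_real, Real.norm_of_nonneg hre.le]
  have : (𝓝[Om re] (0 : ℂ)).NeBot := mem_closure_iff_nhdsWithin_neBot.1 h0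
  -- A Lipschitz function on Ω has a limit at the boundary point 0. The limit `c` inherits the
  -- Lipschitz estimate, and its conjugate is the limit of the gradient of `H`.
  have hcau : Cauchy (map (cauchyField re g) (𝓝[Om re] 0)) := by
    refine (Cauchy.mono ?_ inf_le_left : Cauchy (𝓝[Om re] (0 : ℂ))).map_of_le
      hlip.uniformContinuousOn inf_le_right
    exact cauchy_nhds
  obtain ⟨c, hc⟩ := CompleteSpace.complete hcau
  have hc : Tendsto (cauchyField re g) (𝓝[Om re] 0) (𝓝 c) := hc
  have hdist : ∀ x ∈ Om re, ‖cauchyField re g x - c‖ ≤ L * ‖x‖ := by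
    intro x hx
    have h1 : Tendsto (fun y => ‖cauchyField re g x - cauchyField re g y‖) (𝓝[Om re] 0)
        (𝓝 ‖cauchyField re g x - c‖) := (tendsto_const_nhds.sub hc).norm
    have h2 : Tendsto (fun y => L * ‖x - y‖) (𝓝[Om re] 0) (𝓝 (L * ‖x‖)) := by
      have : Continuous fun y : ℂ => L * ‖x - y‖ := by fun_prop
      have h3 := this.tendsto 0
      rw [sub_zero] at h3
      exact h3.mono_left nhdsWithin_le_nhds
    refine le_of_tendsto_of_tendsto h1 h2 ?_
    filter_upwards [self_mem_nhdsWithin] with y hy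
    have := hlip.dist_le_mul x hx y hy
    rwa [dist_eq_norm, dist_eq_norm] at this
  refine ⟨c, L, ‖c‖ + L * (2 * re), hL0, by positivity, ?_, hdist, ?_⟩
  rotate_left
  · refine ((Complex.continuous_conj.tendsto c).comp hc).congr' ?_
    filter_upwards [self_mem_nhdsWithin] with y hy
    exact (hasGradientAt_bgField hgc hg0 hy).gradient.symm
  intro x hx
  have h1 : ‖x‖ ≤ 2 * re := by
    have h2 := mem_ball_iff_norm.1 hx
    have h3 := norm_add_le (x - re) (re : ℂ)
    rw [sub_add_cancel, Complex.norm_real, Real.norm_of_nonneg hre.le] at h3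
    linarith
  have h4 := hdist x hx
  have h5 := norm_add_le (cauchyField re g x - c) c
  rw [sub_add_cancel] at h5
  have h6 := mul_le_mul_of_nonneg_left h1 hL0
  linarith

end BackgroundField

/-! ### Hyperbolic Möbius transformations with fixed points `±a` -/

/-- The Möbius transformation that multiplies `(a + z) / (a - z)` by `Q`. -/
noncomputable def mob (a Q : ℝ) (z : ℂ) : ℂ :=
  a * ((Q - 1) * a + (Q + 1) * z) / ((Q + 1) * a + (Q - 1) * z)

/-- The derivative of `mob a Q`. -/
noncomputable def mobDeriv (a Q : ℝ) (z : ℂ) : ℂ :=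
  4 * Q * a ^ 2 / ((Q + 1) * a + (Q - 1) * z) ^ 2

section Mob

variable {a Q A : ℝ} {z : ℂ}

/-- The pole of the map is -a(Q + 1)/(Q - 1) on the negative axis, or infinity when Q = 1, whereas
the hypothesis on `z` says Re z ≥ 0. -/
theorem mob_den_ne_zero (ha : 0 < a) (hQ : 1 ≤ Q) (hz : ‖(a : ℂ) - z‖ ≤ ‖(a : ℂ) + z‖) :
    ((Q : ℂ) + 1) * a + (Q - 1) * z ≠ 0 := by
  intro h
  have e : (Q : ℂ) * (a + z) = -(a - z) := by linear_combination h
  have h1 := congrArg norm e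
  rw [norm_mul, norm_neg, Complex.norm_real, Real.norm_of_nonneg (by linarith)] at h1
  rcases hQ.eq_or_lt with h2 | h2
  · rw [← h2] at h
    have : (a : ℂ) = 0 := by push_cast at h; linear_combination h / 2
    exact ha.ne' (Complex.ofReal_eq_zero.1 this)
  · have h3 : ‖(a : ℂ) + z‖ = 0 := by nlinarith [norm_nonneg ((a : ℂ) + z)]
    rw [h3] at hz
    have h4 := norm_le_zero_iff.1 hz
    rw [norm_eq_zero] at h3
    have : (a : ℂ) = 0 := by linear_combination (h3 + h4) / 2
    exact ha.ne' (Complex.ofReal_eq_zero.1 this)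

theorem add_mob (hd : ((Q : ℂ) + 1) * a + (Q - 1) * z ≠ 0) :
    a + mob a Q z = 2 * a * Q * (a + z) / ((Q + 1) * a + (Q - 1) * z) := by
  rw [mob, eq_div_iff hd, add_mul, div_mul_cancel₀ _ hd]; ring

theorem sub_mob (hd : ((Q : ℂ) + 1) * a + (Q - 1) * z ≠ 0) :
    a - mob a Q z = 2 * a * (a - z) / ((Q + 1) * a + (Q - 1) * z) := by
  rw [mob, eq_div_iff hd, sub_mul, div_mul_cancel₀ _ hd]; ring

theorem mob_one (ha : a ≠ 0) : mob a 1 z = z := by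
  have ha' : (a : ℂ) ≠ 0 := Complex.ofReal_ne_zero.2 ha
  rw [mob]; push_cast; field_simp; ring

theorem mob_mob_den {Q' : ℝ} (hd' : ((Q' : ℂ) + 1) * a + (Q' - 1) * z ≠ 0) :
    ((Q : ℂ) + 1) * a + (Q - 1) * mob a Q' z =
      2 * a * (((Q * Q' : ℝ) + 1) * a + ((Q * Q' : ℝ) - 1) * z) /
        ((Q' + 1) * a + (Q' - 1) * z) := by
  rw [mob, eq_div_iff hd', add_mul, mul_assoc, mul_assoc ((Q : ℂ) - 1), div_mul_cancel₀ _ hd']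
  push_cast; ring

theorem mob_mob {Q' : ℝ} (ha : a ≠ 0) (hd' : ((Q' : ℂ) + 1) * a + (Q' - 1) * z ≠ 0) :
    mob a Q (mob a Q' z) = mob a (Q * Q') z := by
  have ha' : (a : ℂ) ≠ 0 := Complex.ofReal_ne_zero.2 ha
  rw [mob, mob_mob_den hd']
  have e : ((Q : ℂ) - 1) * a + (Q + 1) * mob a Q' z =
      2 * a * (((Q * Q' : ℝ) - 1) * a + ((Q * Q' : ℝ) + 1) * z) /
        ((Q' + 1) * a + (Q' - 1) * z) := by
    rw [mob, eq_div_iff hd', add_mul, mul_assoc, mul_assoc ((Q : ℂ) + 1), div_mul_cancel₀ _ hd']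
    push_cast; ring
  rw [e, mob, ← mul_div_assoc, div_div_div_cancel_right₀ hd', mul_left_comm,
    mul_div_mul_left _ _ (mul_ne_zero two_ne_zero ha')]

theorem mobDeriv_mul {Q' : ℝ} (ha : a ≠ 0) (hd' : ((Q' : ℂ) + 1) * a + (Q' - 1) * z ≠ 0) :
    mobDeriv a Q (mob a Q' z) * mobDeriv a Q' z = mobDeriv a (Q * Q') z := by
  have ha' : (a : ℂ) ≠ 0 := Complex.ofReal_ne_zero.2 ha
  rw [mobDeriv, mob_mob_den hd', mobDeriv, mobDeriv]
  by_cases h : (((Q * Q' : ℝ) : ℂ) + 1) * a + ((Q * Q' : ℝ) - 1) * z = 0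
  · rw [h]; simp
  generalize (((Q * Q' : ℝ) : ℂ) + 1) * a + ((Q * Q' : ℝ) - 1) * z = D at h
  generalize ((Q' : ℂ) + 1) * a + (Q' - 1) * z = D' at hd'
  push_cast
  field_simp
  ring

theorem hasDerivAt_mob (hd : ((Q : ℂ) + 1) * a + (Q - 1) * z ≠ 0) :
    HasDerivAt (mob a Q) (mobDeriv a Q z) z := by
  have h1 : HasDerivAt (fun z : ℂ => (a : ℂ) * (((Q : ℂ) - 1) * a + (Q + 1) * z))
      (a * ((Q + 1) * 1)) z := (((hasDerivAt_id z).const_mul _).const_add _).const_mul _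
  have h2 : HasDerivAt (fun z : ℂ => ((Q : ℂ) + 1) * a + (Q - 1) * z) ((Q - 1) * 1) z :=
    ((hasDerivAt_id z).const_mul _).const_add _
  convert! h1.div h2 hd using 1
  rw [mobDeriv]; congr 1; ring

theorem conj_mob : conj (mob a Q z) = mob a Q (conj z) := by simp [mob]

theorem conj_mobDeriv : conj (mobDeriv a Q z) = mobDeriv a Q (conj z) := by
  simp [mobDeriv, map_ofNat (starRingEnd ℂ) 4]

theorem normSq_add_of_gt_mob (ha : 0 < a) (hQ : 0 < Q)
    (hd : ((Q : ℂ) + 1) * a + (Q - 1) * z ≠ 0)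
    (hz : A * ‖(a : ℂ) - z‖ ^ 2 < ‖(a : ℂ) + z‖ ^ 2) :
    Q ^ 2 * A * ‖(a : ℂ) - mob a Q z‖ ^ 2 < ‖(a : ℂ) + mob a Q z‖ ^ 2 := by
  rw [add_mob hd, sub_mob hd]
  simp only [norm_div, norm_mul, Complex.norm_real, Complex.norm_ofNat, Real.norm_of_nonneg ha.le,
    Real.norm_of_nonneg hQ.le, div_pow, mul_pow]
  have h0 : 0 < ‖((Q : ℂ) + 1) * a + (Q - 1) * z‖ := norm_pos_iff.2 hd
  rw [← mul_div_assoc]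
  apply div_lt_div_of_pos_right _ (by positivity)
  have : 0 < 2 ^ 2 * a ^ 2 * Q ^ 2 := by positivity
  nlinarith

/-- The derivative decays like `1 / Q`, uniformly on the half plane. -/
theorem norm_mobDeriv_le (ha : 0 < a) (hQ : 1 ≤ Q) (hz : ‖(a : ℂ) - z‖ ≤ ‖(a : ℂ) + z‖) :
    ‖mobDeriv a Q z‖ ≤ 4 / Q := by
  have hd := mob_den_ne_zero ha hQ hz
  have h0 : 0 < ‖((Q : ℂ) + 1) * a + (Q - 1) * z‖ := norm_pos_iff.2 hd
  -- Because Re z ≥ 0 and Q ≥ 1, already the real part of the denominator is at least Q a.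
  have key : Q ^ 2 * a ^ 2 ≤ ‖((Q : ℂ) + 1) * a + (Q - 1) * z‖ ^ 2 := by
    have hz2 := pow_le_pow_left₀ (norm_nonneg _) hz 2
    rw [← Complex.normSq_eq_norm_sq, ← Complex.normSq_eq_norm_sq, Complex.normSq_apply,
      Complex.normSq_apply] at hz2
    rw [← Complex.normSq_eq_norm_sq, Complex.normSq_apply]
    simp only [Complex.add_re, Complex.add_im, Complex.sub_re, Complex.sub_im, Complex.mul_re,
      Complex.mul_im, Complex.ofReal_re, Complex.ofReal_im, Complex.one_re, Complex.one_im,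
      zero_mul, sub_zero, add_zero, zero_add, sub_self, zero_sub] at *
    have hzr : 0 ≤ z.re := by nlinarith
    have h1 : Q * a ≤ (Q + 1) * a + (Q - 1) * z.re := by nlinarith [mul_nonneg (sub_nonneg.2 hQ) hzr]
    have h2 := pow_le_pow_left₀ (by positivity) h1 2
    nlinarith [sq_nonneg ((Q - 1) * z.im)]
  rw [mobDeriv, norm_div, norm_pow, div_le_div_iff₀ (by positivity) (by linarith)]
  simp only [norm_mul, norm_pow, Complex.norm_real, Complex.norm_ofNat, Real.norm_of_nonneg ha.le,
    Real.norm_of_nonneg (show 0 ≤ Q by linarith)]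
  nlinarith

/-- The circle of centre `c` and radius `r` is thereby a circle of Apollonius for ±a. Both ∂D and
∂Ω, once translated, are of this kind for the same `a`, which is why bipolar coordinates fit the
geometry. -/
theorem apollonius_identity {c r : ℝ} (hr : r ^ 2 = c ^ 2 - a ^ 2) :
    (c - a) * ‖(a : ℂ) + z‖ ^ 2 - (c + a) * ‖(a : ℂ) - z‖ ^ 2 =
      2 * a * (r ^ 2 - ‖z - c‖ ^ 2) := by
  simp only [← Complex.normSq_eq_norm_sq, Complex.normSq_apply, Complex.add_re, Complex.add_im,
    Complex.sub_re, Complex.sub_im, Complex.ofReal_re, Complex.ofReal_im]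
  rw [hr]; ring

theorem mem_ball_iff_apollonius {c r : ℝ} (ha : 0 < a) (hac : a < c) (hr0 : 0 < r)
    (hr : r ^ 2 = c ^ 2 - a ^ 2) :
    ‖z - c‖ < r ↔ (c + a) / (c - a) * ‖(a : ℂ) - z‖ ^ 2 < ‖(a : ℂ) + z‖ ^ 2 := by
  have h := apollonius_identity (z := z) hr
  have hca : 0 < c - a := by linarith
  rw [← pow_lt_pow_iff_left₀ (norm_nonneg _) hr0.le two_ne_zero, div_mul_eq_mul_div,
    div_lt_iff₀ hca]
  constructor
  · intro h1
    have : 0 < 2 * a * (r ^ 2 - ‖z - c‖ ^ 2) := by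
      have := sub_pos.2 h1
      positivity
    linarith
  · intro h1
    have : 0 < 2 * a * (r ^ 2 - ‖z - c‖ ^ 2) := by linarith
    have := (mul_pos_iff_of_pos_left (by positivity : 0 < 2 * a)).1 this
    linarith

/-- Reflection in a circle, followed by complex conjugation, as a Möbius transformation. -/
theorem mob_neg_eq {c r : ℝ} (hac : a < c) (ha : 0 < a) (hr : r ^ 2 = c ^ 2 - a ^ 2)
    (hz : z - c ≠ 0) :
    mob a ((c + a) / (c - a)) (-z) = c + r ^ 2 / (z - c) ∧
    (((c + a) / (c - a) : ℝ) + 1 : ℂ) * a + (((c + a) / (c - a) : ℝ) - 1) * (-z) ≠ 0 := by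
  have hca : ((c : ℂ) - a) ≠ 0 := by
    rw [← Complex.ofReal_sub]; exact Complex.ofReal_ne_zero.2 (by linarith)
  have ha' : (a : ℂ) ≠ 0 := Complex.ofReal_ne_zero.2 ha.ne'
  have hr' : (r : ℂ) ^ 2 = c ^ 2 - a ^ 2 := by exact_mod_cast congrArg (fun x : ℝ => (x : ℂ)) hr
  have e : (((c + a) / (c - a) : ℝ) + 1 : ℂ) * a + (((c + a) / (c - a) : ℝ) - 1) * (-z) =
      -(2 * a * (z - c)) / (c - a) := by
    push_cast; field_simp; ring
  refine ⟨?_, ?_⟩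
  · rw [mob, e, hr']
    push_cast
    field_simp
    ring
  · rw [e]
    exact div_ne_zero (neg_ne_zero.2 (mul_ne_zero (mul_ne_zero two_ne_zero ha') hz)) hca

end Mob

/-! ### Reflections -/

/-- Reflection in the circle with real centre `c`, followed by complex conjugation. -/
noncomputable def reflConj (c r : ℝ) (x : ℂ) : ℂ := c + r ^ 2 / (x - c)

section Refl

variable {c r : ℝ} {x : ℂ}

theorem hasDerivAt_reflConj (hx : x - c ≠ 0) :
    HasDerivAt (reflConj c r) (-(r ^ 2) / (x - c) ^ 2) x := by
  have := ((((hasDerivAt_id x).sub_const (c : ℂ)).inv hx).const_mul ((r : ℂ) ^ 2)).const_add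
    (c : ℂ)
  convert! this using 1
  simp only [id]; ring

theorem reflConj_of_mem_sphere (hr : 0 < r) (hx : x ∈ sphere (c : ℂ) r) :
    reflConj c r x = conj x := by
  have h1 : ‖x - c‖ = r := mem_sphere_iff_norm.1 hx
  have h0 : x - c ≠ 0 := by rw [← norm_pos_iff, h1]; exact hr
  have h2 := Complex.mul_conj' (x - c)
  rw [h1] at h2
  rw [reflConj, ← h2, mul_div_cancel_left₀ _ h0, map_sub, Complex.conj_ofReal]; ring

/-- An inversion fixes its circle pointwise and reverses the normal direction; only the conjugation
remains. -/
theorem reflConj_deriv_mul_normal (hr : 0 < r) (hx : x ∈ sphere (c : ℂ) r) :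
    -((r : ℂ) ^ 2) / (x - c) ^ 2 * normal c r x = -conj (normal c r x) := by
  have h1 : ‖x - c‖ = r := mem_sphere_iff_norm.1 hx
  have h0 : x - c ≠ 0 := by rw [← norm_pos_iff, h1]; exact hr
  have h2 := Complex.mul_conj' (x - c)
  rw [h1] at h2
  have hr' : (r : ℂ) ≠ 0 := Complex.ofReal_ne_zero.2 hr.ne'
  rw [normal, Complex.real_smul, map_mul, Complex.conj_ofReal, ← h2]
  push_cast
  field_simp

end Refl

/-! ### The geometry of the two disks -/

/-- The standing assumptions on the radii and the distance. -/
structure Admissible (re ri ε : ℝ) : Prop where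
  ri_pos : 0 < ri
  ri_lt : ri < re
  eps_pos : 0 < ε
  eps_lt : ε < re - ri

/-- The value of `|e^{ξ + iθ}|²` on `∂D`. -/
noncomputable def levelI (re ri ε : ℝ) : ℝ :=
  (ci re ri ε + alpha re ri ε) / (ci re ri ε - alpha re ri ε)

/-- The value of `|e^{ξ + iθ}|²` on `∂Ω`. -/
noncomputable def levelE (re ri ε : ℝ) : ℝ :=
  (ce re ri ε + alpha re ri ε) / (ce re ri ε - alpha re ri ε)

/-- The multiplier of the composition of the two reflections. -/
noncomputable def ratio (re ri ε : ℝ) : ℝ := levelI re ri ε / levelE re ri ε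

/-- The iterates of the composition of the reflections in `∂Ω` and `∂D`. -/
noncomputable def tmap (re ri ε : ℝ) (n : ℕ) (x : ℂ) : ℂ :=
  mob (alpha re ri ε) (ratio re ri ε ^ n) (x + shift re ri ε) - shift re ri ε

/-- The derivatives of the iterates. -/
noncomputable def tmapDeriv (re ri ε : ℝ) (n : ℕ) (x : ℂ) : ℂ :=
  mobDeriv (alpha re ri ε) (ratio re ri ε ^ n) (x + shift re ri ε)

namespace Admissible

variable {re ri ε : ℝ} (H : Admissible re ri ε)

theorem re_pos (H : Admissible re ri ε) : 0 < re := H.ri_pos.trans H.ri_lt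

theorem ci_sub_ri (H : Admissible re ri ε) :
    ci re ri ε - ri = ε * (2 * re - ε) / (2 * (re - ri - ε)) := by
  have h : re - ri - ε ≠ 0 := by linarith [H.eps_lt]
  rw [ci]; field_simp; ring

theorem ci_add_ri (H : Admissible re ri ε) :
    ci re ri ε + ri = (2 * re - 2 * ri - ε) * (2 * ri + ε) / (2 * (re - ri - ε)) := by
  have h : re - ri - ε ≠ 0 := by linarith [H.eps_lt]
  rw [ci]; field_simp; ring

theorem ri_lt_ci (H : Admissible re ri ε) : ri < ci re ri ε := by
  have h1 := H.ri_pos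
  have h2 := H.ri_lt
  have h3 := H.eps_pos
  have h4 := H.eps_lt
  have h := H.ci_sub_ri
  have : 0 < ε * (2 * re - ε) / (2 * (re - ri - ε)) :=
    div_pos (mul_pos h3 (by linarith)) (by linarith)
  linarith

theorem alpha_pos (H : Admissible re ri ε) : 0 < alpha re ri ε := by
  have h1 := H.ri_pos
  have h2 := H.ri_lt
  have h3 := H.eps_pos
  have h4 := H.eps_lt
  refine div_pos (Real.sqrt_pos.2 ?_) (by linarith)
  have e1 : 0 < 2 * ri + ε := by linarith
  have e2 : 0 < 2 * re - ε := by linarith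
  have e3 : 0 < 2 * re - 2 * ri - ε := by linarith
  positivity

theorem alpha_sq (H : Admissible re ri ε) : alpha re ri ε ^ 2 =
    ε * (2 * ri + ε) * (2 * re - ε) * (2 * re - 2 * ri - ε) / (4 * (re - ri - ε) ^ 2) := by
  have h1 := H.ri_pos
  have h2 := H.ri_lt
  have h3 := H.eps_pos
  have h4 := H.eps_lt
  have e1 : 0 < 2 * ri + ε := by linarith
  have e2 : 0 < 2 * re - ε := by linarith
  have e3 : 0 < 2 * re - 2 * ri - ε := by linarith
  rw [alpha, div_pow, Real.sq_sqrt (by positivity)]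
  congr 1; ring

/-- With `re_sq` below, this says that the two translated circles have the common poles ±α. -/
theorem ri_sq (H : Admissible re ri ε) : ri ^ 2 = ci re ri ε ^ 2 - alpha re ri ε ^ 2 := by
  have h : re - ri - ε ≠ 0 := by linarith [H.eps_lt]
  have e : ci re ri ε ^ 2 = ri ^ 2 + (ci re ri ε - ri) * (ci re ri ε + ri) := by ring
  rw [e, H.alpha_sq, H.ci_sub_ri, H.ci_add_ri]
  field_simp; ring

theorem re_sq (H : Admissible re ri ε) : re ^ 2 = ce re ri ε ^ 2 - alpha re ri ε ^ 2 := by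
  have h : re - ri - ε ≠ 0 := by linarith [H.eps_lt]
  have h1 := H.ri_sq
  have h2 : 2 * (re - ri - ε) * ci re ri ε = re ^ 2 - ri ^ 2 - (re - ri - ε) ^ 2 := by
    rw [ci]; field_simp
  rw [ce]
  nlinarith

theorem alpha_lt_ci (H : Admissible re ri ε) : alpha re ri ε < ci re ri ε := by
  have h1 := H.ri_sq
  have h2 := H.ri_pos
  have h3 := H.ri_lt_ci
  apply lt_of_pow_lt_pow_left₀ 2 (by linarith)
  nlinarith

theorem ci_lt_ce (H : Admissible re ri ε) : ci re ri ε < ce re ri ε := by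
  rw [ce]; linarith [H.eps_lt]

theorem alpha_lt_ce (H : Admissible re ri ε) : alpha re ri ε < ce re ri ε :=
  H.alpha_lt_ci.trans H.ci_lt_ce

theorem one_lt_levelI (H : Admissible re ri ε) : 1 < levelI re ri ε := by
  rw [levelI, one_lt_div (by linarith [H.alpha_lt_ci])]; linarith [H.alpha_pos]

theorem one_lt_levelE (H : Admissible re ri ε) : 1 < levelE re ri ε := by
  rw [levelE, one_lt_div (by linarith [H.alpha_lt_ce])]; linarith [H.alpha_pos]

theorem levelE_lt_levelI (H : Admissible re ri ε) : levelE re ri ε < levelI re ri ε := by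
  rw [levelE, levelI, div_lt_div_iff₀ (by linarith [H.alpha_lt_ce]) (by linarith [H.alpha_lt_ci])]
  nlinarith [H.alpha_pos, H.ci_lt_ce]

theorem one_lt_ratio (H : Admissible re ri ε) : 1 < ratio re ri ε := by
  rw [ratio, one_lt_div (by linarith [H.one_lt_levelE])]; exact H.levelE_lt_levelI

theorem ratio_pos (H : Admissible re ri ε) : 0 < ratio re ri ε := by linarith [H.one_lt_ratio]

theorem one_le_ratio_pow (H : Admissible re ri ε) (n : ℕ) : 1 ≤ ratio re ri ε ^ n :=
  one_le_pow₀ H.one_lt_ratio.le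

theorem ratio_mul_levelE (H : Admissible re ri ε) :
    ratio re ri ε * levelE re ri ε = levelI re ri ε :=
  div_mul_cancel₀ _ (by linarith [H.one_lt_levelE])

theorem two_mul_xii (_H : Admissible re ri ε) : 2 * xii re ri ε = Real.log (levelI re ri ε) := by
  rw [xii, levelI]; ring

theorem mem_Om_iff (H : Admissible re ri ε) {x : ℂ} : x ∈ Om re ↔
    levelE re ri ε * ‖(alpha re ri ε : ℂ) - (x + shift re ri ε)‖ ^ 2 <
      ‖(alpha re ri ε : ℂ) + (x + shift re ri ε)‖ ^ 2 := by
  rw [Om, mem_ball_iff_norm, levelE,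
    ← mem_ball_iff_apollonius H.alpha_pos H.alpha_lt_ce H.re_pos H.re_sq]
  have : x + (shift re ri ε : ℂ) - (ce re ri ε : ℂ) = x - re := by
    rw [shift]; push_cast; ring
  rw [this]

theorem mem_Incl_iff (H : Admissible re ri ε) {x : ℂ} : x ∈ Incl ri ε ↔
    levelI re ri ε * ‖(alpha re ri ε : ℂ) - (x + shift re ri ε)‖ ^ 2 <
      ‖(alpha re ri ε : ℂ) + (x + shift re ri ε)‖ ^ 2 := by
  rw [Incl, mem_ball_iff_norm, levelI,
    ← mem_ball_iff_apollonius H.alpha_pos H.alpha_lt_ci H.ri_pos H.ri_sq]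
  have : x + (shift re ri ε : ℂ) - (ci re ri ε : ℂ) = x - ((ri + ε : ℝ) : ℂ) := by
    rw [shift, ce]; push_cast; ring
  rw [this]

theorem norm_le_of_mem_Om (H : Admissible re ri ε) {x : ℂ} (hx : x ∈ closedBall (re : ℂ) re) :
    levelE re ri ε * ‖(alpha re ri ε : ℂ) - (x + shift re ri ε)‖ ^ 2 ≤
      ‖(alpha re ri ε : ℂ) + (x + shift re ri ε)‖ ^ 2 := by
  rw [← closure_ball _ H.re_pos.ne'] at hx
  have hcl : IsClosed {x : ℂ | levelE re ri ε *
      ‖(alpha re ri ε : ℂ) - (x + shift re ri ε)‖ ^ 2 ≤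
      ‖(alpha re ri ε : ℂ) + (x + shift re ri ε)‖ ^ 2} :=
    isClosed_le (by fun_prop) (by fun_prop)
  exact closure_minimal (fun y hy => (H.mem_Om_iff.1 hy).le) hcl hx

theorem norm_sub_le_norm_add (H : Admissible re ri ε) {x : ℂ}
    (hx : x ∈ closedBall (re : ℂ) re) : ‖(alpha re ri ε : ℂ) - (x + shift re ri ε)‖ ≤
      ‖(alpha re ri ε : ℂ) + (x + shift re ri ε)‖ := by
  refine le_of_sq_le_sq ((le_mul_of_one_le_left (by positivity) H.one_lt_levelE.le).trans
    (H.norm_le_of_mem_Om hx)) (norm_nonneg _)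

theorem tmap_den_ne_zero (H : Admissible re ri ε) {x : ℂ} (hx : x ∈ closedBall (re : ℂ) re)
    (n : ℕ) : (((ratio re ri ε ^ n : ℝ) : ℂ) + 1) * (alpha re ri ε : ℂ) +
      (((ratio re ri ε ^ n : ℝ) : ℂ) - 1) * (x + shift re ri ε) ≠ 0 :=
  mob_den_ne_zero H.alpha_pos (H.one_le_ratio_pow n) (H.norm_sub_le_norm_add hx)

theorem tmap_zero (H : Admissible re ri ε) (x : ℂ) : tmap re ri ε 0 x = x := by
  rw [tmap, pow_zero, mob_one H.alpha_pos.ne', add_sub_cancel_right]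

/-- The map raises levels strictly, so the closed disk goes into the open one. Hence the image terms
of the solution remain regular up to ∂Ω, even though `F` is controlled only inside. -/
theorem tmap_one_mem (H : Admissible re ri ε) {x : ℂ} (hx : x ∈ closedBall (re : ℂ) re) :
    tmap re ri ε 1 x ∈ Om re := by
  have hq := H.one_lt_ratio
  have hE := H.one_lt_levelE
  have hd := H.tmap_den_ne_zero hx 1
  rw [H.mem_Om_iff, tmap, sub_add_cancel]
  -- Lowering the level by the factor q makes the inequality strict on ∂Ω too. The map multiplies
  -- levels by q², which still leaves q times `levelE`, more than `levelE`.
  have h1 : levelE re ri ε / ratio re ri ε *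
      ‖(alpha re ri ε : ℂ) - (x + shift re ri ε)‖ ^ 2 <
      ‖(alpha re ri ε : ℂ) + (x + shift re ri ε)‖ ^ 2 := by
    have h2 := H.norm_le_of_mem_Om hx
    have h3 : levelE re ri ε / ratio re ri ε < levelE re ri ε :=
      div_lt_self (by linarith) hq
    rcases (norm_nonneg ((alpha re ri ε : ℂ) - (x + shift re ri ε))).eq_or_lt with h0 | h0
    · rw [← h0]
      have h5 : x + (shift re ri ε : ℂ) = alpha re ri ε := by
        rw [eq_comm, norm_eq_zero, sub_eq_zero] at h0
        exact h0.symm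
      rw [h5, ← Complex.ofReal_add, Complex.norm_real]
      have := H.alpha_pos
      rw [Real.norm_of_nonneg (by positivity)]
      simp only [ne_eq, OfNat.ofNat_ne_zero, not_false_eq_true, zero_pow, mul_zero]
      positivity
    · exact lt_of_lt_of_le (mul_lt_mul_of_pos_right h3 (by positivity)) h2
  have h4 := normSq_add_of_gt_mob H.alpha_pos (pow_pos H.ratio_pos 1) hd h1
  refine lt_of_le_of_lt (mul_le_mul_of_nonneg_right ?_ (by positivity)) h4
  rw [pow_one]
  have : ratio re ri ε ^ 2 * (levelE re ri ε / ratio re ri ε) =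
      ratio re ri ε * levelE re ri ε := by
    have := H.ratio_pos.ne'
    field_simp
  rw [this]
  nlinarith

theorem tmap_mem (H : Admissible re ri ε) {x : ℂ} (hx : x ∈ Om re) (n : ℕ) :
    tmap re ri ε n x ∈ Om re := by
  have hd := H.tmap_den_ne_zero (ball_subset_closedBall hx) n
  have h1 := normSq_add_of_gt_mob H.alpha_pos (pow_pos H.ratio_pos n) hd (H.mem_Om_iff.1 hx)
  rw [H.mem_Om_iff, tmap, sub_add_cancel]
  refine lt_of_le_of_lt (mul_le_mul_of_nonneg_right ?_ (by positivity)) h1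
  have := H.one_lt_levelE
  exact le_mul_of_one_le_left (by linarith) (one_le_pow₀ (H.one_le_ratio_pow n))

theorem tmap_tmap (H : Admissible re ri ε) {x : ℂ} (hx : x ∈ closedBall (re : ℂ) re) (n : ℕ) :
    tmap re ri ε n (tmap re ri ε 1 x) = tmap re ri ε (n + 1) x := by
  rw [tmap, tmap, sub_add_cancel, mob_mob H.alpha_pos.ne' (H.tmap_den_ne_zero hx 1), ← pow_add,
    tmap]

theorem tmapDeriv_mul (H : Admissible re ri ε) {x : ℂ} (hx : x ∈ closedBall (re : ℂ) re)
    (n : ℕ) : tmapDeriv re ri ε n (tmap re ri ε 1 x) * tmapDeriv re ri ε 1 x =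
      tmapDeriv re ri ε (n + 1) x := by
  rw [tmapDeriv, tmapDeriv, tmap, sub_add_cancel,
    mobDeriv_mul H.alpha_pos.ne' (H.tmap_den_ne_zero hx 1), ← pow_add, tmapDeriv]

theorem hasDerivAt_tmap (H : Admissible re ri ε) {x : ℂ} (hx : x ∈ closedBall (re : ℂ) re)
    (n : ℕ) : HasDerivAt (tmap re ri ε n) (tmapDeriv re ri ε n x) x := by
  have h1 := hasDerivAt_mob (H.tmap_den_ne_zero hx n)
  have h2 : HasDerivAt (fun x : ℂ => x + (shift re ri ε : ℂ)) 1 x :=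
    (hasDerivAt_id x).add_const _
  have h3 := (h1.comp x h2).sub_const (shift re ri ε : ℂ)
  rw [mul_one] at h3
  exact h3

theorem norm_tmapDeriv_le (H : Admissible re ri ε) {x : ℂ} (hx : x ∈ closedBall (re : ℂ) re)
    (n : ℕ) : ‖tmapDeriv re ri ε n x‖ ≤ 4 / ratio re ri ε ^ n :=
  norm_mobDeriv_le H.alpha_pos (H.one_le_ratio_pow n) (H.norm_sub_le_norm_add hx)

theorem conj_tmap (x : ℂ) (n : ℕ) : conj (tmap re ri ε n x) = tmap re ri ε n (conj x) := by
  rw [tmap, map_sub, conj_mob, map_add, Complex.conj_ofReal, tmap]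

theorem conj_tmapDeriv (x : ℂ) (n : ℕ) :
    conj (tmapDeriv re ri ε n x) = tmapDeriv re ri ε n (conj x) := by
  rw [tmapDeriv, conj_mobDeriv, map_add, Complex.conj_ofReal, tmapDeriv]

/-- The reflection in `∂D` as a Möbius transformation. -/
theorem reflConj_incl (H : Admissible re ri ε) {x : ℂ} (hx : x - ((ri + ε : ℝ) : ℂ) ≠ 0) :
    reflConj (ri + ε) ri x + shift re ri ε =
      mob (alpha re ri ε) (levelI re ri ε) (-(x + shift re ri ε)) := by
  have e : x + (shift re ri ε : ℂ) - (ci re ri ε : ℂ) = x - ((ri + ε : ℝ) : ℂ) := by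
    rw [shift, ce]; push_cast; ring
  rw [levelI, (mob_neg_eq H.alpha_lt_ci H.alpha_pos H.ri_sq (by rwa [e])).1, e, reflConj, shift, ce]
  push_cast; ring

theorem reflConj_outer (H : Admissible re ri ε) {x : ℂ} (hx : x - (re : ℂ) ≠ 0) :
    reflConj re re x + shift re ri ε =
      mob (alpha re ri ε) (levelE re ri ε) (-(x + shift re ri ε)) ∧
    ((levelE re ri ε : ℂ) + 1) * (alpha re ri ε : ℂ) +
      ((levelE re ri ε : ℂ) - 1) * (-(x + shift re ri ε)) ≠ 0 := by
  have e : x + (shift re ri ε : ℂ) - (ce re ri ε : ℂ) = x - re := by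
    rw [shift]; push_cast; ring
  have h := mob_neg_eq H.alpha_lt_ce H.alpha_pos H.re_sq (z := x + shift re ri ε) (by rwa [e])
  refine ⟨?_, h.2⟩
  rw [levelE, h.1, e, reflConj, shift]
  push_cast; ring

/-- The composition of the two reflections. -/
theorem tmap_reflConj_outer (H : Admissible re ri ε) {x : ℂ} (hx : x - (re : ℂ) ≠ 0)
    (hx' : x - ((ri + ε : ℝ) : ℂ) ≠ 0) :
    tmap re ri ε 1 (reflConj re re x) = reflConj (ri + ε) ri x := by
  have h := H.reflConj_outer hx
  rw [tmap, pow_one, h.1, mob_mob H.alpha_pos.ne' h.2, H.ratio_mul_levelE, ← H.reflConj_incl hx',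
    add_sub_cancel_right]

theorem conj_mem_ball {c : ℝ} {r : ℝ} {x : ℂ} (hx : x ∈ ball (c : ℂ) r) :
    conj x ∈ ball (c : ℂ) r := by
  rw [mem_ball_iff_norm] at *
  rwa [← Complex.conj_ofReal, ← map_sub, Complex.norm_conj]

theorem reflConj_mem_Om (H : Admissible re ri ε) {x : ℂ} (hx : x ∉ Incl ri ε) :
    reflConj (ri + ε) ri x ∈ Om re := by
  apply closedBall_incl_subset H.eps_pos H.eps_lt
  rw [Incl, mem_ball_iff_norm, not_lt] at hx
  have h := H.ri_pos
  rw [mem_closedBall_iff_norm, reflConj, add_sub_cancel_left, norm_div, norm_pow,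
    Complex.norm_real, Real.norm_of_nonneg h.le, div_le_iff₀ (by linarith), sq]
  exact mul_le_mul_of_nonneg_left hx h.le

theorem sub_center_ne_zero (H : Admissible re ri ε) {x : ℂ} (hx : x ∉ Incl ri ε) :
    x - ((ri + ε : ℝ) : ℂ) ≠ 0 := by
  intro h
  rw [Incl, mem_ball_iff_norm, h, norm_zero] at hx
  exact hx H.ri_pos

end Admissible

/-! ### The solution as a series of images -/

/-- The series of images of `F`. -/
noncomputable def fieldSeries (re ri ε τ : ℝ) (F : ℂ → ℂ) (x : ℂ) : ℂ :=
  ∑' n : ℕ, (-τ : ℂ) ^ n * F (tmap re ri ε n x)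

/-- The derivative of the series of images of a primitive of `Φ`. -/
noncomputable def fieldSeriesDeriv (re ri ε τ : ℝ) (Φ : ℂ → ℂ) (x : ℂ) : ℂ :=
  ∑' n : ℕ, (-τ : ℂ) ^ n * (Φ (tmap re ri ε n x) * tmapDeriv re ri ε n x)

/-- The derivative of the complex field in the shell. -/
noncomputable def shellDeriv (re ri ε τ : ℝ) (Φ : ℂ → ℂ) (x : ℂ) : ℂ :=
  Φ x - τ * (fieldSeriesDeriv re ri ε τ Φ (tmap re ri ε 1 x) * tmapDeriv re ri ε 1 x) -
    τ * (conj (fieldSeriesDeriv re ri ε τ Φ (conj (reflConj (ri + ε) ri x))) *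
      (-((ri : ℂ) ^ 2) / (x - ((ri + ε : ℝ) : ℂ)) ^ 2))

/-- The solution of the transmission problem, where `h` extends the real part of `F`. -/
noncomputable def imageSolution (re ri ε τ : ℝ) (F : ℂ → ℂ) (h : ℂ → ℝ) (x : ℂ) : ℝ :=
  open Classical in
  if x ∈ closedBall ((ri + ε : ℝ) : ℂ) ri then (1 - τ) * (fieldSeries re ri ε τ F x).re
  else h x - τ * (fieldSeries re ri ε τ F (tmap re ri ε 1 x)).re -
    τ * (fieldSeries re ri ε τ F (conj (reflConj (ri + ε) ri x))).re

section Series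

variable {re ri ε τ B : ℝ} {F Φ : ℂ → ℂ}

/-- A bounded derivative on a disk gives a Lipschitz function, which is bounded and whose real part
extends continuously. The extension supplies the values on ∂Ω, where the solution must be
continuous. -/
theorem exists_bound_of_hasDerivAt (hre : 0 < re) (hF : ∀ x ∈ Om re, HasDerivAt F (Φ x) x)
    (hB : ∀ x ∈ Om re, ‖Φ x‖ ≤ B) :
    (∃ h : ℂ → ℝ, Continuous h ∧ EqOn h (fun x => (F x).re) (Om re)) ∧
      ∃ C, ∀ x ∈ Om re, ‖F x‖ ≤ C := by
  have hre0 : (re : ℂ) ∈ Om re := mem_ball_self hre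
  have hB0 : 0 ≤ B := (norm_nonneg _).trans (hB _ hre0)
  have hlip : ∀ x ∈ Om re, ∀ y ∈ Om re, ‖F x - F y‖ ≤ B * ‖x - y‖ := fun x hx y hy =>
    Convex.norm_image_sub_le_of_norm_hasDerivWithin_le
      (fun z hz => (hF z hz).hasDerivWithinAt) hB (convex_ball _ _) hy hx
  constructor
  · have : LipschitzOnWith ⟨B, hB0⟩ (fun x => (F x).re) (Om re) :=
      LipschitzOnWith.of_dist_le_mul fun x hx y hy => by
        rw [dist_eq_norm, dist_eq_norm, ← Complex.sub_re]
        exact (Complex.abs_re_le_norm _).trans (hlip x hx y hy)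
    obtain ⟨h, h1, h2⟩ := this.extend_real
    exact ⟨h, h1.continuous, h2.symm⟩
  · refine ⟨B * re + ‖F re‖, fun x hx => ?_⟩
    have h1 := hlip x hx re hre0
    have h2 := norm_add_le (F x - F re) (F re)
    rw [sub_add_cancel] at h2
    have h3 := mul_le_mul_of_nonneg_left (mem_ball_iff_norm.1 hx).le hB0
    linarith

theorem norm_neg_tau_pow (n : ℕ) : ‖(-τ : ℂ) ^ n‖ = |τ| ^ n := by
  rw [norm_pow, norm_neg, Complex.norm_real, Real.norm_eq_abs]

theorem norm_fieldSeriesDeriv_term_le (H : Admissible re ri ε) (hB : ∀ x ∈ Om re, ‖Φ x‖ ≤ B)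
    {x : ℂ} (hx : x ∈ Om re) (n : ℕ) :
    ‖(-τ : ℂ) ^ n * (Φ (tmap re ri ε n x) * tmapDeriv re ri ε n x)‖ ≤ |τ| ^ n * (B * 4) := by
  have hB0 : 0 ≤ B := (norm_nonneg _).trans (hB _ hx)
  rw [norm_mul, norm_neg_tau_pow, norm_mul]
  have h1 := H.norm_tmapDeriv_le (ball_subset_closedBall hx) n
  have h2 : 4 / ratio re ri ε ^ n ≤ 4 := div_le_self (by norm_num) (H.one_le_ratio_pow n)
  have h3 := hB _ (H.tmap_mem hx n)
  gcongr
  exact h1.trans h2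

theorem summable_fieldSeriesDeriv (H : Admissible re ri ε) (hτ : |τ| < 1)
    (hB : ∀ x ∈ Om re, ‖Φ x‖ ≤ B) {x : ℂ} (hx : x ∈ Om re) :
    Summable fun n : ℕ => (-τ : ℂ) ^ n * (Φ (tmap re ri ε n x) * tmapDeriv re ri ε n x) :=
  Summable.of_norm_bounded ((summable_geometric_of_lt_one (abs_nonneg _) hτ).mul_right (B * 4))
    (norm_fieldSeriesDeriv_term_le H hB hx)

theorem summable_fieldSeries (H : Admissible re ri ε) (hτ : |τ| < 1)
    (hF : ∀ x ∈ Om re, HasDerivAt F (Φ x) x) (hB : ∀ x ∈ Om re, ‖Φ x‖ ≤ B)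
    {x : ℂ} (hx : x ∈ Om re) :
    Summable fun n : ℕ => (-τ : ℂ) ^ n * F (tmap re ri ε n x) := by
  obtain ⟨C, hC⟩ := (exists_bound_of_hasDerivAt H.re_pos hF hB).2
  refine Summable.of_norm_bounded
    ((summable_geometric_of_lt_one (abs_nonneg _) hτ).mul_right C) fun n => ?_
  rw [norm_mul, norm_neg_tau_pow]
  exact mul_le_mul_of_nonneg_left (hC _ (H.tmap_mem hx n)) (by positivity)

theorem hasDerivAt_fieldSeries (H : Admissible re ri ε) (hτ : |τ| < 1)
    (hF : ∀ x ∈ Om re, HasDerivAt F (Φ x) x) (hB : ∀ x ∈ Om re, ‖Φ x‖ ≤ B)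
    {x : ℂ} (hx : x ∈ Om re) :
    HasDerivAt (fieldSeries re ri ε τ F) (fieldSeriesDeriv re ri ε τ Φ x) x := by
  refine hasDerivAt_tsum_of_isPreconnected
    ((summable_geometric_of_lt_one (abs_nonneg _) hτ).mul_right (B * 4)) isOpen_ball
    (convex_ball (re : ℂ) re).isPreconnected (fun n y hy => ?_)
    (fun n y hy => norm_fieldSeriesDeriv_term_le H hB hy n) hx
    (summable_fieldSeries H hτ hF hB hx) hx
  exact ((hF _ (H.tmap_mem hy n)).comp y
    (H.hasDerivAt_tmap (ball_subset_closedBall hy) n)).const_mul _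

/-- Splitting off the first image yields S = F - τ S∘T. This functional equation and its derivative
`fieldSeriesDeriv_eq` give the two transmission conditions. -/
theorem fieldSeries_eq (H : Admissible re ri ε) (hτ : |τ| < 1)
    (hF : ∀ x ∈ Om re, HasDerivAt F (Φ x) x) (hB : ∀ x ∈ Om re, ‖Φ x‖ ≤ B)
    {x : ℂ} (hx : x ∈ Om re) : fieldSeries re ri ε τ F x =
      F x - τ * fieldSeries re ri ε τ F (tmap re ri ε 1 x) := by
  rw [fieldSeries, (summable_fieldSeries H hτ hF hB hx).tsum_eq_zero_add, pow_zero, one_mul,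
    H.tmap_zero, fieldSeries, ← tsum_mul_left, sub_eq_add_neg, ← tsum_neg]
  congr 1
  refine tsum_congr fun n => ?_
  rw [H.tmap_tmap (ball_subset_closedBall hx)]
  ring

theorem fieldSeriesDeriv_eq (H : Admissible re ri ε) (hτ : |τ| < 1)
    (hB : ∀ x ∈ Om re, ‖Φ x‖ ≤ B) {x : ℂ} (hx : x ∈ Om re) :
    fieldSeriesDeriv re ri ε τ Φ x = Φ x - τ *
      (fieldSeriesDeriv re ri ε τ Φ (tmap re ri ε 1 x) * tmapDeriv re ri ε 1 x) := by
  rw [fieldSeriesDeriv, (summable_fieldSeriesDeriv H hτ hB hx).tsum_eq_zero_add, pow_zero,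
    one_mul, H.tmap_zero, fieldSeriesDeriv, ← tsum_mul_right, ← tsum_mul_left, sub_eq_add_neg,
    ← tsum_neg]
  congr 1
  · have : tmapDeriv re ri ε 0 x = 1 := by
      have ha : (alpha re ri ε : ℂ) ≠ 0 := Complex.ofReal_ne_zero.2 H.alpha_pos.ne'
      rw [tmapDeriv, mobDeriv, pow_zero]; push_cast; field_simp; ring
    rw [this, mul_one]
  refine tsum_congr fun n => ?_
  rw [H.tmap_tmap (ball_subset_closedBall hx), ← H.tmapDeriv_mul (ball_subset_closedBall hx)]
  ring

theorem differentiableOn_fieldSeries (H : Admissible re ri ε) (hτ : |τ| < 1)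
    (hF : ∀ x ∈ Om re, HasDerivAt F (Φ x) x) (hB : ∀ x ∈ Om re, ‖Φ x‖ ≤ B) :
    DifferentiableOn ℂ (fieldSeries re ri ε τ F) (Om re) := fun _ hx =>
  (hasDerivAt_fieldSeries H hτ hF hB hx).differentiableAt.differentiableWithinAt

theorem continuousOn_fieldSeriesDeriv (H : Admissible re ri ε) (hτ : |τ| < 1)
    (hF : ∀ x ∈ Om re, HasDerivAt F (Φ x) x) (hB : ∀ x ∈ Om re, ‖Φ x‖ ≤ B) :
    ContinuousOn (fieldSeriesDeriv re ri ε τ Φ) (Om re) := by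
  refine (((differentiableOn_fieldSeries H hτ hF hB).analyticOnNhd
    isOpen_ball).deriv.continuousOn).congr fun x hx => ?_
  exact (hasDerivAt_fieldSeries H hτ hF hB hx).deriv.symm

theorem continuousOn_of_primitive (hF : ∀ x ∈ Om re, HasDerivAt F (Φ x) x) :
    ContinuousOn Φ (Om re) := by
  have hd : DifferentiableOn ℂ F (Om re) := fun x hx =>
    (hF x hx).differentiableAt.differentiableWithinAt
  refine ((hd.analyticOnNhd isOpen_ball).deriv.continuousOn).congr fun x hx => ?_
  exact (hF x hx).deriv.symm

theorem conj_reflConj_mem (H : Admissible re ri ε) {x : ℂ} (hx : x ∉ Incl ri ε) :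
    conj (reflConj (ri + ε) ri x) ∈ Om re :=
  Admissible.conj_mem_ball (H.reflConj_mem_Om hx)

theorem hasDerivAt_reflected (H : Admissible re ri ε) (hτ : |τ| < 1)
    (hF : ∀ x ∈ Om re, HasDerivAt F (Φ x) x) (hB : ∀ x ∈ Om re, ‖Φ x‖ ≤ B)
    {x : ℂ} (hx : x ∉ Incl ri ε) :
    HasDerivAt (fun y => conj (fieldSeries re ri ε τ F (conj (reflConj (ri + ε) ri y))))
      (conj (fieldSeriesDeriv re ri ε τ Φ (conj (reflConj (ri + ε) ri x))) *
      (-((ri : ℂ) ^ 2) / (x - ((ri + ε : ℝ) : ℂ)) ^ 2)) x := by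
  have h1 := (hasDerivAt_fieldSeries H hτ hF hB (conj_reflConj_mem H hx)).conj_conj
  rw [Complex.conj_conj] at h1
  exact h1.comp x (hasDerivAt_reflConj (H.sub_center_ne_zero hx))

theorem continuousAt_reflected (H : Admissible re ri ε) (hτ : |τ| < 1)
    (hF : ∀ x ∈ Om re, HasDerivAt F (Φ x) x) (hB : ∀ x ∈ Om re, ‖Φ x‖ ≤ B)
    {x : ℂ} (hx : x ∉ Incl ri ε) :
    ContinuousAt (fun x => conj (fieldSeriesDeriv re ri ε τ Φ (conj (reflConj (ri + ε) ri x))) *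
      (-((ri : ℂ) ^ 2) / (x - ((ri + ε : ℝ) : ℂ)) ^ 2)) x := by
  have h1 := (continuousOn_fieldSeriesDeriv H hτ hF hB).continuousAt
    (isOpen_ball.mem_nhds (conj_reflConj_mem H hx))
  have h2 : ContinuousAt (fun y => conj (reflConj (ri + ε) ri y)) x :=
    Complex.continuous_conj.continuousAt.comp
      (hasDerivAt_reflConj (H.sub_center_ne_zero hx)).continuousAt
  refine (Complex.continuous_conj.continuousAt.comp
    (ContinuousAt.comp (f := fun y => conj (reflConj (ri + ε) ri y)) h1 h2)).mul ?_
  have := H.sub_center_ne_zero hx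
  exact ContinuousAt.div (by fun_prop) (by fun_prop) (by positivity)

theorem continuousAt_shifted (H : Admissible re ri ε) (hτ : |τ| < 1)
    (hF : ∀ x ∈ Om re, HasDerivAt F (Φ x) x) (hB : ∀ x ∈ Om re, ‖Φ x‖ ≤ B)
    {x : ℂ} (hx : x ∈ closedBall (re : ℂ) re) :
    ContinuousAt (fun x => fieldSeriesDeriv re ri ε τ Φ (tmap re ri ε 1 x) *
      tmapDeriv re ri ε 1 x) x := by
  have h1 := (continuousOn_fieldSeriesDeriv H hτ hF hB).continuousAt
    (isOpen_ball.mem_nhds (H.tmap_one_mem hx))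
  refine (ContinuousAt.comp (f := tmap re ri ε 1) h1
    (H.hasDerivAt_tmap hx 1).continuousAt).mul ?_
  have h2 := H.tmap_den_ne_zero hx 1
  unfold tmapDeriv mobDeriv
  exact ContinuousAt.div (by fun_prop) (by fun_prop) (pow_ne_zero 2 h2)

theorem hasDerivAt_shell (H : Admissible re ri ε) (hτ : |τ| < 1)
    (hF : ∀ x ∈ Om re, HasDerivAt F (Φ x) x) (hB : ∀ x ∈ Om re, ‖Φ x‖ ≤ B)
    {x : ℂ} (hxO : x ∈ Om re) (hx : x ∉ Incl ri ε) :
    HasDerivAt (fun y => F y - τ * fieldSeries re ri ε τ F (tmap re ri ε 1 y) -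
      τ * conj (fieldSeries re ri ε τ F (conj (reflConj (ri + ε) ri y))))
      (shellDeriv re ri ε τ Φ x) x := by
  have h1 := (hasDerivAt_fieldSeries H hτ hF hB
    (H.tmap_one_mem (ball_subset_closedBall hxO))).comp x
    (H.hasDerivAt_tmap (ball_subset_closedBall hxO) 1)
  exact ((hF x hxO).sub (h1.const_mul _)).sub
    ((hasDerivAt_reflected H hτ hF hB hx).const_mul _)

theorem not_mem_Incl_of_mem_Shell {x : ℂ} (hx : x ∈ Shell re ri ε) : x ∉ Incl ri ε :=
  fun h => hx.2 (ball_subset_closedBall h)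

variable {h : ℂ → ℝ}

theorem imageSolution_eq_on_incl : EqOn (imageSolution re ri ε τ F h)
    (fun x => (((1 - τ : ℝ) : ℂ) * fieldSeries re ri ε τ F x).re)
    (closedBall ((ri + ε : ℝ) : ℂ) ri) := fun x hx => by
  simp only [imageSolution, if_pos hx, Complex.re_ofReal_mul]

/-- On ∂D the inversion fixes `x`, and the shell formula becomes the real part of F - τ S∘T - τ S,
that is of (1 - τ) S by the functional equation. So the two definitions match on ∂D. -/
theorem imageSolution_eq_on_shell (H : Admissible re ri ε) (hτ : |τ| < 1)
    (hF : ∀ x ∈ Om re, HasDerivAt F (Φ x) x) (hB : ∀ x ∈ Om re, ‖Φ x‖ ≤ B)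
    (hh : EqOn h (fun x => (F x).re) (Om re)) : EqOn (imageSolution re ri ε τ F h)
    (fun x => h x - τ * (fieldSeries re ri ε τ F (tmap re ri ε 1 x)).re -
      τ * (fieldSeries re ri ε τ F (conj (reflConj (ri + ε) ri x))).re)
    (closedBall (re : ℂ) re \ Incl ri ε) := fun x hx => by
  by_cases hxc : x ∈ closedBall ((ri + ε : ℝ) : ℂ) ri
  · have hxs : x ∈ sphere ((ri + ε : ℝ) : ℂ) ri := by
      rw [← closedBall_sdiff_ball]; exact ⟨hxc, hx.2⟩
    have hxO : x ∈ Om re := closedBall_incl_subset H.eps_pos H.eps_lt hxc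
    have e := fieldSeries_eq H hτ hF hB hxO
    simp only [imageSolution, if_pos hxc]
    rw [reflConj_of_mem_sphere H.ri_pos hxs, Complex.conj_conj, hh hxO]
    have e2 := congrArg Complex.re e
    rw [Complex.sub_re, Complex.re_ofReal_mul] at e2
    linarith
  · simp only [imageSolution, if_neg hxc]

theorem imageSolution_re_shell (H : Admissible re ri ε) (hτ : |τ| < 1)
    (hF : ∀ x ∈ Om re, HasDerivAt F (Φ x) x) (hB : ∀ x ∈ Om re, ‖Φ x‖ ≤ B)
    (hh : EqOn h (fun x => (F x).re) (Om re)) {x : ℂ} (hx : x ∈ Shell re ri ε) :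
    imageSolution re ri ε τ F h x =
      (F x - τ * fieldSeries re ri ε τ F (tmap re ri ε 1 x) -
      τ * conj (fieldSeries re ri ε τ F (conj (reflConj (ri + ε) ri x)))).re := by
  rw [imageSolution_eq_on_shell H hτ hF hB hh
    ⟨ball_subset_closedBall hx.1, not_mem_Incl_of_mem_Shell hx⟩]
  simp only [hh hx.1, Complex.sub_re, Complex.re_ofReal_mul, Complex.conj_re]

theorem hasGradientAt_imageSolution_incl (H : Admissible re ri ε) (hτ : |τ| < 1)
    (hF : ∀ x ∈ Om re, HasDerivAt F (Φ x) x) (hB : ∀ x ∈ Om re, ‖Φ x‖ ≤ B)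
    {x : ℂ} (hx : x ∈ Incl ri ε) : HasGradientAt (imageSolution re ri ε τ F h)
      (conj (((1 - τ : ℝ) : ℂ) * fieldSeriesDeriv re ri ε τ Φ x)) x := by
  have hxO := closedBall_incl_subset H.eps_pos H.eps_lt (ball_subset_closedBall hx)
  refine (hasGradientAt_re ((hasDerivAt_fieldSeries H hτ hF hB hxO).const_mul
    ((1 - τ : ℝ) : ℂ))).congr_of_eventuallyEq ?_
  filter_upwards [isOpen_Incl.mem_nhds hx] with y hy
  exact imageSolution_eq_on_incl (ball_subset_closedBall hy)

theorem hasGradientAt_imageSolution_shell (H : Admissible re ri ε) (hτ : |τ| < 1)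
    (hF : ∀ x ∈ Om re, HasDerivAt F (Φ x) x) (hB : ∀ x ∈ Om re, ‖Φ x‖ ≤ B)
    (hh : EqOn h (fun x => (F x).re) (Om re)) {x : ℂ} (hx : x ∈ Shell re ri ε) :
    HasGradientAt (imageSolution re ri ε τ F h) (conj (shellDeriv re ri ε τ Φ x)) x := by
  refine (hasGradientAt_re (hasDerivAt_shell H hτ hF hB hx.1
    (not_mem_Incl_of_mem_Shell hx))).congr_of_eventuallyEq ?_
  filter_upwards [isOpen_Shell.mem_nhds hx] with y hy
  exact imageSolution_re_shell H hτ hF hB hh hy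

theorem tendsto_segment (x n : ℂ) : Tendsto (fun t : ℝ => x + t • n) (𝓝[>] 0) (𝓝 x) := by
  have : Continuous fun t : ℝ => x + t • n := by fun_prop
  have h := this.tendsto 0
  rw [zero_smul, add_zero] at h
  exact h.mono_left nhdsWithin_le_nhds

theorem tendsto_segment_sub (x n : ℂ) : Tendsto (fun t : ℝ => x - t • n) (𝓝[>] 0) (𝓝 x) := by
  have : Continuous fun t : ℝ => x - t • n := by fun_prop
  have h := this.tendsto 0
  rw [zero_smul, sub_zero] at h
  exact h.mono_left nhdsWithin_le_nhds

/-- The normal derivative of the series on `∂D`, seen from the shell. -/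
theorem re_shellDeriv_mul_normal (H : Admissible re ri ε) (hτ : |τ| < 1)
    (hB : ∀ x ∈ Om re, ‖Φ x‖ ≤ B) {x : ℂ} (hx : x ∈ sphere ((ri + ε : ℝ) : ℂ) ri) :
    (shellDeriv re ri ε τ Φ x * normal ((ri + ε : ℝ) : ℂ) ri x).re =
      (1 + τ) * (fieldSeriesDeriv re ri ε τ Φ x * normal ((ri + ε : ℝ) : ℂ) ri x).re := by
  have hxO : x ∈ Om re :=
    closedBall_incl_subset H.eps_pos H.eps_lt (sphere_subset_closedBall hx)
  have h1 := reflConj_deriv_mul_normal H.ri_pos hx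
  have h2 := reflConj_of_mem_sphere H.ri_pos hx
  have h3 := fieldSeriesDeriv_eq H hτ hB hxO
  set n := normal ((ri + ε : ℝ) : ℂ) ri x
  -- F - τ S∘T contributes the derivative of S, and the reflected term contributes τ times a
  -- conjugate because the inversion reverses the normal. Real parts add up with the factor 1 + τ.
  have e : shellDeriv re ri ε τ Φ x * n = fieldSeriesDeriv re ri ε τ Φ x * n +
      τ * conj (fieldSeriesDeriv re ri ε τ Φ x * n) := by
    rw [shellDeriv, h2, Complex.conj_conj, map_mul]
    linear_combination (-n) * h3 - τ * conj (fieldSeriesDeriv re ri ε τ Φ x) * h1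
  rw [e, Complex.add_re, Complex.re_ofReal_mul, Complex.conj_re]
  ring

/-- On `∂Ω` the two families of images have opposite fluxes. -/
theorem reflected_flux (H : Admissible re ri ε) {x : ℂ} (hx : x ∈ sphere (re : ℂ) re) :
    conj (reflConj (ri + ε) ri x) = tmap re ri ε 1 x ∧
    -((ri : ℂ) ^ 2) / (x - ((ri + ε : ℝ) : ℂ)) ^ 2 * normal re re x =
      -conj (tmapDeriv re ri ε 1 x * normal re re x) := by
  have hre := H.re_pos
  have hxI : x ∉ Incl ri ε := fun h => by
    have := closedBall_incl_subset H.eps_pos H.eps_lt (ball_subset_closedBall h)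
    rw [Om, mem_ball_iff_norm, mem_sphere_iff_norm.1 hx] at this
    exact lt_irrefl _ this
  have h0 : x - (re : ℂ) ≠ 0 := by
    rw [← norm_pos_iff, mem_sphere_iff_norm.1 hx]; exact hre
  have hc0 := H.sub_center_ne_zero hxI
  have h2 := reflConj_of_mem_sphere hre hx
  have h3 := reflConj_deriv_mul_normal hre hx
  have e1 := H.tmap_reflConj_outer h0 hc0
  rw [h2] at e1
  refine ⟨by rw [← e1, Admissible.conj_tmap, Complex.conj_conj], ?_⟩
  have hconj : conj x ∈ closedBall (re : ℂ) re := by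
    rw [mem_closedBall_iff_norm, ← Complex.conj_ofReal re, ← map_sub, Complex.norm_conj,
      mem_sphere_iff_norm.1 hx]
  have hd1 := H.hasDerivAt_tmap hconj 1
  rw [← h2] at hd1
  have hd2 := hd1.comp x (hasDerivAt_reflConj (c := re) (r := re) h0)
  have hd3 := hasDerivAt_reflConj (c := ri + ε) (r := ri) hc0
  -- The factorisation of one reflection through the other holds away from the two centres, hence
  -- near `x`, so it may be differentiated there.
  have hev : (tmap re ri ε 1 ∘ reflConj re re) =ᶠ[𝓝 x] reflConj (ri + ε) ri := by
    have o1 : IsOpen {y : ℂ | y - (re : ℂ) ≠ 0} := isOpen_ne_fun (by fun_prop) (by fun_prop)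
    have o2 : IsOpen {y : ℂ | y - ((ri + ε : ℝ) : ℂ) ≠ 0} :=
      isOpen_ne_fun (by fun_prop) (by fun_prop)
    filter_upwards [o1.mem_nhds h0, o2.mem_nhds hc0] with y hy1 hy2
    exact H.tmap_reflConj_outer hy1 hy2
  have h4 := (hd2.congr_of_eventuallyEq hev.symm).unique hd3
  rw [← h4, h2, ← Admissible.conj_tmapDeriv, mul_assoc, h3, map_mul]
  ring

theorem isSolution_imageSolution (H : Admissible re ri ε) {k : ℝ} (hk : 0 < k)
    (hτk : τ = tau k) {g : ℂ → ℝ} (hτ : |τ| < 1)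
    (hF : ∀ x ∈ Om re, HasDerivAt F (Φ x) x) (hB : ∀ x ∈ Om re, ‖Φ x‖ ≤ B)
    (hh : EqOn h (fun x => (F x).re) (Om re)) (hhc : Continuous h)
    (hg : ∀ x ∈ sphere (re : ℂ) re, Tendsto
      (fun t : ℝ => (Φ (x - t • normal re re x) * normal re re x).re) (𝓝[>] 0) (𝓝 (g x))) :
    IsSolution re ri ε k g (imageSolution re ri ε τ F h) where
  continuousOn := by
    have hfc := (differentiableOn_fieldSeries H hτ hF hB).continuousOn
    have hsub := closedBall_incl_subset H.eps_pos H.eps_lt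
    have h1 : ContinuousOn (imageSolution re ri ε τ F h) (closedBall ((ri + ε : ℝ) : ℂ) ri) := by
      refine ContinuousOn.congr ?_ imageSolution_eq_on_incl
      exact Complex.continuous_re.comp_continuousOn (continuousOn_const.mul (hfc.mono hsub))
    have h2 : ContinuousOn (imageSolution re ri ε τ F h)
        (closedBall (re : ℂ) re \ Incl ri ε) := by
      refine ContinuousOn.congr ?_ (imageSolution_eq_on_shell H hτ hF hB hh)
      refine (hhc.continuousOn.sub (continuousOn_const.mul
        (Complex.continuous_re.comp_continuousOn ?_))).sub (continuousOn_const.mul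
        (Complex.continuous_re.comp_continuousOn ?_))
      · exact hfc.comp (fun x hx => (H.hasDerivAt_tmap hx.1 1).continuousAt.continuousWithinAt)
          fun x hx => H.tmap_one_mem hx.1
      · refine hfc.comp (fun x hx => ?_) fun x hx => conj_reflConj_mem H hx.2
        exact (Complex.continuous_conj.continuousAt.comp
          (hasDerivAt_reflConj (H.sub_center_ne_zero hx.2)).continuousAt).continuousWithinAt
    have h3 := h1.union_of_isClosed h2 isClosed_closedBall
      (isClosed_closedBall.sdiff isOpen_Incl)
    refine h3.mono fun x hx => ?_
    by_cases hxI : x ∈ Incl ri ε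
    · exact Or.inl (ball_subset_closedBall hxI)
    · exact Or.inr ⟨hx, hxI⟩
  harmonic_incl := fun x hx => by
    have hxO := closedBall_incl_subset H.eps_pos H.eps_lt (ball_subset_closedBall hx)
    have han : AnalyticAt ℂ (fun x => ((1 - τ : ℝ) : ℂ) * fieldSeries re ri ε τ F x) x :=
      (differentiableOn_const _ |>.mul (differentiableOn_fieldSeries H hτ hF hB)).analyticAt
        (isOpen_ball.mem_nhds hxO)
    refine (harmonicAt_congr_nhds ?_).1 han.harmonicAt_re
    filter_upwards [isOpen_Incl.mem_nhds hx] with y hy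
    exact (imageSolution_eq_on_incl (ball_subset_closedBall hy)).symm
  harmonic_shell := fun x hx => by
    have hd : DifferentiableOn ℂ (fun y => F y - τ * fieldSeries re ri ε τ F (tmap re ri ε 1 y) -
      τ * conj (fieldSeries re ri ε τ F (conj (reflConj (ri + ε) ri y)))) (Shell re ri ε) :=
      fun y hy => (hasDerivAt_shell H hτ hF hB hy.1
        (not_mem_Incl_of_mem_Shell hy)).differentiableAt.differentiableWithinAt
    refine (harmonicAt_congr_nhds ?_).1
      (hd.analyticAt (isOpen_Shell.mem_nhds hx)).harmonicAt_re
    filter_upwards [isOpen_Shell.mem_nhds hx] with y hy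
    exact (imageSolution_re_shell H hτ hF hB hh hy).symm
  transmission := fun x hx => by
    have hxO : x ∈ Om re :=
      closedBall_incl_subset H.eps_pos H.eps_lt (sphere_subset_closedBall hx)
    have hxI : x ∉ Incl ri ε := by
      rw [Incl, mem_ball_iff_norm, mem_sphere_iff_norm.1 hx]; exact lt_irrefl _
    have hflux := re_shellDeriv_mul_normal H hτ hB hx
    have hmI := fun t (ht : t ∈ Ioo 0 ri) => sub_normal_mem_Incl H.ri_pos hx ht
    have hmS := fun t (ht : t ∈ Ioo 0 ε) => add_normal_mem_Shell H.ri_pos H.eps_lt hx ht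
    refine ⟨(((1 - τ : ℝ) : ℂ) * fieldSeriesDeriv re ri ε τ Φ x *
      normal ((ri + ε : ℝ) : ℂ) ri x).re, ?_, ?_⟩
    · rw [HasInnerNormalDeriv]
      have hc := (continuousOn_fieldSeriesDeriv H hτ hF hB).continuousAt (isOpen_ball.mem_nhds hxO)
      have := Complex.continuous_re.continuousAt.tendsto.comp
        (((hc.tendsto.comp (tendsto_segment_sub x (normal ((ri + ε : ℝ) : ℂ) ri x))).const_mul
          ((1 - τ : ℝ) : ℂ)).mul_const (normal ((ri + ε : ℝ) : ℂ) ri x))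
      refine this.congr' ?_
      filter_upwards [Ioo_mem_nhdsGT H.ri_pos] with t ht
      rw [(hasGradientAt_imageSolution_incl H hτ hF hB (hmI t ht)).gradient, inner_conj_left]
      rfl
    -- Here τ = (k - 1)/(k + 1) enters, in the form k(1 - τ) = 1 + τ.
    · have hval : k * (((1 - τ : ℝ) : ℂ) * fieldSeriesDeriv re ri ε τ Φ x *
          normal ((ri + ε : ℝ) : ℂ) ri x).re =
          (shellDeriv re ri ε τ Φ x * normal ((ri + ε : ℝ) : ℂ) ri x).re := by
        rw [hflux, mul_assoc, Complex.re_ofReal_mul, ← mul_assoc]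
        congr 1
        rw [hτk, tau]; field_simp; ring
      rw [hval, HasOuterNormalDeriv]
      have hc : ContinuousAt (shellDeriv re ri ε τ Φ) x :=
        (((continuousOn_of_primitive hF).continuousAt (isOpen_ball.mem_nhds hxO)).sub
          (continuousAt_const.mul (continuousAt_shifted H hτ hF hB
            (ball_subset_closedBall hxO)))).sub
          (continuousAt_const.mul (continuousAt_reflected H hτ hF hB hxI))
      have := Complex.continuous_re.continuousAt.tendsto.comp
        ((hc.tendsto.comp (tendsto_segment x (normal ((ri + ε : ℝ) : ℂ) ri x))).mul_const
          (normal ((ri + ε : ℝ) : ℂ) ri x))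
      refine this.congr' ?_
      filter_upwards [Ioo_mem_nhdsGT H.eps_pos] with t ht
      rw [(hasGradientAt_imageSolution_shell H hτ hF hB hh (hmS t ht)).gradient, inner_conj_left]
      rfl
  neumann := fun x hx => by
    have hxc := sphere_subset_closedBall hx
    have hxI : x ∉ Incl ri ε := fun h => by
      have := closedBall_incl_subset H.eps_pos H.eps_lt (ball_subset_closedBall h)
      rw [Om, mem_ball_iff_norm, mem_sphere_iff_norm.1 hx] at this
      exact lt_irrefl _ this
    obtain ⟨hf1, hf2⟩ := reflected_flux H hx
    rw [HasInnerNormalDeriv]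
    have hmS := fun t (ht : t ∈ Ioo 0 ε) =>
      sub_normal_mem_Shell H.re_pos H.eps_pos H.eps_lt H.ri_pos hx ht
    have hgx := hg x hx
    set n := normal (re : ℂ) re x
    -- The two image families are continuous up to ∂Ω and their fluxes there cancel, so the whole
    -- flux comes from `Φ`.
    have hc := (continuousAt_shifted H hτ hF hB hxc).add (continuousAt_reflected H hτ hF hB hxI)
    have h1 := Complex.continuous_re.continuousAt.tendsto.comp
      ((hc.tendsto.comp (tendsto_segment_sub x n)).mul_const n)
    have hz : ((fieldSeriesDeriv re ri ε τ Φ (tmap re ri ε 1 x) * tmapDeriv re ri ε 1 x +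
        conj (fieldSeriesDeriv re ri ε τ Φ (conj (reflConj (ri + ε) ri x))) *
        (-((ri : ℂ) ^ 2) / (x - ((ri + ε : ℝ) : ℂ)) ^ 2)) * n).re = 0 := by
      rw [hf1]
      have e : (fieldSeriesDeriv re ri ε τ Φ (tmap re ri ε 1 x) * tmapDeriv re ri ε 1 x +
        conj (fieldSeriesDeriv re ri ε τ Φ (tmap re ri ε 1 x)) *
        (-((ri : ℂ) ^ 2) / (x - ((ri + ε : ℝ) : ℂ)) ^ 2)) * n =
        fieldSeriesDeriv re ri ε τ Φ (tmap re ri ε 1 x) * tmapDeriv re ri ε 1 x * n -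
        conj (fieldSeriesDeriv re ri ε τ Φ (tmap re ri ε 1 x) * tmapDeriv re ri ε 1 x * n) := by
        rw [mul_assoc (fieldSeriesDeriv re ri ε τ Φ (tmap re ri ε 1 x)), map_mul]
        linear_combination conj (fieldSeriesDeriv re ri ε τ Φ (tmap re ri ε 1 x)) * hf2
      rw [e, Complex.sub_re, Complex.conj_re, sub_self]
    simp only [Pi.add_apply] at h1
    rw [hz] at h1
    have h2 := hgx.sub (h1.const_mul τ)
    rw [mul_zero, sub_zero] at h2
    refine h2.congr' ?_
    filter_upwards [Ioo_mem_nhdsGT H.eps_pos] with t ht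
    rw [(hasGradientAt_imageSolution_shell H hτ hF hB hh (hmS t ht)).gradient, inner_conj_left,
      shellDeriv]
    simp only [Function.comp_apply, Pi.add_apply]
    rw [← Complex.re_ofReal_mul, ← Complex.sub_re]
    congr 1
    ring

end Series

/-! ### The kernel `v / (1 + v)²` along rays -/

/-- The weighted kernel `N v / (1 + v)²` at `v = s ζ`, with the weight `N = |1 + ζ|² / |ζ|`. -/
noncomputable def rayKernel (ζ : ℂ) (s : ℝ) : ℂ :=
  ((‖1 + ζ‖ ^ 2 / ‖ζ‖ : ℝ) : ℂ) * (s * ζ / (1 + s * ζ) ^ 2)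

/-- A function whose increments dominate those of `rayKernel`. -/
noncomputable def rayMajorant (b s : ℝ) : ℝ := -(3 * b ^ 2 * (b + 2 * s - 1) / (b + s - 1) ^ 2)

section Ray

variable {ζ : ℂ} {s : ℝ}

/-- The bounds do not depend on b, which stands for |1+ζ|/|ζ| in (0, 2] and may be arbitrarily
small. At s = 1 the value is -3(b + 1), which explains the 9. -/
theorem rayMajorant_bounds {b : ℝ} (hb : 0 < b) (hb2 : b ≤ 2) (hs : 1 ≤ s) :
    -9 ≤ rayMajorant b s ∧ rayMajorant b s ≤ 0 := by
  have hw : 0 < b + s - 1 := by linarith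
  rw [rayMajorant]
  constructor
  · rw [neg_le_neg_iff, div_le_iff₀ (by positivity)]
    obtain ⟨y, hy⟩ : ∃ y, s = 1 + y := ⟨s - 1, by ring⟩
    subst hy
    have hy : 0 ≤ y := by linarith
    have h1 : 0 ≤ b ^ 2 * (2 - b) := mul_nonneg (by positivity) (by linarith)
    have h2 : 0 ≤ b * y * (3 - b) := mul_nonneg (by positivity) (by linarith)
    nlinarith [sq_nonneg y]
  · rw [neg_nonpos]
    have : 0 < b + 2 * s - 1 := by linarith
    positivity

theorem hasDerivAt_rayMajorant {b : ℝ} (hb : 0 < b) (hs : 1 ≤ s) :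
    HasDerivAt (rayMajorant b) (6 * b ^ 2 * s / (b + s - 1) ^ 3) s := by
  have hw : b + s - 1 ≠ 0 := by linarith
  have h1 : HasDerivAt (fun s : ℝ => 3 * b ^ 2 * (b + 2 * s - 1)) (3 * b ^ 2 * (2 * 1)) s :=
    ((((hasDerivAt_id s).const_mul 2).const_add b).sub_const 1).const_mul _
  have h2 : HasDerivAt (fun s : ℝ => (b + s - 1) ^ 2) ((2 : ℕ) * (b + s - 1) ^ (2 - 1) * 1) s :=
    (((hasDerivAt_id s).const_add b).sub_const 1).pow 2
  convert! (h1.div h2 (pow_ne_zero 2 hw)).neg using 1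
  field_simp
  ring

theorem rayMajorant_mono {b s' : ℝ} (hb : 0 < b) (hs : 1 ≤ s) (hss : s ≤ s') :
    rayMajorant b s ≤ rayMajorant b s' := by
  have hm : MonotoneOn (rayMajorant b) (Ici 1) := by
    refine monotoneOn_of_deriv_nonneg (convex_Ici 1)
      (fun x hx => (hasDerivAt_rayMajorant hb hx).continuousAt.continuousWithinAt)
      (fun x hx => ?_) fun x hx => ?_
    · rw [interior_Ici] at hx
      exact (hasDerivAt_rayMajorant hb (le_of_lt hx)).differentiableAt.differentiableWithinAt
    · rw [interior_Ici] at hx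
      have hx' : 1 < x := hx
      have : 0 < b + x - 1 := by linarith
      rw [(hasDerivAt_rayMajorant hb (le_of_lt hx)).deriv]
      positivity
  exact hm hs (hs.trans hss) hss

theorem norm_ratio_pos (hζ : 1 ≤ ‖ζ‖) (hζ1 : 1 + ζ ≠ 0) : 0 < ‖1 + ζ‖ / ‖ζ‖ :=
  div_pos (norm_pos_iff.2 hζ1) (by linarith)

theorem norm_ratio_le_two (hζ : 1 ≤ ‖ζ‖) : ‖1 + ζ‖ / ‖ζ‖ ≤ 2 := by
  rw [div_le_iff₀ (by linarith)]
  have := norm_add_le 1 ζ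
  rw [norm_one] at this
  linarith

/-- Expand |1 + sζ|² = |(1 + ζ) + (s - 1)ζ|². The cross term is a nonnegative multiple of Re ζ +
|ζ|², which is nonnegative for |ζ| ≥ 1; then (x + y)² ≤ 2(x² + y²). -/
theorem norm_one_add_mul_sq_ge (hζ : 1 ≤ ‖ζ‖) (hs : 1 ≤ s) :
    ‖ζ‖ ^ 2 * (‖1 + ζ‖ / ‖ζ‖ + s - 1) ^ 2 ≤ 2 * ‖1 + s * ζ‖ ^ 2 := by
  have hz : 0 < ‖ζ‖ := by linarith
  have e : ‖ζ‖ ^ 2 * (‖1 + ζ‖ / ‖ζ‖ + s - 1) ^ 2 = (‖1 + ζ‖ + ‖ζ‖ * (s - 1)) ^ 2 := by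
    field_simp; ring
  have h1 : ‖1 + ζ‖ ^ 2 + (s - 1) ^ 2 * ‖ζ‖ ^ 2 ≤ ‖1 + s * ζ‖ ^ 2 := by
    have h2 : -‖ζ‖ ≤ ζ.re := (abs_le.1 (Complex.abs_re_le_norm ζ)).1
    have h3 : ‖ζ‖ ^ 2 = ζ.re * ζ.re + ζ.im * ζ.im := by
      rw [← Complex.normSq_eq_norm_sq, Complex.normSq_apply]
    have h5 : ζ.re ≥ -‖ζ‖ ^ 2 := by nlinarith
    rw [← Complex.normSq_eq_norm_sq (1 + ζ), ← Complex.normSq_eq_norm_sq (1 + s * ζ), h3,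
      Complex.normSq_apply, Complex.normSq_apply]
    simp only [Complex.add_re, Complex.add_im, Complex.mul_re, Complex.mul_im, Complex.one_re,
      Complex.one_im, Complex.ofReal_re, Complex.ofReal_im]
    rw [h3] at h5
    nlinarith [mul_nonneg (sub_nonneg.2 hs) (sub_nonneg.2 h5)]
  rw [e]
  nlinarith [sq_nonneg (‖1 + ζ‖ - ‖ζ‖ * (s - 1))]

theorem one_add_mul_ne_zero (hζ : 1 ≤ ‖ζ‖) (hζ1 : 1 + ζ ≠ 0) (hs : 1 ≤ s) :
    1 + s * ζ ≠ 0 := by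
  have h1 := norm_one_add_mul_sq_ge hζ hs
  have h2 := norm_ratio_pos hζ hζ1
  have h3 : 0 < ‖ζ‖ ^ 2 * (‖1 + ζ‖ / ‖ζ‖ + s - 1) ^ 2 := by
    have : 0 < ‖1 + ζ‖ / ‖ζ‖ + s - 1 := by linarith
    positivity
  intro h
  rw [h, norm_zero] at h1
  norm_num at h1
  linarith

theorem norm_rayKernel (hs : 1 ≤ s) (hζ : 1 ≤ ‖ζ‖) :
    ‖rayKernel ζ s‖ = ‖1 + ζ‖ ^ 2 * s / ‖1 + s * ζ‖ ^ 2 := by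
  have hz : 0 < ‖ζ‖ := by linarith
  rw [rayKernel, norm_mul, norm_div, norm_mul, norm_pow, Complex.norm_real, Complex.norm_real,
    Real.norm_of_nonneg (by linarith : 0 ≤ s), Real.norm_of_nonneg (by positivity)]
  field_simp

/-- With b = |1+ζ|/|ζ| the kernel is at most 2b²s/(b+s-1)², and s b ≤ 2(b+s-1) because b ≤ 2 and s ≥
1. -/
theorem norm_rayKernel_le (hζ : 1 ≤ ‖ζ‖) (hζ1 : 1 + ζ ≠ 0) (hs : 1 ≤ s) :
    ‖rayKernel ζ s‖ ≤ 8 / s := by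
  have hz : 0 < ‖ζ‖ := by linarith
  have hd : 0 < ‖1 + s * ζ‖ := norm_pos_iff.2 (one_add_mul_ne_zero hζ hζ1 hs)
  rw [norm_rayKernel hs hζ, div_le_div_iff₀ (by positivity) (by linarith)]
  have h1 := norm_one_add_mul_sq_ge hζ hs
  have h2 := norm_ratio_pos hζ hζ1
  have h3 := norm_ratio_le_two hζ
  have e : ‖1 + ζ‖ = ‖ζ‖ * (‖1 + ζ‖ / ‖ζ‖) := by field_simp
  set b := ‖1 + ζ‖ / ‖ζ‖
  rw [e]
  have h4 : s * b ≤ 2 * (b + s - 1) := by nlinarith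
  have h5 : (s * b) ^ 2 ≤ (2 * (b + s - 1)) ^ 2 := pow_le_pow_left₀ (by positivity) h4 2
  have h6 := mul_le_mul_of_nonneg_left h5 (sq_nonneg ‖ζ‖)
  nlinarith

/-- The derivative of `rayKernel` along the ray. -/
noncomputable def rayKernelDeriv (ζ : ℂ) (s : ℝ) : ℂ :=
  ((‖1 + ζ‖ ^ 2 / ‖ζ‖ : ℝ) : ℂ) * (ζ * (1 - s * ζ) / (1 + s * ζ) ^ 3)

theorem hasDerivAt_rayKernel (hζ : 1 ≤ ‖ζ‖) (hζ1 : 1 + ζ ≠ 0) (hs : 1 ≤ s) :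
    HasDerivAt (rayKernel ζ) (rayKernelDeriv ζ s) s := by
  have hd := one_add_mul_ne_zero hζ hζ1 hs
  have h0 : HasDerivAt (fun s : ℝ => (s : ℂ) * ζ) (1 * ζ) s :=
    (hasDerivAt_id s).ofReal_comp.mul_const ζ
  have h1 := (h0.const_add 1).pow 2
  convert! (h0.div h1 (pow_ne_zero 2 hd)).const_mul ((‖1 + ζ‖ ^ 2 / ‖ζ‖ : ℝ) : ℂ) using 1
  rw [rayKernelDeriv]
  congr 1
  simp only [Pi.pow_apply]
  rw [div_eq_div_iff (pow_ne_zero 3 hd) (pow_ne_zero 2 (pow_ne_zero 2 hd))]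
  push_cast
  ring

theorem norm_rayKernelDeriv (hζ : 1 ≤ ‖ζ‖) : ‖rayKernelDeriv ζ s‖ =
    ‖1 + ζ‖ ^ 2 * ‖1 - s * ζ‖ / ‖1 + s * ζ‖ ^ 3 := by
  have hz : 0 < ‖ζ‖ := by linarith
  rw [rayKernelDeriv, norm_mul, norm_div, norm_mul, norm_pow, Complex.norm_real,
    Real.norm_of_nonneg (by positivity)]
  field_simp

theorem norm_rayKernelDeriv_le (hζ : 1 ≤ ‖ζ‖) (hζ1 : 1 + ζ ≠ 0) (hs : 1 ≤ s) :
    ‖rayKernelDeriv ζ s‖ ≤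
      6 * (‖1 + ζ‖ / ‖ζ‖) ^ 2 * s / (‖1 + ζ‖ / ‖ζ‖ + s - 1) ^ 3 := by
  have hz : 0 < ‖ζ‖ := by linarith
  have hd : 0 < ‖1 + s * ζ‖ := norm_pos_iff.2 (one_add_mul_ne_zero hζ hζ1 hs)
  have h1 := norm_one_add_mul_sq_ge hζ hs
  have h2 := norm_ratio_pos hζ hζ1
  have e : ‖1 + ζ‖ = ‖ζ‖ * (‖1 + ζ‖ / ‖ζ‖) := by field_simp
  have h6 : ‖1 - s * ζ‖ ≤ 2 * s * ‖ζ‖ := by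
    have := norm_sub_le 1 (s * ζ)
    rw [norm_one, norm_mul, Complex.norm_real, Real.norm_of_nonneg (by linarith)] at this
    nlinarith
  rw [norm_rayKernelDeriv hζ]
  nth_rewrite 1 [e]
  set b := ‖1 + ζ‖ / ‖ζ‖
  have hw : 0 < b + s - 1 := by linarith
  -- 7/10 is below 1/√2, and 2/(7/10)³ is below 6, the constant in the majorant.
  have h3 : 7 / 10 * (‖ζ‖ * (b + s - 1)) ≤ ‖1 + s * ζ‖ := by
    apply le_of_sq_le_sq _ hd.le
    nlinarith [sq_nonneg ‖1 + s * ζ‖]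
  have h4 := pow_le_pow_left₀ (by positivity) h3 3
  rw [div_le_div_iff₀ (by positivity) (by positivity)]
  calc (‖ζ‖ * b) ^ 2 * ‖1 - s * ζ‖ * (b + s - 1) ^ 3
      ≤ (‖ζ‖ * b) ^ 2 * (2 * s * ‖ζ‖) * (b + s - 1) ^ 3 := by gcongr
    _ ≤ 6 * b ^ 2 * s * (7 / 10 * (‖ζ‖ * (b + s - 1))) ^ 3 := by
        have : 0 ≤ ‖ζ‖ ^ 3 * b ^ 2 * s * (b + s - 1) ^ 3 := by positivity
        nlinarith
    _ ≤ _ := by gcongr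

/-- The increments of the kernel are dominated by those of a bounded monotone function. -/
theorem norm_rayKernel_sub_le {s' : ℝ} (hζ : 1 ≤ ‖ζ‖) (hζ1 : 1 + ζ ≠ 0) (hs : 1 ≤ s)
    (hss : s ≤ s') : ‖rayKernel ζ s' - rayKernel ζ s‖ ≤
      rayMajorant (‖1 + ζ‖ / ‖ζ‖) s' - rayMajorant (‖1 + ζ‖ / ‖ζ‖) s := by
  have hb := norm_ratio_pos hζ hζ1
  refine image_norm_le_of_norm_deriv_right_le_deriv_boundary' (a := s) (b := s')
    (f := fun x => rayKernel ζ x - rayKernel ζ s) (f' := rayKernelDeriv ζ)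
    (B := fun x => rayMajorant (‖1 + ζ‖ / ‖ζ‖) x - rayMajorant (‖1 + ζ‖ / ‖ζ‖) s)
    (B' := fun s => 6 * (‖1 + ζ‖ / ‖ζ‖) ^ 2 * s / (‖1 + ζ‖ / ‖ζ‖ + s - 1) ^ 3)
    ?_ ?_ (by simp) ?_ ?_ ?_ (right_mem_Icc.2 hss)
  · exact fun x hx => ((hasDerivAt_rayKernel hζ hζ1 (hs.trans hx.1)).sub_const
      _).continuousAt.continuousWithinAt
  · exact fun x hx => ((hasDerivAt_rayKernel hζ hζ1 (hs.trans hx.1)).sub_const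
      _).hasDerivWithinAt
  · exact fun x hx => ((hasDerivAt_rayMajorant hb (hs.trans hx.1)).sub_const
      _).continuousAt.continuousWithinAt
  · exact fun x hx => ((hasDerivAt_rayMajorant hb (hs.trans hx.1)).sub_const
      _).hasDerivWithinAt
  · exact fun x hx => norm_rayKernelDeriv_le hζ hζ1 (hs.trans hx.1)

theorem norm_rayKernel_sub_le_of_mem {s₁ s₂ m M : ℝ} (hζ : 1 ≤ ‖ζ‖) (hζ1 : 1 + ζ ≠ 0)
    (hm : 1 ≤ m) (h₁ : s₁ ∈ Icc m M) (h₂ : s₂ ∈ Icc m M) :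
    ‖rayKernel ζ s₁ - rayKernel ζ s₂‖ ≤
      rayMajorant (‖1 + ζ‖ / ‖ζ‖) M - rayMajorant (‖1 + ζ‖ / ‖ζ‖) m := by
  have hb := norm_ratio_pos hζ hζ1
  wlog h : s₂ ≤ s₁ generalizing s₁ s₂
  · rw [norm_sub_rev]; exact this h₂ h₁ (le_of_not_ge h)
  refine (norm_rayKernel_sub_le hζ hζ1 (hm.trans h₂.1) h).trans ?_
  have h3 := rayMajorant_mono hb (hm.trans h₁.1) h₁.2
  have h4 := rayMajorant_mono hb hm h₂.1
  linarith

/-- A discrete form of the bound on the derivative. -/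
theorem norm_rayKernel_mul_le {q K : ℝ} (hζ : 1 ≤ ‖ζ‖) (hζ1 : 1 + ζ ≠ 0) (hs : 1 ≤ s)
    (hq : 1 < q) (hK : ‖1 + ζ‖ / ‖ζ‖ + q * s - 1 ≤ K * (‖1 + ζ‖ / ‖ζ‖ + s - 1)) :
    (q - 1) * (‖rayKernel ζ s‖ * (‖1 - s * ζ‖ / ‖1 + s * ζ‖)) ≤
      K ^ 3 * (rayMajorant (‖1 + ζ‖ / ‖ζ‖) (q * s) - rayMajorant (‖1 + ζ‖ / ‖ζ‖) s) := by
  have hb := norm_ratio_pos hζ hζ1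
  have hd : 0 < ‖1 + s * ζ‖ := norm_pos_iff.2 (one_add_mul_ne_zero hζ hζ1 hs)
  have h1 := norm_rayKernelDeriv_le hζ hζ1 hs
  -- For v = sζ one has s K'(s) = K(s)(1 - v)/(1 + v), so the factor |1 - v|/|1 + v| turns the
  -- kernel into its logarithmic derivative.
  have e : ‖rayKernel ζ s‖ * (‖1 - s * ζ‖ / ‖1 + s * ζ‖) = s * ‖rayKernelDeriv ζ s‖ := by
    rw [norm_rayKernel hs hζ, norm_rayKernelDeriv hζ]; field_simp
  rw [e]
  set b := ‖1 + ζ‖ / ‖ζ‖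
  have hw : 0 < b + s - 1 := by linarith
  have hqs : s ≤ q * s := by nlinarith
  have hK0 : 0 < K := by
    have : 0 < K * (b + s - 1) := by linarith
    exact (pos_iff_pos_of_mul_pos this).2 hw
  -- Mean value inequality on [s, qs]: there the denominator of the majorant's derivative has grown
  -- by at most K³, and its numerator has not decreased.
  have h2 : 6 * b ^ 2 * s / (K * (b + s - 1)) ^ 3 * (q * s - s) ≤
      rayMajorant b (q * s) - rayMajorant b s := by
    refine (convex_Icc s (q * s)).mul_sub_le_image_sub_of_le_deriv
      (fun x hx => (hasDerivAt_rayMajorant hb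
        (hs.trans hx.1)).continuousAt.continuousWithinAt) ?_ ?_ s (left_mem_Icc.2 hqs) (q * s)
      (right_mem_Icc.2 hqs) hqs
    · rw [interior_Icc]
      exact fun x hx => (hasDerivAt_rayMajorant hb
        (hs.trans hx.1.le)).differentiableAt.differentiableWithinAt
    · rw [interior_Icc]
      intro x hx
      have hx1 := hs.trans hx.1.le
      have hwx : 0 < b + x - 1 := by linarith
      rw [(hasDerivAt_rayMajorant hb hx1).deriv]
      have : b + x - 1 ≤ K * (b + s - 1) := by linarith [hx.2]
      have := hx.1.le
      gcongr
  calc (q - 1) * (s * ‖rayKernelDeriv ζ s‖)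
      ≤ (q - 1) * (s * (6 * b ^ 2 * s / (b + s - 1) ^ 3)) := by
        have : 0 ≤ q - 1 := by linarith
        gcongr
    _ = K ^ 3 * (6 * b ^ 2 * s / (K * (b + s - 1)) ^ 3 * (q * s - s)) := by
        field_simp
    _ ≤ _ := by gcongr

end Ray

/-! ### Sums of the kernel along geometric sequences -/

section RaySum

variable {ζ : ℂ} {s q : ℝ}

theorem one_le_mul_pow (hs : 1 ≤ s) (hq : 1 < q) (n : ℕ) : 1 ≤ s * q ^ n :=
  one_le_mul_of_one_le_of_one_le hs (one_le_pow₀ hq.le)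

theorem norm_rayKernel_pow_le (hζ : 1 ≤ ‖ζ‖) (hζ1 : 1 + ζ ≠ 0) (hs : 1 ≤ s) (hq : 1 < q)
    (n : ℕ) : ‖rayKernel ζ (s * q ^ n)‖ ≤ 8 * q⁻¹ ^ n := by
  have h0 : 0 < q ^ n := by positivity
  refine (norm_rayKernel_le hζ hζ1 (one_le_mul_pow hs hq n)).trans ?_
  rw [inv_pow, ← div_eq_mul_inv]
  gcongr
  nlinarith

theorem tsum_inv_pow (hq : 1 < q) : Summable (fun n : ℕ => 8 * q⁻¹ ^ n) ∧
    ∑' n : ℕ, 8 * q⁻¹ ^ n = 8 * q / (q - 1) := by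
  have h1 : q⁻¹ < 1 := inv_lt_one_of_one_lt₀ hq
  have h0 : 0 ≤ q⁻¹ := by positivity
  refine ⟨(summable_geometric_of_lt_one h0 h1).mul_left 8, ?_⟩
  rw [tsum_mul_left, tsum_geometric_of_lt_one h0 h1]
  have : q - 1 ≠ 0 := by linarith
  have : q ≠ 0 := by linarith
  field_simp

theorem summable_rayKernel_weight {a : ℕ → ℂ} {B : ℝ} (ha : ∀ n, ‖a n‖ ≤ B) (hζ : 1 ≤ ‖ζ‖)
    (hζ1 : 1 + ζ ≠ 0) (hs : 1 ≤ s) (hq : 1 < q) :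
    Summable (fun n => a n * rayKernel ζ (s * q ^ n)) := by
  refine Summable.of_norm_bounded ((tsum_inv_pow hq).1.mul_left B) fun n => ?_
  rw [norm_mul]
  exact mul_le_mul (ha n) (norm_rayKernel_pow_le hζ hζ1 hs hq n) (norm_nonneg _)
    ((norm_nonneg _).trans (ha n))

theorem norm_tsum_rayKernel_weight_le {a : ℕ → ℂ} {B : ℝ} (ha : ∀ n, ‖a n‖ ≤ B) (hζ : 1 ≤ ‖ζ‖)
    (hζ1 : 1 + ζ ≠ 0) (hs : 1 ≤ s) (hq : 1 < q) :
    ‖∑' n, a n * rayKernel ζ (s * q ^ n)‖ ≤ B * (8 * q / (q - 1)) := by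
  rw [← (tsum_inv_pow hq).2, ← tsum_mul_left]
  refine tsum_of_norm_bounded ((tsum_inv_pow hq).1.mul_left B).hasSum fun n => ?_
  rw [norm_mul]
  exact mul_le_mul (ha n) (norm_rayKernel_pow_le hζ hζ1 hs hq n) (norm_nonneg _)
    ((norm_nonneg _).trans (ha n))

/-- The sums with geometrically decaying weights. -/
theorem norm_tsum_rayKernel_geometric_le {a : ℕ → ℂ} {B ρ : ℝ} (hρ0 : 0 ≤ ρ) (hρ : ρ < 1)
    (ha : ∀ n, ‖a n‖ ≤ B * ρ ^ n) (hζ : 1 ≤ ‖ζ‖) (hζ1 : 1 + ζ ≠ 0) (hs : 1 ≤ s) (hq : 1 < q) :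
    ‖∑' n, a n * rayKernel ζ (s * q ^ n)‖ ≤ 8 * B / (1 - ρ) := by
  have h : ∑' n, 8 * B * ρ ^ n = 8 * B / (1 - ρ) := by
    rw [tsum_mul_left, tsum_geometric_of_lt_one hρ0 hρ, div_eq_mul_inv]
  rw [← h]
  refine tsum_of_norm_bounded ((summable_geometric_of_lt_one hρ0 hρ).mul_left _).hasSum
    fun n => ?_
  rw [norm_mul]
  have h1 : ‖rayKernel ζ (s * q ^ n)‖ ≤ 8 :=
    (norm_rayKernel_le hζ hζ1 (one_le_mul_pow hs hq n)).trans
      (div_le_self (by norm_num) (one_le_mul_pow hs hq n))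
  calc ‖a n‖ * ‖rayKernel ζ (s * q ^ n)‖ ≤ (B * ρ ^ n) * 8 :=
        mul_le_mul (ha n) h1 (norm_nonneg _) ((norm_nonneg _).trans (ha n))
    _ = _ := by ring

theorem rayMajorant_increment_nonneg {b : ℝ} (hb : 0 < b) (hs : 1 ≤ s) (hq : 1 < q) (n : ℕ) :
    0 ≤ rayMajorant b (s * q ^ (n + 1)) - rayMajorant b (s * q ^ n) := by
  rw [sub_nonneg]
  refine rayMajorant_mono hb (one_le_mul_pow hs hq n) ?_
  have : q ^ n ≤ q ^ (n + 1) := pow_le_pow_right₀ hq.le (Nat.le_succ n)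
  gcongr

theorem sum_rayMajorant_le {b : ℝ} (hb : 0 < b) (hb2 : b ≤ 2) (hs : 1 ≤ s) (hq : 1 < q) (N : ℕ) :
    ∑ n ∈ Finset.range N, (rayMajorant b (s * q ^ (n + 1)) - rayMajorant b (s * q ^ n)) ≤ 9 := by
  rw [Finset.sum_range_sub (fun n => rayMajorant b (s * q ^ n))]
  have h1 := rayMajorant_bounds hb hb2 (one_le_mul_pow hs hq N)
  have h2 := rayMajorant_bounds hb hb2 (one_le_mul_pow hs hq 0)
  linarith [h1.2, h2.1]

theorem summable_rayMajorant {b : ℝ} (hb : 0 < b) (hb2 : b ≤ 2) (hs : 1 ≤ s) (hq : 1 < q) :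
    Summable (fun n : ℕ => rayMajorant b (s * q ^ (n + 1)) - rayMajorant b (s * q ^ n)) :=
  summable_of_sum_range_le (fun n => rayMajorant_increment_nonneg hb hs hq n)
    fun n => sum_rayMajorant_le hb hb2 hs hq n

theorem tsum_rayMajorant_le {b : ℝ} (hb : 0 < b) (hb2 : b ≤ 2) (hs : 1 ≤ s) (hq : 1 < q) :
    ∑' n : ℕ, (rayMajorant b (s * q ^ (n + 1)) - rayMajorant b (s * q ^ n)) ≤ 9 :=
  Real.tsum_le_of_sum_range_le (fun n => rayMajorant_increment_nonneg hb hs hq n)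
    fun n => sum_rayMajorant_le hb hb2 hs hq n

theorem norm_neg_pow_le_one {τ : ℝ} (hτ : |τ| ≤ 1) (n : ℕ) : ‖(-τ : ℂ) ^ n‖ ≤ 1 := by
  rw [norm_pow, norm_neg, Complex.norm_real]
  exact pow_le_one₀ (norm_nonneg _) hτ

/-- Alternating sums of the kernel are bounded. -/
theorem norm_tsum_rayKernel_alternating_le {τ : ℝ} (hτ0 : 0 ≤ τ) (hτ : τ ≤ 1) (hζ : 1 ≤ ‖ζ‖)
    (hζ1 : 1 + ζ ≠ 0) (hs : 1 ≤ s) (hq : 1 < q) :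
    ‖∑' n : ℕ, (-τ : ℂ) ^ n * rayKernel ζ (s * q ^ n)‖ ≤ 17 := by
  have hb := norm_ratio_pos hζ hζ1
  have hb2 := norm_ratio_le_two hζ
  have hpow : ∀ n : ℕ, ‖(-τ : ℂ) ^ n‖ ≤ 1 :=
    norm_neg_pow_le_one (abs_le.2 ⟨by linarith, hτ⟩)
  have hsum := summable_rayKernel_weight hpow hζ hζ1 hs hq
  set S := ∑' n : ℕ, (-τ : ℂ) ^ n * rayKernel ζ (s * q ^ n) with hS
  have hsum' : Summable (fun n : ℕ => (-τ : ℂ) ^ (n + 1) * rayKernel ζ (s * q ^ n)) := by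
    simpa only [pow_succ', mul_assoc] using hsum.mul_left (-τ : ℂ)
  have h1 : S = rayKernel ζ s + ∑' n : ℕ, (-τ : ℂ) ^ (n + 1) * rayKernel ζ (s * q ^ (n + 1)) := by
    rw [hS, hsum.tsum_eq_zero_add]
    simp
  have h2 : -τ * S = ∑' n : ℕ, (-τ : ℂ) ^ (n + 1) * rayKernel ζ (s * q ^ n) := by
    rw [hS, ← tsum_mul_left]
    exact tsum_congr fun n => by ring
  -- Summation by parts. The increments sum to at most 9 and the first term is at most 8; since 1 +
  -- τ ≥ 1 the total is 17.
  have h3 : (1 + τ) * S = rayKernel ζ s + ∑' n : ℕ, (-τ : ℂ) ^ (n + 1) *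
      (rayKernel ζ (s * q ^ (n + 1)) - rayKernel ζ (s * q ^ n)) := by
    simp only [mul_sub]
    rw [((summable_nat_add_iff 1).2 hsum).tsum_sub hsum', ← h2, add_sub_assoc', ← h1]
    ring
  have h4 : ‖∑' n : ℕ, (-τ : ℂ) ^ (n + 1) *
      (rayKernel ζ (s * q ^ (n + 1)) - rayKernel ζ (s * q ^ n))‖ ≤ 9 := by
    refine (tsum_of_norm_bounded (summable_rayMajorant hb hb2 hs hq).hasSum fun n => ?_).trans
      (tsum_rayMajorant_le hb hb2 hs hq)
    rw [norm_mul]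
    refine (mul_le_of_le_one_left (norm_nonneg _) (hpow _)).trans
      (norm_rayKernel_sub_le hζ hζ1 (one_le_mul_pow hs hq n) ?_)
    have : q ^ n ≤ q ^ (n + 1) := pow_le_pow_right₀ hq.le (Nat.le_succ n)
    gcongr
  have h5 : ‖rayKernel ζ s‖ ≤ 8 :=
    (norm_rayKernel_le hζ hζ1 hs).trans (div_le_self (by norm_num) hs)
  have h6 : ‖S‖ ≤ ‖((1 + τ : ℝ) : ℂ) * S‖ := by
    rw [norm_mul, Complex.norm_real, Real.norm_of_nonneg (by linarith)]
    nlinarith [norm_nonneg S]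
  push_cast at h6
  rw [h3] at h6
  linarith [norm_add_le (rayKernel ζ s) (∑' n : ℕ, (-τ : ℂ) ^ (n + 1) *
    (rayKernel ζ (s * q ^ (n + 1)) - rayKernel ζ (s * q ^ n)))]

/-- Sums with weights that are small where the kernel is large. -/
theorem norm_tsum_rayKernel_error_le {a : ℕ → ℂ} {E F K : ℝ} (hE : 0 ≤ E) (hF : 0 ≤ F)
    (hζ : 1 ≤ ‖ζ‖) (hζ1 : 1 + ζ ≠ 0) (hs : 1 ≤ s) (hq : 1 < q) (hqK : q ≤ K)
    (hK : q - 1 ≤ (K - 1) * (‖1 + ζ‖ / ‖ζ‖))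
    (ha : ∀ n, ‖a n‖ ≤ E + F * (‖1 - ((s * q ^ n : ℝ) : ℂ) * ζ‖ /
      ‖1 + ((s * q ^ n : ℝ) : ℂ) * ζ‖)) :
    ‖∑' n, a n * rayKernel ζ (s * q ^ n)‖ ≤ (E * (8 * q) + F * (9 * K ^ 3)) / (q - 1) := by
  have hb := norm_ratio_pos hζ hζ1
  have hb2 := norm_ratio_le_two hζ
  have hq0 : 0 < q - 1 := by linarith
  have hK0 : 0 ≤ K := by linarith
  have h1 : ∀ n, ‖a n * rayKernel ζ (s * q ^ n)‖ ≤ E * (8 * q⁻¹ ^ n) +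
      F * (K ^ 3 / (q - 1)) * (rayMajorant (‖1 + ζ‖ / ‖ζ‖) (s * q ^ (n + 1)) -
        rayMajorant (‖1 + ζ‖ / ‖ζ‖) (s * q ^ n)) := by
    intro n
    have hsn := one_le_mul_pow hs hq n
    -- With σ = s qⁿ and b = |1+ζ|/|ζ|, the required b + qσ - 1 ≤ K(b + σ - 1) splits into (q - 1)(σ
    -- - 1) ≤ (K - 1)(σ - 1) and q - 1 ≤ (K - 1)b.
    have h2 := norm_rayKernel_mul_le (K := K) hζ hζ1 hsn hq (by nlinarith)
    have e : q * (s * q ^ n) = s * q ^ (n + 1) := by ring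
    rw [e] at h2
    have h3 := norm_rayKernel_pow_le hζ hζ1 hs hq n
    have h4 : ‖rayKernel ζ (s * q ^ n)‖ * (‖1 - ((s * q ^ n : ℝ) : ℂ) * ζ‖ /
        ‖1 + ((s * q ^ n : ℝ) : ℂ) * ζ‖) ≤ K ^ 3 / (q - 1) *
        (rayMajorant (‖1 + ζ‖ / ‖ζ‖) (s * q ^ (n + 1)) -
          rayMajorant (‖1 + ζ‖ / ‖ζ‖) (s * q ^ n)) := by
      rw [div_mul_eq_mul_div, le_div_iff₀ hq0]
      linarith
    rw [norm_mul]
    refine (mul_le_mul_of_nonneg_right (ha n) (norm_nonneg _)).trans ?_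
    have h5 := mul_le_mul_of_nonneg_left h3 hE
    have h6 := mul_le_mul_of_nonneg_left h4 hF
    linarith
  have h2 := (tsum_inv_pow hq).1.hasSum.mul_left E
  have h3 := (summable_rayMajorant hb hb2 hs hq).hasSum.mul_left (F * (K ^ 3 / (q - 1)))
  refine (tsum_of_norm_bounded (h2.add h3) h1).trans ?_
  rw [(tsum_inv_pow hq).2]
  have h4 := mul_le_mul_of_nonneg_left (tsum_rayMajorant_le hb hb2 hs hq)
    (by positivity : 0 ≤ F * (K ^ 3 / (q - 1)))
  refine (add_le_add_right h4 _).trans (le_of_eq ?_)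
  field_simp

end RaySum

/-! ### The integral of the kernel along a ray -/

/-- The Laplace transform of the kernel along the ray through `s ζ`. -/
noncomputable def rayIntegral (ζ : ℂ) (s β : ℝ) : ℂ :=
  ∫ t in Ioi (0 : ℝ), (Real.exp (-(β * t)) : ℂ) * rayKernel ζ (s * Real.exp t)

section RayIntegral

variable {ζ : ℂ} {s β : ℝ}

theorem one_le_mul_exp (hs : 1 ≤ s) {t : ℝ} (ht : 0 ≤ t) : 1 ≤ s * Real.exp t :=
  one_le_mul_of_one_le_of_one_le hs (Real.one_le_exp ht)

theorem continuousOn_rayIntegrand (hζ : 1 ≤ ‖ζ‖) (hζ1 : 1 + ζ ≠ 0) (hs : 1 ≤ s) :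
    ContinuousOn (fun t : ℝ => (Real.exp (-(β * t)) : ℂ) * rayKernel ζ (s * Real.exp t))
      (Ici 0) := by
  intro t ht
  have h1 : ContinuousAt (fun t : ℝ => rayKernel ζ (s * Real.exp t)) t :=
    ContinuousAt.comp (f := fun t : ℝ => s * Real.exp t)
      (hasDerivAt_rayKernel hζ hζ1 (one_le_mul_exp hs ht)).continuousAt (by fun_prop)
  exact ContinuousAt.continuousWithinAt (ContinuousAt.mul (by fun_prop) h1)

theorem norm_rayKernel_exp_le (hζ : 1 ≤ ‖ζ‖) (hζ1 : 1 + ζ ≠ 0) (hs : 1 ≤ s) {t : ℝ}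
    (ht : 0 ≤ t) : ‖rayKernel ζ (s * Real.exp t)‖ ≤ 8 * Real.exp (-t) := by
  refine (norm_rayKernel_le hζ hζ1 (one_le_mul_exp hs ht)).trans ?_
  rw [Real.exp_neg, ← div_eq_mul_inv]
  have := Real.exp_pos t
  gcongr
  nlinarith

theorem norm_rayIntegrand_le (hζ : 1 ≤ ‖ζ‖) (hζ1 : 1 + ζ ≠ 0) (hs : 1 ≤ s) {t : ℝ}
    (ht : 0 ≤ t) : ‖(Real.exp (-(β * t)) : ℂ) * rayKernel ζ (s * Real.exp t)‖ ≤
      8 * Real.exp (-(β + 1) * t) := by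
  rw [norm_mul, Complex.norm_real, Real.norm_of_nonneg (Real.exp_pos _).le,
    show -(β + 1) * t = -(β * t) + -t by ring, Real.exp_add]
  have := mul_le_mul_of_nonneg_left (norm_rayKernel_exp_le hζ hζ1 hs ht)
    (Real.exp_pos (-(β * t))).le
  linarith

theorem integrableOn_rayIntegrand (hζ : 1 ≤ ‖ζ‖) (hζ1 : 1 + ζ ≠ 0) (hs : 1 ≤ s) (hβ : 0 ≤ β) :
    IntegrableOn (fun t : ℝ => (Real.exp (-(β * t)) : ℂ) * rayKernel ζ (s * Real.exp t))
      (Ioi 0) := by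
  have h1 : IntegrableOn (fun t : ℝ => 8 * Real.exp (-(β + 1) * t)) (Ioi 0) :=
    (integrableOn_exp_mul_Ioi (by linarith) 0).const_mul 8
  refine Integrable.mono' h1 (((continuousOn_rayIntegrand hζ hζ1 hs).mono
    Ioi_subset_Ici_self).aestronglyMeasurable measurableSet_Ioi) ?_
  exact (ae_restrict_mem measurableSet_Ioi).mono fun t ht =>
    norm_rayIntegrand_le hζ hζ1 hs (le_of_lt ht)

theorem norm_rayIntegral_le (hζ : 1 ≤ ‖ζ‖) (hζ1 : 1 + ζ ≠ 0) (hs : 1 ≤ s) (hβ : 0 ≤ β) :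
    ‖rayIntegral ζ s β‖ ≤ 8 / (β + 1) := by
  have h1 : IntegrableOn (fun t : ℝ => 8 * Real.exp (-(β + 1) * t)) (Ioi 0) :=
    (integrableOn_exp_mul_Ioi (by linarith) 0).const_mul 8
  refine (norm_integral_le_of_norm_le h1 ((ae_restrict_mem measurableSet_Ioi).mono fun t ht =>
    norm_rayIntegrand_le hζ hζ1 hs (le_of_lt ht))).trans (le_of_eq ?_)
  rw [integral_const_mul, integral_exp_mul_Ioi (by linarith)]
  rw [mul_zero, Real.exp_zero, neg_div_neg_eq, mul_one_div]

/-- The derivative of y e^{-yx} in y is (1 - yx)e^{-yx}, of modulus at most 1 for y ≥ 0. -/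
theorem abs_mul_exp_sub_le {a b x : ℝ} (ha : 0 ≤ a) (hb : 0 ≤ b) (hx : 0 ≤ x) :
    |a * Real.exp (-(a * x)) - b * Real.exp (-(b * x))| ≤ |a - b| := by
  have h := (convex_Ici (0 : ℝ)).norm_image_sub_le_of_norm_hasDerivWithin_le (C := 1)
    (f := fun y => y * Real.exp (-(y * x))) (f' := fun y => (1 - y * x) * Real.exp (-(y * x)))
    (x := b) (y := a) ?_ ?_ hb ha
  · simpa using h
  · intro y _
    have h1 : HasDerivAt (fun y : ℝ => -(y * x)) (-(1 * x)) y :=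
      ((hasDerivAt_id y).mul_const x).neg
    convert! ((hasDerivAt_id y).mul h1.exp).hasDerivWithinAt using 1
    simp only [id]
    ring
  · intro y hy
    have hyx : 0 ≤ y * x := mul_nonneg hy hx
    rw [norm_mul, Real.norm_of_nonneg (Real.exp_pos _).le, Real.norm_eq_abs, Real.exp_neg,
      ← div_eq_mul_inv, div_le_one (Real.exp_pos _)]
    have := Real.add_one_le_exp (y * x)
    rw [abs_le]
    constructor <;> linarith

/-- This exchanges the factor 1/log q for κ, in front of the integral and inside the exponent at
once, at a cost that is uniform in l = -log|τ|. -/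
theorem norm_rayIntegral_sub_le {κ κ' l : ℝ} (hκ : 0 ≤ κ) (hκ' : 0 ≤ κ') (hl : 0 ≤ l)
    (hζ : 1 ≤ ‖ζ‖) (hζ1 : 1 + ζ ≠ 0) (hs : 1 ≤ s) :
    ‖κ' * rayIntegral ζ s (κ' * l) - κ * rayIntegral ζ s (κ * l)‖ ≤ 8 * |κ' - κ| := by
  have h1 : IntegrableOn (fun t : ℝ => 8 * |κ' - κ| * Real.exp (-1 * t)) (Ioi 0) :=
    (integrableOn_exp_mul_Ioi (by norm_num) 0).const_mul _
  rw [rayIntegral, rayIntegral, ← integral_const_mul, ← integral_const_mul, ← integral_sub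
    ((integrableOn_rayIntegrand hζ hζ1 hs (by positivity)).const_mul _)
    ((integrableOn_rayIntegrand hζ hζ1 hs (by positivity)).const_mul _)]
  refine (norm_integral_le_of_norm_le h1 ((ae_restrict_mem measurableSet_Ioi).mono
    fun t ht => ?_)).trans (le_of_eq ?_)
  · have ht' : (0 : ℝ) ≤ t := le_of_lt ht
    have h2 := abs_mul_exp_sub_le hκ' hκ (mul_nonneg hl ht')
    have h3 := norm_rayKernel_exp_le hζ hζ1 hs ht'
    have e : (κ' : ℂ) * ((Real.exp (-(κ' * l * t)) : ℂ) * rayKernel ζ (s * Real.exp t)) -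
        κ * ((Real.exp (-(κ * l * t)) : ℂ) * rayKernel ζ (s * Real.exp t)) =
        ((κ' * Real.exp (-(κ' * (l * t))) - κ * Real.exp (-(κ * (l * t))) : ℝ) : ℂ) *
          rayKernel ζ (s * Real.exp t) := by
      rw [mul_assoc κ', mul_assoc κ]; push_cast; ring
    rw [e, norm_mul, Complex.norm_real, Real.norm_eq_abs]
    calc _ ≤ |κ' - κ| * (8 * Real.exp (-t)) :=
          mul_le_mul h2 h3 (norm_nonneg _) (abs_nonneg _)
      _ = _ := by rw [neg_one_mul]; ring
  · rw [integral_const_mul, integral_exp_mul_Ioi (by norm_num)]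
    simp

end RayIntegral

/-! ### Translations along the ray and Riemann sums. -/

section RayCompare

variable {ζ : ℂ} {s β : ℝ}

theorem intervalIntegrable_of_continuousOn_Ici {E : Type*} [NormedAddCommGroup E] {f : ℝ → E}
    (hf : ContinuousOn f (Ici 0)) {a b : ℝ} (ha : 0 ≤ a) (hb : 0 ≤ b) :
    IntervalIntegrable f volume a b :=
  (hf.mono (ordConnected_Ici.uIcc_subset ha hb)).intervalIntegrable

theorem continuousOn_rayMajorant_exp {b : ℝ} (hb : 0 < b) :
    ContinuousOn (fun t => rayMajorant b (Real.exp t)) (Ici 0) := fun _ ht =>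
  (ContinuousAt.comp (f := Real.exp) (hasDerivAt_rayMajorant hb
    (Real.one_le_exp ht)).continuousAt Real.continuous_exp.continuousAt).continuousWithinAt

/-- The integral telescopes to the one over [T, T + σ] minus the one over [0, σ], and the majorant
takes values in [-9, 0]. -/
theorem integral_rayMajorant_shift_le {b σ T : ℝ} (hb : 0 < b) (hb2 : b ≤ 2) (hσ : 0 ≤ σ)
    (hT : 0 ≤ T) :
    ∫ t in (0 : ℝ)..T, (rayMajorant b (Real.exp (t + σ)) - rayMajorant b (Real.exp t)) ≤
      9 * σ := by
  have hc := continuousOn_rayMajorant_exp hb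
  have hc' : ContinuousOn (fun t => rayMajorant b (Real.exp (t + σ))) (Ici 0) :=
    ContinuousOn.comp (g := fun t => rayMajorant b (Real.exp t)) (f := fun t : ℝ => t + σ) hc
      (by fun_prop) fun t ht => add_nonneg ht hσ
  rw [intervalIntegral.integral_sub (intervalIntegrable_of_continuousOn_Ici hc' le_rfl hT)
    (intervalIntegrable_of_continuousOn_Ici hc le_rfl hT),
    intervalIntegral.integral_comp_add_right (fun t => rayMajorant b (Real.exp t)),
    intervalIntegral.integral_interval_sub_interval_comm
      (intervalIntegrable_of_continuousOn_Ici hc (by linarith) (by linarith))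
      (intervalIntegrable_of_continuousOn_Ici hc le_rfl hT)
      (intervalIntegrable_of_continuousOn_Ici hc (by linarith) le_rfl), zero_add,
    intervalIntegral.integral_symm, intervalIntegral.integral_symm T]
  have h1 : ∫ _t in (0 : ℝ)..σ, (-9 : ℝ) ≤ ∫ t in (0 : ℝ)..σ, rayMajorant b (Real.exp t) :=
    intervalIntegral.integral_mono_on hσ (by simp)
      (intervalIntegrable_of_continuousOn_Ici hc le_rfl hσ)
      fun t ht => (rayMajorant_bounds hb hb2 (Real.one_le_exp ht.1)).1
  have h2 : ∫ t in T..T + σ, rayMajorant b (Real.exp t) ≤ ∫ _t in T..T + σ, (0 : ℝ) :=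
    intervalIntegral.integral_mono_on (by linarith)
      (intervalIntegrable_of_continuousOn_Ici hc hT (by linarith)) (by simp)
      fun t ht => (rayMajorant_bounds hb hb2 (Real.one_le_exp (hT.trans ht.1))).2
  simp only [intervalIntegral.integral_const, smul_eq_mul, sub_zero, mul_zero] at h1 h2
  linarith

/-- Starting the ray at `s` instead of 1 costs O(log s). This absorbs the offset 2ξᵢ in P_D and the
offset 2ξᵢ - 2ξ in P_S. -/
theorem norm_rayIntegral_shift_le (hζ : 1 ≤ ‖ζ‖) (hζ1 : 1 + ζ ≠ 0) (hs : 1 ≤ s) (hβ : 0 ≤ β) :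
    ‖rayIntegral ζ s β - rayIntegral ζ 1 β‖ ≤ 9 * Real.log s := by
  have hb := norm_ratio_pos hζ hζ1
  have hb2 := norm_ratio_le_two hζ
  have hσ := Real.log_nonneg hs
  have hs0 : 0 < s := by linarith
  have hi := integrableOn_rayIntegrand hζ hζ1 hs hβ
  have hi1 := integrableOn_rayIntegrand hζ hζ1 le_rfl hβ
  rw [rayIntegral, rayIntegral, ← integral_sub hi hi1]
  refine le_of_tendsto (intervalIntegral_tendsto_integral_Ioi 0 (hi.sub hi1)
    tendsto_id).norm ?_
  filter_upwards [eventually_ge_atTop 0] with T hT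
  simp only [id]
  have hc := continuousOn_rayMajorant_exp hb
  have hc' : ContinuousOn (fun t => rayMajorant (‖1 + ζ‖ / ‖ζ‖) (Real.exp (t + Real.log s)))
      (Ici 0) :=
    ContinuousOn.comp (g := fun t => rayMajorant (‖1 + ζ‖ / ‖ζ‖) (Real.exp t))
      (f := fun t : ℝ => t + Real.log s) hc (by fun_prop) fun t ht => add_nonneg ht hσ
  refine (intervalIntegral.norm_integral_le_of_norm_le hT (Eventually.of_forall fun t ht => ?_)
    (intervalIntegrable_of_continuousOn_Ici (hc'.sub hc) le_rfl hT)).trans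
    (integral_rayMajorant_shift_le hb hb2 hσ hT)
  have ht0 : 0 ≤ t := ht.1.le
  have h1 : Real.exp t ≤ s * Real.exp t := by nlinarith [Real.exp_pos t]
  simp only [one_mul, Pi.sub_apply]
  rw [← mul_sub, norm_mul, Complex.norm_real, Real.norm_of_nonneg (Real.exp_pos _).le,
    Real.exp_add, Real.exp_log hs0, mul_comm (Real.exp t) s]
  refine (mul_le_of_le_one_left (norm_nonneg _) (Real.exp_le_one_iff.2 ?_)).trans
    (norm_rayKernel_sub_le hζ hζ1 (Real.one_le_exp ht0) h1)
  have := mul_nonneg hβ ht0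
  linarith

/-- Geometric sums of the kernel as Riemann sums. -/
theorem norm_tsum_sub_rayIntegral_le {h : ℝ} (hh : 0 < h) (hζ : 1 ≤ ‖ζ‖) (hζ1 : 1 + ζ ≠ 0)
    (hs : 1 ≤ s) (hs' : s ≤ Real.exp h) (hβ : 0 ≤ β) :
    ‖h * ∑' n : ℕ, (Real.exp (-(β * h)) : ℂ) ^ n * rayKernel ζ (s * Real.exp h ^ n) -
      rayIntegral ζ 1 β‖ ≤ 17 * h := by
  have hb := norm_ratio_pos hζ hζ1
  have hb2 := norm_ratio_le_two hζ
  have hq : 1 < Real.exp h := Real.one_lt_exp_iff.2 hh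
  have hρ1 : Real.exp (-(β * h)) ≤ 1 := Real.exp_le_one_iff.2 (by nlinarith)
  have hρ0 := Real.exp_pos (-(β * h))
  have hpow : ∀ n : ℕ, ‖(Real.exp (-(β * h)) : ℂ) ^ n‖ ≤ 1 := fun n => by
    rw [norm_pow, Complex.norm_real, Real.norm_of_nonneg hρ0.le]
    exact pow_le_one₀ hρ0.le hρ1
  have hsum := summable_rayKernel_weight hpow hζ hζ1 hs hq
  have hi := integrableOn_rayIntegrand hζ hζ1 le_rfl hβ
  have hco := continuousOn_rayIntegrand (β := β) hζ hζ1 le_rfl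
  have hN : Tendsto (fun N : ℕ => (N : ℝ) * h) atTop atTop :=
    tendsto_natCast_atTop_atTop.atTop_mul_const hh
  have hlim := (hsum.hasSum.tendsto_sum_nat.const_mul (h : ℂ)).sub
    (intervalIntegral_tendsto_integral_Ioi 0 hi hN)
  refine le_of_tendsto hlim.norm (Eventually.of_forall fun N => ?_)
  have hn0 : ∀ n : ℕ, (0 : ℝ) ≤ n * h := fun n => by positivity
  have hcells := intervalIntegral.sum_integral_adjacent_intervals (μ := volume)
    (f := fun t : ℝ => (Real.exp (-(β * t)) : ℂ) * rayKernel ζ (1 * Real.exp t))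
    (a := fun n : ℕ => (n : ℝ) * h) (n := N)
    fun n _ => intervalIntegrable_of_continuousOn_Ici hco (hn0 n) (hn0 (n + 1))
  simp only [Nat.cast_zero, zero_mul] at hcells
  rw [← hcells, Finset.mul_sum, ← Finset.sum_sub_distrib]
  -- In the n-th cell both s qⁿ and e^t lie between qⁿ and qⁿ⁺¹, so the kernel varies by at most an
  -- increment of the majorant. The exponential weight varies by a difference of consecutive powers,
  -- against a kernel of size at most 8. Both telescope, giving 9 + 8 = 17.
  have hcell : ∀ n ∈ Finset.range N,
      ‖(h : ℂ) * ((Real.exp (-(β * h)) : ℂ) ^ n * rayKernel ζ (s * Real.exp h ^ n)) -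
        ∫ t in ((n : ℕ) * h : ℝ)..(((n + 1 : ℕ) : ℝ) * h),
          (Real.exp (-(β * t)) : ℂ) * rayKernel ζ (1 * Real.exp t)‖ ≤
      ((rayMajorant (‖1 + ζ‖ / ‖ζ‖) (1 * Real.exp h ^ (n + 1)) -
        rayMajorant (‖1 + ζ‖ / ‖ζ‖) (1 * Real.exp h ^ n)) +
        8 * (Real.exp (-(β * h)) ^ n - Real.exp (-(β * h)) ^ (n + 1))) * h := by
    intro n _
    have hle : (n : ℝ) * h ≤ ((n + 1 : ℕ) : ℝ) * h := by push_cast; linarith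
    have hlen : ((n + 1 : ℕ) : ℝ) * h - n * h = h := by push_cast; ring
    have e1 : (h : ℂ) * ((Real.exp (-(β * h)) : ℂ) ^ n * rayKernel ζ (s * Real.exp h ^ n)) =
        ∫ _t in ((n : ℕ) * h : ℝ)..(((n + 1 : ℕ) : ℝ) * h),
          (Real.exp (-(β * h)) : ℂ) ^ n * rayKernel ζ (s * Real.exp h ^ n) := by
      rw [intervalIntegral.integral_const, hlen, Complex.real_smul]
    rw [e1, ← intervalIntegral.integral_sub (by simp)
      (intervalIntegrable_of_continuousOn_Ici hco (hn0 n) (hn0 (n + 1)))]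
    refine (intervalIntegral.norm_integral_le_of_norm_le_const (fun t ht => ?_)).trans
      (le_of_eq (by rw [hlen, abs_of_pos hh]))
    rw [uIoc_of_le hle] at ht
    have ht0 : 0 ≤ t := (hn0 n).trans ht.1.le
    have ep : Real.exp h ^ n = Real.exp (n * h) := (Real.exp_nat_mul h n).symm
    have ep1 : Real.exp h ^ (n + 1) = Real.exp ((n + 1 : ℕ) * h) := (Real.exp_nat_mul h _).symm
    have er : Real.exp (-(β * h)) ^ n = Real.exp (-(β * (n * h))) := by
      rw [← Real.exp_nat_mul]; congr 1; ring
    have er1 : Real.exp (-(β * h)) ^ (n + 1) = Real.exp (-(β * ((n + 1 : ℕ) * h))) := by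
      rw [← Real.exp_nat_mul]; congr 1; ring
    have hpn : 1 ≤ Real.exp h ^ n := one_le_pow₀ hq.le
    have hm1 : s * Real.exp h ^ n ∈ Icc (1 * Real.exp h ^ n) (1 * Real.exp h ^ (n + 1)) := by
      rw [pow_succ']
      constructor <;> nlinarith
    have hm2 : 1 * Real.exp t ∈ Icc (1 * Real.exp h ^ n) (1 * Real.exp h ^ (n + 1)) := by
      rw [ep, ep1, one_mul, one_mul, one_mul]
      exact ⟨Real.exp_le_exp.2 ht.1.le, Real.exp_le_exp.2 ht.2⟩
    have h1 := norm_rayKernel_sub_le_of_mem hζ hζ1 (by rwa [one_mul]) hm1 hm2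
    have h2 : ‖rayKernel ζ (1 * Real.exp t)‖ ≤ 8 :=
      (norm_rayKernel_le hζ hζ1 (one_le_mul_exp le_rfl ht0)).trans
        (div_le_self (by norm_num) (one_le_mul_exp le_rfl ht0))
    have h3 : Real.exp (-(β * t)) ≤ Real.exp (-(β * h)) ^ n := by
      rw [er]
      exact Real.exp_le_exp.2 (neg_le_neg (mul_le_mul_of_nonneg_left ht.1.le hβ))
    have h4 : Real.exp (-(β * h)) ^ (n + 1) ≤ Real.exp (-(β * t)) := by
      rw [er1]
      exact Real.exp_le_exp.2 (neg_le_neg (mul_le_mul_of_nonneg_left ht.2 hβ))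
    have e2 : (Real.exp (-(β * h)) : ℂ) ^ n * rayKernel ζ (s * Real.exp h ^ n) -
        (Real.exp (-(β * t)) : ℂ) * rayKernel ζ (1 * Real.exp t) =
        (Real.exp (-(β * h)) : ℂ) ^ n * (rayKernel ζ (s * Real.exp h ^ n) -
          rayKernel ζ (1 * Real.exp t)) +
        ((Real.exp (-(β * h)) ^ n - Real.exp (-(β * t)) : ℝ) : ℂ) *
          rayKernel ζ (1 * Real.exp t) := by
      push_cast; ring
    rw [e2]
    refine (norm_add_le _ _).trans (add_le_add ?_ ?_)
    · rw [norm_mul]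
      exact (mul_le_of_le_one_left (norm_nonneg _) (hpow n)).trans h1
    · rw [norm_mul, Complex.norm_real, Real.norm_of_nonneg (by linarith), mul_comm]
      exact mul_le_mul h2 (by linarith) (by linarith) (by norm_num)
  refine (norm_sum_le_of_le _ hcell).trans ?_
  rw [← Finset.sum_mul, Finset.sum_add_distrib, ← Finset.mul_sum]
  have h1 := sum_rayMajorant_le hb hb2 le_rfl hq N
  have h2 : ∑ n ∈ Finset.range N, (Real.exp (-(β * h)) ^ n - Real.exp (-(β * h)) ^ (n + 1)) ≤
      1 := by
    rw [Finset.sum_range_sub' (fun n => Real.exp (-(β * h)) ^ n)]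
    have : 0 < Real.exp (-(β * h)) ^ N := by positivity
    simp only [pow_zero]
    linarith
  gcongr
  linarith

end RayCompare

/-! ### Quantitative estimates for the geometry -/

/-- The square root of a function of `ε` that stays away from `0`, with `2 α d = √ε radical`. -/
noncomputable def radical (re ri ε : ℝ) : ℝ :=
  √((2 * ri + ε) * (2 * re - ε) * (2 * re - 2 * ri - ε))

namespace Admissible

variable {re ri ε : ℝ}

theorem sqrt_eps_pos (H : Admissible re ri ε) : 0 < √ε := Real.sqrt_pos.2 H.eps_pos

theorem sq_sqrt_eps (H : Admissible re ri ε) : √ε ^ 2 = ε := Real.sq_sqrt H.eps_pos.le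

theorem sqrt_eps_le (H : Admissible re ri ε) : √ε ≤ re + 1 := by
  have h1 := H.sq_sqrt_eps
  have h2 := H.eps_lt
  have h3 := H.ri_pos
  have h4 := H.re_pos
  have h5 := H.sqrt_eps_pos
  nlinarith

theorem radical_sq (H : Admissible re ri ε) :
    radical re ri ε ^ 2 = (2 * ri + ε) * (2 * re - ε) * (2 * re - 2 * ri - ε) := by
  have h1 := H.ri_pos
  have h2 := H.ri_lt
  have h3 := H.eps_pos
  have h4 := H.eps_lt
  have e1 : 0 < 2 * ri + ε := by linarith
  have e2 : 0 < 2 * re - ε := by linarith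
  have e3 : 0 < 2 * re - 2 * ri - ε := by linarith
  exact Real.sq_sqrt (by positivity)

theorem le_radical (H : Admissible re ri ε) : √(2 * ri * re * (re - ri)) ≤ radical re ri ε := by
  have h1 := H.ri_pos
  have h2 := H.ri_lt
  have h3 := H.eps_pos
  have h4 := H.eps_lt
  have h5 := H.re_pos
  refine Real.sqrt_le_sqrt ?_
  have e1 : 2 * ri ≤ 2 * ri + ε := by linarith
  have e2 : re ≤ 2 * re - ε := by linarith
  have e3 : re - ri ≤ 2 * re - 2 * ri - ε := by linarith
  have e4 : 0 ≤ re - ri := by linarith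
  gcongr
  exact mul_nonneg (by linarith) (by linarith)

theorem radical_pos (H : Admissible re ri ε) : 0 < radical re ri ε := by
  have h1 := H.ri_pos
  have h2 := H.re_pos
  have h3 : 0 < re - ri := by linarith [H.ri_lt]
  exact lt_of_lt_of_le (Real.sqrt_pos.2 (by positivity)) H.le_radical

theorem radical_le (H : Admissible re ri ε) : radical re ri ε ≤ √(12 * re ^ 3) := by
  have h1 := H.ri_pos
  have h2 := H.ri_lt
  have h3 := H.eps_pos
  have h4 := H.eps_lt
  have h5 := H.re_pos
  refine Real.sqrt_le_sqrt ?_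
  have e1 : 2 * ri + ε ≤ 3 * re := by linarith
  have e2 : 2 * re - ε ≤ 2 * re := by linarith
  have e3 : 2 * re - 2 * ri - ε ≤ 2 * re := by linarith
  have e4 : 0 ≤ 2 * re - 2 * ri - ε := by linarith
  have e5 : 0 ≤ 2 * re - ε := by linarith
  calc _ ≤ 3 * re * (2 * re) * (2 * re) := by gcongr
    _ = _ := by ring

theorem two_mul_alpha (H : Admissible re ri ε) :
    2 * (re - ri - ε) * alpha re ri ε = √ε * radical re ri ε := by
  have h : re - ri - ε ≠ 0 := by linarith [H.eps_lt]
  rw [alpha, mul_div_cancel₀ _ (mul_ne_zero two_ne_zero h), radical,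
    ← Real.sqrt_mul H.eps_pos.le]
  congr 1; ring

/-- Directly, q - 1 = 2α(ce - ci)/((ci - α)(ce + α)); the factor ci - α is removed with ri² = (ci -
α)(ci + α). Together with `two_mul_alpha` this shows q - 1 as √ε times a quantity bounded from both
sides. -/
theorem ratio_sub_one (H : Admissible re ri ε) :
    ratio re ri ε - 1 = 2 * (re - ri - ε) * alpha re ri ε * (ci re ri ε + alpha re ri ε) /
      (ri ^ 2 * (ce re ri ε + alpha re ri ε)) := by
  have h1 := H.alpha_lt_ci
  have h2 := H.alpha_lt_ce
  have h3 := H.alpha_pos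
  have e1 : ci re ri ε - alpha re ri ε ≠ 0 := by linarith
  have e2 : ce re ri ε - alpha re ri ε ≠ 0 := by linarith
  have e3 : ci re ri ε + alpha re ri ε ≠ 0 := by linarith
  have e4 : ce re ri ε + alpha re ri ε ≠ 0 := by linarith
  have e5 : ri ^ 2 = (ci re ri ε - alpha re ri ε) * (ci re ri ε + alpha re ri ε) := by
    rw [H.ri_sq]; ring
  have e6 : re - ri - ε = ce re ri ε - ci re ri ε := by rw [ce]; ring
  rw [ratio, levelI, levelE, e5, e6]
  field_simp
  ring

theorem ratio_sub_one_ge (H : Admissible re ri ε) :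
    √ε * (√(2 * ri * re * (re - ri)) / (ri * re)) ≤ ratio re ri ε - 1 := by
  have h1 := H.ri_pos
  have h2 := H.ri_lt
  have h3 := H.eps_pos
  have h4 := H.eps_lt
  have h5 := H.re_pos
  have h6 := H.alpha_pos
  have h7 := H.ri_lt_ci
  have h8 := H.sqrt_eps_pos
  have h9 := H.le_radical
  have h10 := H.radical_pos
  have e6 : ce re ri ε = ci re ri ε + (re - ri - ε) := by rw [ce]; ring
  have h11 := H.ci_lt_ce
  rw [H.ratio_sub_one, H.two_mul_alpha, mul_div_assoc']
  rw [div_le_div_iff₀ (by positivity) (mul_pos (by positivity) (by linarith))]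
  have h12 : ri * (ce re ri ε + alpha re ri ε) ≤ re * (ci re ri ε + alpha re ri ε) := by
    rw [e6]; nlinarith
  calc √ε * √(2 * ri * re * (re - ri)) * (ri ^ 2 * (ce re ri ε + alpha re ri ε))
      ≤ √ε * radical re ri ε * (ri ^ 2 * (ce re ri ε + alpha re ri ε)) := by
        have : 0 < ce re ri ε + alpha re ri ε := by linarith
        gcongr
    _ = √ε * radical re ri ε * ri * (ri * (ce re ri ε + alpha re ri ε)) := by ring
    _ ≤ √ε * radical re ri ε * ri * (re * (ci re ri ε + alpha re ri ε)) := by gcongr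
    _ = _ := by ring

theorem ratio_sub_one_le (H : Admissible re ri ε) :
    ratio re ri ε - 1 ≤ √ε * (√(12 * re ^ 3) / ri ^ 2) := by
  have h1 := H.ri_pos
  have h6 := H.alpha_pos
  have h7 := H.ri_lt_ci
  have h8 := H.sqrt_eps_pos
  have h9 := H.radical_le
  have h11 := H.ci_lt_ce
  have h12 : 0 < ce re ri ε + alpha re ri ε := by linarith
  rw [H.ratio_sub_one, H.two_mul_alpha, mul_div_assoc',
    div_le_div_iff₀ (by positivity) (by positivity)]
  calc √ε * radical re ri ε * (ci re ri ε + alpha re ri ε) * ri ^ 2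
      ≤ √ε * √(12 * re ^ 3) * (ce re ri ε + alpha re ri ε) * ri ^ 2 := by
        have := H.radical_pos
        have : 0 < ci re ri ε + alpha re ri ε := by linarith
        gcongr
    _ = _ := by ring

/-- The restriction on ε keeps the disks away from the concentric position, where the poles escape
to infinity. -/
theorem alpha_le (H : Admissible re ri ε) (h : ε ≤ (re - ri) / 2) :
    alpha re ri ε ≤ √ε * (√(12 * re ^ 3) / (re - ri)) := by
  have h2 : 0 < re - ri := by linarith [H.ri_lt]
  have h3 := H.two_mul_alpha
  have h4 := H.radical_le
  have h5 := H.alpha_pos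
  have h8 := H.sqrt_eps_pos
  rw [mul_div_assoc', le_div_iff₀ h2]
  nlinarith

theorem shift_eq (H : Admissible re ri ε) :
    shift re ri ε * (ce re ri ε + re) = alpha re ri ε ^ 2 := by
  rw [shift]; linarith [H.re_sq]

theorem shift_nonneg (H : Admissible re ri ε) : 0 ≤ shift re ri ε := by
  have h1 := H.shift_eq
  have h2 : 0 < ce re ri ε + re := by
    linarith [H.alpha_lt_ce, H.alpha_pos, H.re_pos]
  by_contra h
  push Not at h
  nlinarith [sq_nonneg (alpha re ri ε)]

theorem shift_le_alpha (H : Admissible re ri ε) : shift re ri ε ≤ alpha re ri ε := by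
  have h1 := H.shift_eq
  have h2 := H.alpha_lt_ce
  have h3 := H.alpha_pos
  have h4 := H.re_pos
  have h5 := H.shift_nonneg
  by_contra h
  push Not at h
  nlinarith

theorem log_levelI_le (H : Admissible re ri ε) :
    Real.log (levelI re ri ε) ≤ alpha re ri ε * (2 * (ri + 2 * alpha re ri ε) / ri ^ 2) := by
  have h1 := H.alpha_lt_ci
  have h3 := H.alpha_pos
  have h4 := H.ri_pos
  have h5 := H.ri_sq
  have h6 : ci re ri ε ≤ ri + alpha re ri ε := by nlinarith
  have h7 : 0 < ci re ri ε - alpha re ri ε := by linarith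
  refine (Real.log_le_sub_one_of_pos (by linarith [H.one_lt_levelI])).trans ?_
  have e : levelI re ri ε - 1 = alpha re ri ε * (2 / (ci re ri ε - alpha re ri ε)) := by
    rw [levelI]; field_simp; ring
  rw [e]
  refine mul_le_mul_of_nonneg_left ?_ h3.le
  rw [div_le_div_iff₀ h7 (by positivity)]
  nlinarith

theorem ratio_sub_one_le_mul (H : Admissible re ri ε) :
    ratio re ri ε - 1 ≤ 2 * re * (ri + 2 * alpha re ri ε) / ri ^ 2 *
      (alpha re ri ε / (ce re ri ε + alpha re ri ε)) := by
  have h1 := H.alpha_lt_ci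
  have h2 := H.alpha_lt_ce
  have h3 := H.alpha_pos
  have h4 := H.ri_pos
  have h5 := H.ri_sq
  have h6 : ci re ri ε ≤ ri + alpha re ri ε := by nlinarith
  have h7 : re - ri - ε ≤ re := by linarith [H.eps_pos]
  have h8 : 0 ≤ ci re ri ε + alpha re ri ε := by linarith
  have h9 : 0 < ce re ri ε + alpha re ri ε := by linarith
  have h10 := H.re_pos
  rw [H.ratio_sub_one, div_mul_div_comm]
  gcongr ?_ / _
  calc _ = 2 * (re - ri - ε) * (ci re ri ε + alpha re ri ε) * alpha re ri ε := by ring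
    _ ≤ 2 * re * (ri + 2 * alpha re ri ε) * alpha re ri ε :=
      mul_le_mul_of_nonneg_right (mul_le_mul (by linarith) (by linarith) h8 (by linarith)) h3.le

/-- One has |1+ζ|/|ζ| ≥ 1 - 1/|ζ| ≥ (1 - 1/|ζ|²)/2, and at the level of ∂Ω the last quantity is
α/(ce + α). It bounds from below the relative distance of the ray's starting point to the
singularity -1, as the error estimate for the sums requires. -/
theorem norm_expBipolar_ratio_ge (H : Admissible re ri ε) {ζ : ℂ}
    (hζ : levelE re ri ε ≤ ‖ζ‖ ^ 2) :
    alpha re ri ε / (ce re ri ε + alpha re ri ε) ≤ ‖1 + ζ‖ / ‖ζ‖ := by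
  have h2 := H.alpha_lt_ce
  have h3 := H.alpha_pos
  have h4 := H.one_lt_levelE
  have h5 : 1 < ‖ζ‖ := by
    by_contra h
    push Not at h
    nlinarith [norm_nonneg ζ]
  have h6 : alpha re ri ε / (ce re ri ε + alpha re ri ε) = (1 - (levelE re ri ε)⁻¹) / 2 := by
    have e1 : ce re ri ε - alpha re ri ε ≠ 0 := by linarith
    have e4 : ce re ri ε + alpha re ri ε ≠ 0 := by linarith
    rw [levelE]; field_simp; ring
  have h7 : (‖ζ‖ ^ 2)⁻¹ ≤ (levelE re ri ε)⁻¹ := inv_anti₀ (by linarith) hζ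
  have h8 : 1 - ‖ζ‖⁻¹ ≤ ‖1 + ζ‖ / ‖ζ‖ := by
    rw [le_div_iff₀ (by linarith), sub_mul, one_mul, inv_mul_cancel₀ (by linarith)]
    have := norm_sub_norm_le ζ (-1)
    rw [norm_neg, norm_one, sub_neg_eq_add, add_comm ζ] at this
    exact this
  have h9 : (levelE re ri ε)⁻¹ ≥ (‖ζ‖⁻¹) ^ 2 := by rwa [inv_pow]
  have h10 : (0 : ℝ) ≤ ‖ζ‖⁻¹ := by positivity
  rw [h6]
  nlinarith [sq_nonneg (‖ζ‖⁻¹ - 1)]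

theorem abs_radical_sub_le (H : Admissible re ri ε) :
    |radical re ri 0 - radical re ri ε| * √(2 * ri * re * (re - ri)) ≤ ε * (24 * re ^ 2) := by
  have h1 := H.ri_pos
  have h2 := H.ri_lt
  have h3 := H.eps_pos
  have h4 := H.eps_lt
  have h5 := H.re_pos
  have h6 := H.radical_sq
  have h7 := H.le_radical
  have h8 : radical re ri 0 ^ 2 = (2 * ri) * (2 * re) * (2 * re - 2 * ri) := by
    rw [radical, Real.sq_sqrt] <;> simp only [add_zero, sub_zero]
    have : 0 < 2 * re - 2 * ri := by linarith
    positivity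
  have h9 : 0 ≤ radical re ri 0 := Real.sqrt_nonneg _
  have h10 : |radical re ri 0 - radical re ri ε| * √(2 * ri * re * (re - ri)) ≤
      |radical re ri 0 - radical re ri ε| * |radical re ri 0 + radical re ri ε| := by
    refine mul_le_mul_of_nonneg_left ?_ (abs_nonneg _)
    exact h7.trans ((le_add_of_nonneg_left h9).trans (le_abs_self _))
  refine h10.trans ?_
  rw [← abs_mul]
  have e : (radical re ri 0 - radical re ri ε) * (radical re ri 0 + radical re ri ε) =
      ε * (-(2 * re) * (2 * re - 2 * ri - ε) + (2 * ri + ε) * (2 * re - 2 * ri - ε) +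
        (2 * ri) * (2 * re)) := by
    have : (radical re ri 0 - radical re ri ε) * (radical re ri 0 + radical re ri ε) =
      radical re ri 0 ^ 2 - radical re ri ε ^ 2 := by ring
    rw [this, h6, h8]; ring
  rw [e, abs_mul, abs_of_pos h3]
  refine mul_le_mul_of_nonneg_left ?_ h3.le
  have a1 : 0 ≤ re * (2 * re - 2 * ri - ε) := mul_nonneg h5.le (by linarith)
  have a2 : 0 ≤ (2 * ri + ε) * (2 * re - 2 * ri - ε) := mul_nonneg (by linarith) (by linarith)
  have a3 : re * (2 * re - 2 * ri - ε) ≤ re * (2 * re) :=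
    mul_le_mul_of_nonneg_left (by linarith) h5.le
  have a4 : (2 * ri + ε) * (2 * re - 2 * ri - ε) ≤ (3 * re) * (2 * re) :=
    mul_le_mul (by linarith) (by linarith) (by linarith) (by linarith)
  have a5 : ri * re ≤ re * re := mul_le_mul_of_nonneg_right h2.le h5.le
  have a6 : 0 ≤ ri * re := by positivity
  rw [abs_le]
  constructor <;> nlinarith

/-- The origin of r_*: in 1/(q - 1) the limits ci → ri, ce → re and α → 0 leave ri re/(√ε
radical(0)) as leading term. -/
theorem rStar_eq (H : Admissible re ri ε) :
    rStar re ri / 4 = ri * re / radical re ri 0 := by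
  have h1 := H.ri_pos
  have h3 : 0 < re - ri := by linarith [H.ri_lt]
  have h5 := H.re_pos
  have e1 : radical re ri 0 = √(2 * ri * re / (re - ri)) * (2 * (re - ri)) := by
    rw [radical, ← Real.sqrt_sq (by positivity : 0 ≤ 2 * (re - ri)), ← Real.sqrt_mul
      (by positivity)]
    congr 1
    simp only [add_zero, sub_zero]
    field_simp
  have h6 : 0 < √(2 * ri * re / (re - ri)) := Real.sqrt_pos.2 (by positivity)
  have h7 : √(2 * ri * re / (re - ri)) ^ 2 = 2 * ri * re / (re - ri) :=
    Real.sq_sqrt (by positivity)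
  rw [e1, rStar, div_eq_div_iff (by norm_num) (by positivity)]
  have : √(2 * ri * re / (re - ri)) * (√(2 * ri * re / (re - ri)) * (2 * (re - ri))) =
      √(2 * ri * re / (re - ri)) ^ 2 * (2 * (re - ri)) := by ring
  rw [this, h7]
  field_simp
  norm_num

/-- From 1 - 1/q ≤ log q ≤ q - 1: the reciprocals of the two outer terms differ by exactly 1. -/
theorem one_div_log_sub_le (H : Admissible re ri ε) :
    |1 / Real.log (ratio re ri ε) - 1 / (ratio re ri ε - 1)| ≤ 1 := by
  have h1 := H.one_lt_ratio
  have h2 : 0 < ratio re ri ε - 1 := by linarith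
  have h3 := Real.log_pos h1
  have h4 := Real.log_le_sub_one_of_pos H.ratio_pos
  have h5 := Real.one_sub_inv_le_log_of_pos H.ratio_pos
  have h6 : 1 / (ratio re ri ε - 1) ≤ 1 / Real.log (ratio re ri ε) :=
    one_div_le_one_div_of_le h3 h4
  have h7 : 1 / Real.log (ratio re ri ε) ≤ 1 + 1 / (ratio re ri ε - 1) := by
    have e : 1 + 1 / (ratio re ri ε - 1) = 1 / (1 - (ratio re ri ε)⁻¹) := by
      have := H.ratio_pos.ne'
      field_simp; ring
    rw [e]
    refine one_div_le_one_div_of_le ?_ h5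
    rw [sub_pos]
    exact inv_lt_one_of_one_lt₀ h1
  rw [abs_le]
  constructor <;> linarith

/-- Both quantities are 1/√ε times a factor, and the factors differ by O(√ε): ci - ri and ce - re
are at most α, which is O(√ε), and the radical changes by O(ε). -/
theorem one_div_ratio_sub_le (H : Admissible re ri ε) {A : ℝ} (hA : alpha re ri ε ≤ √ε * A) :
    |1 / (ratio re ri ε - 1) - rStar re ri / (4 * √ε)| ≤
      (2 * A * √(12 * re ^ 3) * (ri + re) * √(2 * ri * re * (re - ri)) +
        ri * re * ((re + 1) * (24 * re ^ 2))) / √(2 * ri * re * (re - ri)) ^ 3 := by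
  have h1 := H.ri_pos
  have h3 : 0 < re - ri := by linarith [H.ri_lt]
  have h5 := H.re_pos
  have hα := H.alpha_pos
  have hη := H.sqrt_eps_pos
  have hci := H.ri_lt_ci
  have hce := H.ci_lt_ce
  have hr := H.radical_pos
  have hrl := H.le_radical
  have hru := H.radical_le
  have hr0' : √(2 * ri * re * (re - ri)) ≤ radical re ri 0 := by
    refine Real.sqrt_le_sqrt ?_
    simp only [add_zero, sub_zero]
    have : 0 < ri * re * (re - ri) := by positivity
    nlinarith
  have hr0u : radical re ri 0 ≤ √(12 * re ^ 3) := by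
    refine Real.sqrt_le_sqrt ?_
    simp only [add_zero, sub_zero]
    have : 0 < re ^ 2 := by positivity
    have a5 : ri * re ^ 2 ≤ re * re ^ 2 := mul_le_mul_of_nonneg_right H.ri_lt.le this.le
    have a6 : 0 < ri ^ 2 * re := by positivity
    nlinarith
  have hm : 0 < √(2 * ri * re * (re - ri)) := Real.sqrt_pos.2 (by positivity)
  have habs := H.abs_radical_sub_le
  set m := √(2 * ri * re * (re - ri))
  set M := √(12 * re ^ 3)
  have hr0 : 0 < radical re ri 0 := hm.trans_le hr0'
  have hce0 : 0 < ce re ri ε + alpha re ri ε := by linarith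
  have hci0 : 0 < ci re ri ε + alpha re ri ε := by linarith
  have e : 1 / (ratio re ri ε - 1) - rStar re ri / (4 * √ε) =
      ri * (ri * (ce re ri ε + alpha re ri ε) * radical re ri 0 -
        re * (ci re ri ε + alpha re ri ε) * radical re ri ε) /
      (√ε * ((ci re ri ε + alpha re ri ε) * radical re ri ε * radical re ri 0)) := by
    rw [← div_div, H.rStar_eq, H.ratio_sub_one, H.two_mul_alpha]
    field_simp
  have hci1 : ci re ri ε - ri ≤ alpha re ri ε := by nlinarith [H.ri_sq]
  have hce1 : ce re ri ε - re ≤ alpha re ri ε := by nlinarith [H.re_sq]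
  have hce2 : 0 ≤ ce re ri ε - re := H.shift_nonneg
  have hA0 : 0 < A := by
    by_contra h
    push Not at h
    nlinarith
  have hnum : |ri * (ce re ri ε + alpha re ri ε) * radical re ri 0 -
      re * (ci re ri ε + alpha re ri ε) * radical re ri ε| * m ≤
      √ε * (2 * A * M * (ri + re) * m + ri * re * ((re + 1) * (24 * re ^ 2))) := by
    have e1 : ri * (ce re ri ε + alpha re ri ε) * radical re ri 0 -
        re * (ci re ri ε + alpha re ri ε) * radical re ri ε =
        ri * ((ce re ri ε - re) + alpha re ri ε) * radical re ri 0 -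
        re * ((ci re ri ε - ri) + alpha re ri ε) * radical re ri ε +
        ri * re * (radical re ri 0 - radical re ri ε) := by ring
    have b1 : |ri * ((ce re ri ε - re) + alpha re ri ε) * radical re ri 0| ≤
        ri * (2 * (√ε * A)) * M := by
      rw [abs_of_nonneg (mul_nonneg (mul_nonneg h1.le (by linarith)) hr0.le)]
      exact mul_le_mul (mul_le_mul_of_nonneg_left (by linarith) h1.le) hr0u hr0.le
        (by positivity)
    have b2 : |re * ((ci re ri ε - ri) + alpha re ri ε) * radical re ri ε| ≤
        re * (2 * (√ε * A)) * M := by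
      rw [abs_of_nonneg (mul_nonneg (mul_nonneg h5.le (by linarith)) hr.le)]
      exact mul_le_mul (mul_le_mul_of_nonneg_left (by linarith) h5.le) hru hr.le (by positivity)
    have b3 : |ri * re * (radical re ri 0 - radical re ri ε)| * m ≤
        √ε * (ri * re * ((re + 1) * (24 * re ^ 2))) := by
      rw [abs_mul, abs_of_pos (by positivity), mul_assoc]
      have b4 : ε * (24 * re ^ 2) ≤ √ε * ((re + 1) * (24 * re ^ 2)) := by
        nth_rewrite 1 [← H.sq_sqrt_eps]
        rw [sq, mul_assoc]
        have := H.sqrt_eps_le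
        gcongr
      calc _ ≤ ri * re * (√ε * ((re + 1) * (24 * re ^ 2))) :=
            mul_le_mul_of_nonneg_left (habs.trans b4) (by positivity)
        _ = _ := by ring
    rw [e1]
    refine (mul_le_mul_of_nonneg_right ((abs_add_le _ _).trans
      (add_le_add_left (abs_sub _ _) _)) hm.le).trans ?_
    have b5 := mul_le_mul_of_nonneg_right (add_le_add b1 b2) hm.le
    linarith
  have hden : √ε * (ri * m ^ 2) ≤
      √ε * ((ci re ri ε + alpha re ri ε) * radical re ri ε * radical re ri 0) := by
    rw [sq, ← mul_assoc ri]
    gcongr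
    linarith
  rw [e, abs_div, abs_mul, abs_of_pos h1, abs_of_pos (a := √ε * _) (by positivity),
    div_le_div_iff₀ (by positivity) (by positivity)]
  calc _ = (ri * m ^ 2) * (|ri * (ce re ri ε + alpha re ri ε) * radical re ri 0 -
      re * (ci re ri ε + alpha re ri ε) * radical re ri ε| * m) := by ring
    _ ≤ (ri * m ^ 2) *
        (√ε * (2 * A * M * (ri + re) * m + ri * re * ((re + 1) * (24 * re ^ 2)))) := by
        gcongr
    _ = (2 * A * M * (ri + re) * m + ri * re * ((re + 1) * (24 * re ^ 2))) *
        (√ε * (ri * m ^ 2)) := by ring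
    _ ≤ _ := by gcongr

/-- The asymptotic size of the geometric constants, up to a factor `C`. -/
def _root_.CoreShell.GeometryBound (re ri C : ℝ) : Prop := 1 ≤ C ∧
    ∀ ε, Admissible re ri ε → ratio re ri ε ≤ C ∧ √ε ≤ C * Real.log (ratio re ri ε) ∧
      (ε ≤ (re - ri) / 2 → alpha re ri ε ≤ C * √ε ∧ Real.log (levelI re ri ε) ≤ C * √ε ∧
        ratio re ri ε - 1 ≤ C * (alpha re ri ε / (ce re ri ε + alpha re ri ε)) ∧
        |1 / Real.log (ratio re ri ε) - rStar re ri / (4 * √ε)| ≤ C)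

theorem exists_geometryBound (hri : 0 < ri) (hre : ri < re) : ∃ C : ℝ, GeometryBound re ri C := by
  have hre0 : 0 < re := hri.trans hre
  have hd : 0 < re - ri := by linarith
  have hm : 0 < √(2 * ri * re * (re - ri)) := Real.sqrt_pos.2 (by positivity)
  set m := √(2 * ri * re * (re - ri)) with hmdef
  set M := √(12 * re ^ 3) with hMdef
  have hM : 0 ≤ M := Real.sqrt_nonneg _
  set A := M / (re - ri) with hAdef
  have hA : 0 ≤ A := by positivity
  obtain ⟨Q, hQ⟩ : ∃ Q, Q = 1 + (re + 1) * (M / ri ^ 2) := ⟨_, rfl⟩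
  have hQ1 : 1 ≤ Q := by rw [hQ]; exact le_add_of_nonneg_right (by positivity)
  obtain ⟨A', hA'⟩ : ∃ A', A' = ri + 2 * ((re + 1) * A) := ⟨_, rfl⟩
  have hA'0 : 0 ≤ A' := by rw [hA']; positivity
  obtain ⟨G, hG⟩ : ∃ G, G = 1 + (2 * A * M * (ri + re) * m +
    ri * re * ((re + 1) * (24 * re ^ 2))) / m ^ 3 := ⟨_, rfl⟩
  have hG0 : 0 ≤ G := by rw [hG]; positivity
  have t1 : 0 ≤ Q * (ri * re / m) := by positivity
  have t2 : 0 ≤ A * (2 * A' / ri ^ 2) := by positivity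
  have t3 : 0 ≤ M / ri ^ 2 := by positivity
  have t4 : 0 ≤ 2 * re * A' / ri ^ 2 := by positivity
  refine ⟨Q + Q * (ri * re / m) + A + A * (2 * A' / ri ^ 2) + M / ri ^ 2 +
    2 * re * A' / ri ^ 2 + G, by linarith, fun ε H => ?_⟩
  set C := Q + Q * (ri * re / m) + A + A * (2 * A' / ri ^ 2) + M / ri ^ 2 +
    2 * re * A' / ri ^ 2 + G with hC
  have hη := H.sqrt_eps_pos
  have hη1 := H.sqrt_eps_le
  have hq1 : ratio re ri ε ≤ Q := by
    have h1 := H.ratio_sub_one_le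
    have h2 : √ε * (M / ri ^ 2) ≤ (re + 1) * (M / ri ^ 2) := by gcongr
    linarith
  have hlog := Real.log_pos H.one_lt_ratio
  refine ⟨by linarith, ?_, fun hε => ?_⟩
  · have h1 := H.ratio_sub_one_ge
    have h2 := Real.one_sub_inv_le_log_of_pos H.ratio_pos
    have h3 : ratio re ri ε - 1 ≤ Q * Real.log (ratio re ri ε) := by
      have h4 : ratio re ri ε - 1 = ratio re ri ε * (1 - (ratio re ri ε)⁻¹) := by
        rw [mul_sub, mul_inv_cancel₀ H.ratio_pos.ne', mul_one]
      rw [h4]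
      refine (mul_le_mul_of_nonneg_left h2 H.ratio_pos.le).trans ?_
      gcongr
    have h5 : √ε = √ε * (m / (ri * re)) * (ri * re / m) := by field_simp
    have h6 : √ε ≤ Q * Real.log (ratio re ri ε) * (ri * re / m) := by
      rw [h5]
      exact mul_le_mul_of_nonneg_right (h1.trans h3) (by positivity)
    refine h6.trans ?_
    have h7 : Q * (ri * re / m) ≤ C := by linarith
    calc _ = Q * (ri * re / m) * Real.log (ratio re ri ε) := by ring
      _ ≤ _ := by gcongr
  · have ha := H.alpha_le hε
    have hα := H.alpha_pos
    have ha1 : ri + 2 * alpha re ri ε ≤ A' := by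
      rw [hA']
      have : √ε * A ≤ (re + 1) * A := by gcongr
      linarith
    refine ⟨?_, ?_, ?_, ?_⟩
    · refine ha.trans ?_
      rw [mul_comm]
      have : A ≤ C := by linarith
      gcongr
    · refine H.log_levelI_le.trans ?_
      calc _ ≤ √ε * A * (2 * A' / ri ^ 2) := by gcongr
        _ = A * (2 * A' / ri ^ 2) * √ε := by ring
        _ ≤ _ := by
          have : A * (2 * A' / ri ^ 2) ≤ C := by linarith
          gcongr
    · refine H.ratio_sub_one_le_mul.trans ?_
      have h1 : 0 < ce re ri ε + alpha re ri ε := by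
        linarith [H.ci_lt_ce, H.ri_lt_ci, H.ri_pos]
      refine mul_le_mul_of_nonneg_right ?_ (by positivity)
      calc _ ≤ 2 * re * A' / ri ^ 2 := by gcongr
        _ ≤ _ := by linarith
    · refine (abs_sub_le _ (1 / (ratio re ri ε - 1)) _).trans ?_
      have h1 := H.one_div_log_sub_le
      have h2 := H.one_div_ratio_sub_le ha
      have : G ≤ C := by linarith
      linarith

end Admissible

/-! ### The field in bipolar coordinates -/

theorem norm_rayKernel_one {ζ : ℂ} (hζ : 1 ≤ ‖ζ‖) (hζ1 : 1 + ζ ≠ 0) : ‖rayKernel ζ 1‖ = 1 := by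
  have h1 : ‖1 + ζ‖ ≠ 0 := norm_ne_zero_iff.2 hζ1
  rw [norm_rayKernel le_rfl hζ, Complex.ofReal_one, one_mul, mul_one, div_self (pow_ne_zero 2 h1)]

/-- The point with complex bipolar coordinate `ω`. -/
noncomputable def bipolarPoint (a : ℝ) (ω : ℂ) : ℂ := a * (ω - 1) / (ω + 1)

theorem mob_bipolarPoint {a Q : ℝ} {ω : ℂ} (ha : a ≠ 0) (hω : 1 + ω ≠ 0)
    (hQω : 1 + Q * ω ≠ 0) : mob a Q (bipolarPoint a ω) = bipolarPoint a (Q * ω) := by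
  have ha' : (a : ℂ) ≠ 0 := Complex.ofReal_ne_zero.2 ha
  rw [add_comm] at hω hQω
  have e : ((Q : ℂ) + 1) * a + (Q - 1) * (a * (ω - 1) / (ω + 1)) =
      2 * a * (Q * ω + 1) / (ω + 1) := by
    field_simp; ring
  rw [mob, bipolarPoint, bipolarPoint, e]
  field_simp
  ring

theorem mobDeriv_bipolarPoint {a Q : ℝ} {ω : ℂ} (ha : a ≠ 0) (hω : 1 + ω ≠ 0)
    (hQω : 1 + Q * ω ≠ 0) :
    mobDeriv a Q (bipolarPoint a ω) = Q * (1 + ω) ^ 2 / (1 + Q * ω) ^ 2 := by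
  have ha' : (a : ℂ) ≠ 0 := Complex.ofReal_ne_zero.2 ha
  rw [add_comm] at hω hQω
  have e : ((Q : ℂ) + 1) * a + (Q - 1) * (a * (ω - 1) / (ω + 1)) =
      2 * a * (Q * ω + 1) / (ω + 1) := by
    field_simp; ring
  rw [mobDeriv, bipolarPoint, e, add_comm 1 ω, add_comm 1 ((Q : ℂ) * ω), div_pow, div_div_eq_mul_div,
    div_eq_div_iff (pow_ne_zero 2 (mul_ne_zero (mul_ne_zero two_ne_zero ha') hQω))
      (pow_ne_zero 2 hQω)]
  ring

/-! ### Levels and unit vectors in bipolar coordinates. -/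

namespace Admissible

variable {re ri ε : ℝ} {x : ℂ}

theorem alpha_sub_ne_zero (hp : x + (shift re ri ε : ℂ) ≠ (alpha re ri ε : ℂ)) :
    (alpha re ri ε : ℂ) - (x + shift re ri ε) ≠ 0 := sub_ne_zero.2 (Ne.symm hp)

theorem one_add_expBipolar (H : Admissible re ri ε)
    (hp : x + (shift re ri ε : ℂ) ≠ (alpha re ri ε : ℂ)) : 1 + expBipolar re ri ε x =
      2 * alpha re ri ε / (alpha re ri ε - (x + shift re ri ε)) ∧
      1 + expBipolar re ri ε x ≠ 0 := by
  have h := alpha_sub_ne_zero hp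
  have ha : (alpha re ri ε : ℂ) ≠ 0 := Complex.ofReal_ne_zero.2 H.alpha_pos.ne'
  have e : 1 + expBipolar re ri ε x =
      2 * alpha re ri ε / (alpha re ri ε - (x + shift re ri ε)) := by
    rw [expBipolar]; field_simp; ring
  exact ⟨e, by rw [e]; exact div_ne_zero (mul_ne_zero two_ne_zero ha) h⟩

theorem bipolarPoint_expBipolar (H : Admissible re ri ε)
    (hp : x + (shift re ri ε : ℂ) ≠ (alpha re ri ε : ℂ)) :
    x + shift re ri ε = bipolarPoint (alpha re ri ε) (expBipolar re ri ε x) := by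
  have h := alpha_sub_ne_zero hp
  have ha : (alpha re ri ε : ℂ) ≠ 0 := Complex.ofReal_ne_zero.2 H.alpha_pos.ne'
  have e := H.one_add_expBipolar hp
  rw [bipolarPoint, eq_div_iff (by rw [add_comm]; exact e.2), add_comm _ (1 : ℂ), e.1, expBipolar]
  field_simp
  ring

theorem norm_expBipolar_sq : ‖expBipolar re ri ε x‖ ^ 2 =
    ‖(alpha re ri ε : ℂ) + (x + shift re ri ε)‖ ^ 2 /
      ‖(alpha re ri ε : ℂ) - (x + shift re ri ε)‖ ^ 2 := by
  rw [expBipolar, norm_div, div_pow]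

theorem levelE_lt_norm_sq (H : Admissible re ri ε) (hx : x ∈ Om re)
    (hp : x + (shift re ri ε : ℂ) ≠ (alpha re ri ε : ℂ)) :
    levelE re ri ε < ‖expBipolar re ri ε x‖ ^ 2 := by
  have h := norm_pos_iff.2 (alpha_sub_ne_zero hp)
  rw [norm_expBipolar_sq, lt_div_iff₀ (by positivity)]
  exact H.mem_Om_iff.1 hx

theorem one_le_norm_expBipolar (H : Admissible re ri ε) (hx : x ∈ Om re)
    (hp : x + (shift re ri ε : ℂ) ≠ (alpha re ri ε : ℂ)) : 1 ≤ ‖expBipolar re ri ε x‖ := by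
  have h1 := H.levelE_lt_norm_sq hx hp
  have h2 := H.one_lt_levelE
  by_contra h
  push Not at h
  nlinarith [norm_nonneg (expBipolar re ri ε x)]

theorem ne_pole_of_not_mem (H : Admissible re ri ε) (hx : x ∉ Incl ri ε) :
    x + (shift re ri ε : ℂ) ≠ (alpha re ri ε : ℂ) := by
  intro h
  apply hx
  have h1 := H.alpha_pos
  rw [H.mem_Incl_iff, h, sub_self, norm_zero]
  rw [← two_mul, zero_pow two_ne_zero, mul_zero]
  have : 2 * (alpha re ri ε : ℂ) ≠ 0 :=
    mul_ne_zero two_ne_zero (Complex.ofReal_ne_zero.2 h1.ne')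
  exact pow_pos (norm_pos_iff.2 this) 2

theorem norm_sq_le_levelI (H : Admissible re ri ε) (hx : x ∉ Incl ri ε) :
    ‖expBipolar re ri ε x‖ ^ 2 ≤ levelI re ri ε := by
  have h := norm_pos_iff.2 (alpha_sub_ne_zero (H.ne_pole_of_not_mem hx))
  rw [norm_expBipolar_sq, div_le_iff₀ (by positivity)]
  exact not_lt.1 fun h' => hx (H.mem_Incl_iff.2 h')

theorem hasDerivAt_expBipolar (H : Admissible re ri ε)
    (hp : x + (shift re ri ε : ℂ) ≠ (alpha re ri ε : ℂ)) :
    HasDerivAt (expBipolar re ri ε) ((1 + expBipolar re ri ε x) ^ 2 / (2 * alpha re ri ε)) x := by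
  have h := alpha_sub_ne_zero hp
  have ha : (alpha re ri ε : ℂ) ≠ 0 := Complex.ofReal_ne_zero.2 H.alpha_pos.ne'
  have h1 : HasDerivAt (fun x : ℂ => (alpha re ri ε : ℂ) + (x + (shift re ri ε : ℂ))) 1 x :=
    ((hasDerivAt_id x).add_const _).const_add _
  have h2 : HasDerivAt (fun x : ℂ => (alpha re ri ε : ℂ) - (x + (shift re ri ε : ℂ))) (-1) x :=
    ((hasDerivAt_id x).add_const _).const_sub _
  convert! h1.div h2 h using 1
  rw [(H.one_add_expBipolar hp).1]
  field_simp
  ring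

/-- The logarithmic derivative of `e^{ξ + iθ}`. -/
theorem hasDerivAt_log_expBipolar (H : Admissible re ri ε) (hx : x ∈ Om re)
    (hp : x + (shift re ri ε : ℂ) ≠ (alpha re ri ε : ℂ)) :
    HasDerivAt (fun y => Complex.log (expBipolar re ri ε y / expBipolar re ri ε x))
      ((1 + expBipolar re ri ε x) ^ 2 / (2 * alpha re ri ε) / expBipolar re ri ε x) x := by
  have h0 : expBipolar re ri ε x ≠ 0 := by
    rw [← norm_pos_iff]; linarith [H.one_le_norm_expBipolar hx hp]
  have h1 := (H.hasDerivAt_expBipolar hp).div_const (expBipolar re ri ε x)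
  have h2 := h1.clog (by rw [div_self h0]; exact Complex.one_mem_slitPlane)
  rwa [div_self h0, div_one] at h2

/-- `L` is the logarithmic derivative of ζ, so conj L is the gradient of ξ, and its normalisation is
|L|/L. The weight in `rayKernel` is chosen so that its value at 1 is this unit vector. -/
theorem conj_eq_rayKernel (H : Admissible re ri ε) (hx : x ∈ Om re)
    (hp : x + (shift re ri ε : ℂ) ≠ (alpha re ri ε : ℂ)) {L : ℂ}
    (hL : L = (1 + expBipolar re ri ε x) ^ 2 / (2 * alpha re ri ε) / expBipolar re ri ε x) :
    ‖L‖⁻¹ • conj L = rayKernel (expBipolar re ri ε x) 1 ∧ L ≠ 0 := by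
  have hζ := H.one_le_norm_expBipolar hx hp
  have hζ1 := (H.one_add_expBipolar hp).2
  have ha := H.alpha_pos
  have hac : (alpha re ri ε : ℂ) ≠ 0 := Complex.ofReal_ne_zero.2 ha.ne'
  set ζ := expBipolar re ri ε x
  have h0 : ζ ≠ 0 := by rw [← norm_pos_iff]; linarith
  have hL0 : L ≠ 0 := by
    rw [hL]
    exact div_ne_zero (div_ne_zero (pow_ne_zero 2 hζ1) (mul_ne_zero two_ne_zero hac)) h0
  have hn : (‖L‖ : ℂ) ≠ 0 := Complex.ofReal_ne_zero.2 (norm_ne_zero_iff.2 hL0)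
  have e1 : ‖L‖ = ‖1 + ζ‖ ^ 2 / ‖ζ‖ / (2 * alpha re ri ε) := by
    rw [hL, norm_div, norm_div, norm_mul, norm_pow, Complex.norm_real, Complex.norm_ofNat,
      Real.norm_of_nonneg ha.le]
    field_simp
  have e2 : L * conj L = (‖L‖ : ℂ) * ‖L‖ := by
    rw [Complex.mul_conj, Complex.normSq_eq_norm_sq]; push_cast; ring
  refine ⟨?_, hL0⟩
  have e3 : ‖L‖⁻¹ • conj L = ‖L‖ / L := by
    rw [Complex.real_smul, Complex.ofReal_inv, eq_div_iff hL0, mul_assoc, mul_comm (conj L), e2,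
      inv_mul_cancel_left₀ hn]
  rw [e3, e1, hL, rayKernel]
  push_cast
  field_simp

theorem eXi_eq (H : Admissible re ri ε) (hx : x ∈ Om re)
    (hp : x + (shift re ri ε : ℂ) ≠ (alpha re ri ε : ℂ)) :
    eXi re ri ε x = rayKernel (expBipolar re ri ε x) 1 := by
  have h1 := hasGradientAt_re
    ((H.hasDerivAt_log_expBipolar hx hp).add_const (xi re ri ε x : ℂ))
  have h0 : expBipolar re ri ε x ≠ 0 := by
    rw [← norm_pos_iff]; linarith [H.one_le_norm_expBipolar hx hp]
  have h2 : HasGradientAt (xi re ri ε) _ x :=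
    h1.congr_of_eventuallyEq (by
      filter_upwards [(H.hasDerivAt_expBipolar hp).continuousAt.eventually_ne h0] with y hy
      rw [Complex.add_re, Complex.ofReal_re, Complex.log_re, norm_div, Real.log_div (norm_ne_zero_iff.2 hy) (norm_ne_zero_iff.2 h0),
        xi, xi, sub_add_cancel])
  rw [eXi, gradXi, h2.gradient, Complex.norm_conj]
  exact (H.conj_eq_rayKernel hx hp rfl).1

/-- θ is the real part of -i log ζ up to a constant, so e_θ is e_ξ turned by a right angle. -/
theorem eTheta_eq (H : Admissible re ri ε) (hx : x ∈ Om re)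
    (hp : x + (shift re ri ε : ℂ) ≠ (alpha re ri ε : ℂ)) :
    eTheta re ri ε x = Complex.I * rayKernel (expBipolar re ri ε x) 1 := by
  have h1 := hasGradientAt_re ((H.hasDerivAt_log_expBipolar hx hp).const_mul (-Complex.I))
  have h2 : HasGradientAt
      (fun y => Complex.arg (expBipolar re ri ε y / expBipolar re ri ε x)) _ x :=
    h1.congr_of_eventuallyEq (Eventually.of_forall fun y => by
      simp [Complex.log_im])
  rw [eTheta, gradTheta, h2.gradient, Complex.norm_conj, norm_mul, norm_neg, Complex.norm_I,
    one_mul, map_mul, map_neg, Complex.conj_I, neg_neg, ← mul_smul_comm,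
    (H.conj_eq_rayKernel hx hp rfl).1]

/-- Expanding, |1+ζ|²/|ζ| = |ζ| + 1/|ζ| + 2 cos θ. This identifies the weight of the kernel with the
factor in the asymptotic formulas. -/
theorem two_mul_cosh_add_cos (H : Admissible re ri ε) (hx : x ∈ Om re)
    (hp : x + (shift re ri ε : ℂ) ≠ (alpha re ri ε : ℂ)) :
    2 * (Real.cosh (xi re ri ε x) + Real.cos (theta re ri ε x)) =
      ‖1 + expBipolar re ri ε x‖ ^ 2 / ‖expBipolar re ri ε x‖ := by
  have hζ := H.one_le_norm_expBipolar hx hp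
  rw [xi, theta]
  set ζ := expBipolar re ri ε x
  have hz : 0 < ‖ζ‖ := by linarith
  have h0 : ζ ≠ 0 := norm_pos_iff.1 hz
  rw [Real.cosh_log hz, Complex.cos_arg h0]
  have e : ‖1 + ζ‖ ^ 2 = 1 + ‖ζ‖ ^ 2 + 2 * ζ.re := by
    rw [← Complex.normSq_eq_norm_sq, ← Complex.normSq_eq_norm_sq, Complex.normSq_apply,
      Complex.normSq_apply]
    simp only [Complex.add_re, Complex.add_im, Complex.one_re, Complex.one_im]
    ring
  rw [e]
  field_simp
  ring

theorem exp_xi_theta (H : Admissible re ri ε) (hx : x ∈ Om re)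
    (hp : x + (shift re ri ε : ℂ) ≠ (alpha re ri ε : ℂ)) :
    Complex.exp ((xi re ri ε x : ℂ) + Complex.I * theta re ri ε x) = expBipolar re ri ε x := by
  have hζ := H.one_le_norm_expBipolar hx hp
  have h0 : expBipolar re ri ε x ≠ 0 := by rw [← norm_pos_iff]; linarith
  rw [Complex.exp_add, xi, ← Complex.ofReal_exp, Real.exp_log (by linarith), theta, mul_comm
    Complex.I, Complex.norm_mul_exp_arg_mul_I]

theorem exp_two_mul_xii (H : Admissible re ri ε) :
    Complex.exp (((2 * xii re ri ε : ℝ)) : ℂ) = levelI re ri ε := by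
  rw [H.two_mul_xii, ← Complex.ofReal_exp, Real.exp_log (by linarith [H.one_lt_levelI])]

end Admissible

/-- z/(1+z)² is invariant under z ↦ 1/z, and w e^{-t} is the reciprocal of s ζ e^t; hence the
integrand of `P` is the kernel on the outgoing ray. -/
theorem weight_mul_P {ζ w : ℂ} {s β : ℝ} (hζ : 1 ≤ ‖ζ‖) (hζ1 : 1 + ζ ≠ 0) (hs : 1 ≤ s)
    (hw : w * (s * ζ) = 1) :
    ((‖1 + ζ‖ ^ 2 / ‖ζ‖ : ℝ) : ℂ) * P w β = rayIntegral ζ s β := by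
  rw [P, rayIntegral, ← integral_const_mul]
  refine setIntegral_congr_fun measurableSet_Ioi fun t ht => ?_
  have hne := one_add_mul_ne_zero hζ hζ1 (one_le_mul_exp hs (le_of_lt ht))
  have he : (Real.exp t : ℂ) ≠ 0 := Complex.ofReal_ne_zero.2 (Real.exp_pos t).ne'
  have e1 : (Real.exp (-t) : ℂ) = (Real.exp t : ℂ)⁻¹ := by rw [Real.exp_neg]; push_cast; rfl
  have e2 : (Real.exp (-(β + 1) * t) : ℂ) = (Real.exp (-(β * t)) : ℂ) * (Real.exp t : ℂ)⁻¹ := by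
    rw [← e1, ← Complex.ofReal_mul, ← Real.exp_add]; congr 2; ring
  have hw0 : w ≠ 0 := left_ne_zero_of_mul_eq_one hw
  have hv : (s : ℂ) * ζ = w⁻¹ := eq_inv_of_mul_eq_one_right hw
  push_cast at hne
  have e4 : 1 + (s : ℂ) * (Real.exp t : ℂ) * ζ = w⁻¹ * (Real.exp t : ℂ) *
      (1 + w * (Real.exp t : ℂ)⁻¹) := by
    rw [mul_right_comm, hv]; field_simp; ring
  have hne' : 1 + w * (Real.exp t : ℂ)⁻¹ ≠ 0 := by
    intro h
    apply hne
    rw [← Complex.ofReal_exp, e4, h, mul_zero]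
  simp only [rayKernel]
  rw [e2, e1, Complex.ofReal_mul, e4, mul_right_comm (s : ℂ), hv]
  generalize (Real.exp t : ℂ) = E at *
  generalize (Real.exp (-(β * t)) : ℂ) = E' at *
  have : w⁻¹ * E / (w⁻¹ * E * (1 + w * E⁻¹)) ^ 2 = w * E⁻¹ / (1 + w * E⁻¹) ^ 2 := by
    rw [div_eq_div_iff (pow_ne_zero 2 (mul_ne_zero (mul_ne_zero (inv_ne_zero hw0) he) hne'))
      (pow_ne_zero 2 hne')]
    field_simp
  rw [this]
  ring

/-! ### Uniform bounds for the image sums -/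

/-- The quotient `r_* / (4 √ε)`. -/
noncomputable def kappa (re ri ε : ℝ) : ℝ := rStar re ri / (4 * √ε)

/-- Weights attached to the points `s qⁿ ζ` that are close to `c` when these are close to `1`. -/
structure RayWeight (re ri ε : ℝ) (c : ℂ) (B L : ℝ) (ζ : ℂ) (s : ℝ) (A : ℕ → ℂ) : Prop where
  one_le_norm : 1 ≤ ‖ζ‖
  ne_zero : 1 + ζ ≠ 0
  level : levelE re ri ε ≤ ‖ζ‖ ^ 2
  one_le : 1 ≤ s
  le_ratio : s ≤ ratio re ri ε
  bound : ∀ n, ‖A n‖ ≤ B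
  approx : ∀ n, ‖A n - c‖ ≤ L * (shift re ri ε + alpha re ri ε *
    (‖1 - ((s * ratio re ri ε ^ n : ℝ) : ℂ) * ζ‖ /
      ‖1 + ((s * ratio re ri ε ^ n : ℝ) : ℂ) * ζ‖))

/-- The weighted sum of the kernel over the images. -/
noncomputable def raySum (re ri ε τ : ℝ) (ζ : ℂ) (s : ℝ) (A : ℕ → ℂ) : ℂ :=
  ∑' n : ℕ, (-τ : ℂ) ^ n * A n * rayKernel ζ (s * ratio re ri ε ^ n)

section Bounds

variable {re ri ε τ B L C : ℝ} {c ζ : ℂ} {s : ℝ} {A : ℕ → ℂ}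

theorem norm_neg_pow_mul_le (hτ : |τ| ≤ 1) (n : ℕ) (z : ℂ) : ‖(-τ : ℂ) ^ n * z‖ ≤ ‖z‖ := by
  rw [norm_mul]
  exact mul_le_of_le_one_left (norm_nonneg _) (norm_neg_pow_le_one hτ n)

theorem RayWeight.bound_nonneg (D : RayWeight re ri ε c B L ζ s A) : 0 ≤ B :=
  (norm_nonneg _).trans (D.bound 0)

theorem GeometryBound.le_ratio_sub_one (hG : GeometryBound re ri C) (H : Admissible re ri ε) :
    √ε ≤ C * (ratio re ri ε - 1) := by
  have h2 := Real.log_le_sub_one_of_pos H.ratio_pos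
  exact (hG.2 ε H).2.1.trans (mul_le_mul_of_nonneg_left h2 (by linarith [hG.1]))

/-- The crude estimate, without cancellation: the kernel decays like q⁻ⁿ, so the sum is O(1/(q - 1))
= O(1/√ε). It settles every range in which ε is bounded below. -/
theorem RayWeight.norm_raySum_le_div (D : RayWeight re ri ε c B L ζ s A)
    (hG : GeometryBound re ri C) (H : Admissible re ri ε) (hτ : |τ| ≤ 1) :
    ‖raySum re ri ε τ ζ s A‖ ≤ B * (8 * C ^ 2) / √ε := by
  have hC := hG.1
  have hB := D.bound_nonneg
  have hη := H.sqrt_eps_pos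
  have hq := H.one_lt_ratio
  refine (norm_tsum_rayKernel_weight_le (B := B)
    (fun n => (norm_neg_pow_mul_le hτ n _).trans (D.bound n))
    D.one_le_norm D.ne_zero D.one_le H.one_lt_ratio).trans ?_
  rw [mul_div_assoc B]
  refine mul_le_mul_of_nonneg_left ?_ hB
  rw [div_le_div_iff₀ (by linarith) hη]
  calc 8 * ratio re ri ε * √ε ≤ 8 * C * (C * (ratio re ri ε - 1)) := by
        have h1 := (hG.2 ε H).1
        have h2 := hG.le_ratio_sub_one H
        gcongr
    _ = _ := by ring

theorem RayWeight.summable (D : RayWeight re ri ε c B L ζ s A) (H : Admissible re ri ε)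
    (hτ : |τ| ≤ 1) :
    Summable fun n : ℕ => (-τ : ℂ) ^ n * A n * rayKernel ζ (s * ratio re ri ε ^ n) :=
  summable_rayKernel_weight (B := B) (fun n => (norm_neg_pow_mul_le hτ n _).trans (D.bound n))
    D.one_le_norm D.ne_zero D.one_le H.one_lt_ratio

/-- The weights differ from `c` by the translation plus α |1 - v|/|1 + v|, and the sum of |K| |1 -
v|/|1 + v| is O(1/(q - 1)) by bounded variation. As α and the translation are O(q - 1), the error is
bounded. -/
theorem RayWeight.norm_raySum_sub_le (D : RayWeight re ri ε c B L ζ s A) (hL : 0 ≤ L)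
    (hG : GeometryBound re ri C) (H : Admissible re ri ε) (hε : ε ≤ (re - ri) / 2)
    (hτ : |τ| ≤ 1) :
    ‖raySum re ri ε τ ζ s A - c * ∑' n : ℕ, (-τ : ℂ) ^ n *
      rayKernel ζ (s * ratio re ri ε ^ n)‖ ≤ L * (8 * C + 9 * (C + 1) ^ 3) * C ^ 2 := by
  have hC := hG.1
  have hη := H.sqrt_eps_pos
  have hq := H.one_lt_ratio
  have hα := H.alpha_pos
  obtain ⟨h1, -, h2⟩ := hG.2 ε H
  obtain ⟨h3, -, h4, -⟩ := h2 hε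
  have h5 := H.norm_expBipolar_ratio_ge D.level
  have hs1 : Summable fun n : ℕ => (-τ : ℂ) ^ n * rayKernel ζ (s * ratio re ri ε ^ n) :=
    summable_rayKernel_weight (B := 1) (norm_neg_pow_le_one hτ) D.one_le_norm D.ne_zero D.one_le
      H.one_lt_ratio
  have e : raySum re ri ε τ ζ s A - c * ∑' n : ℕ, (-τ : ℂ) ^ n *
      rayKernel ζ (s * ratio re ri ε ^ n) =
      ∑' n : ℕ, (-τ : ℂ) ^ n * (A n - c) * rayKernel ζ (s * ratio re ri ε ^ n) := by
    rw [← tsum_mul_left, raySum, ← (D.summable H hτ).tsum_sub (hs1.mul_left c)]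
    exact tsum_congr fun n => by ring
  rw [e]
  refine (norm_tsum_rayKernel_error_le (E := L * shift re ri ε) (F := L * alpha re ri ε)
    (K := C + 1) (mul_nonneg hL H.shift_nonneg) (by positivity) D.one_le_norm D.ne_zero D.one_le
    hq (by linarith) ?_ fun n => ?_).trans ?_
  · rw [add_sub_cancel_right]
    exact h4.trans (mul_le_mul_of_nonneg_left h5 (by linarith))
  · refine (norm_neg_pow_mul_le hτ n _).trans ((D.approx n).trans (le_of_eq (by ring)))
  · rw [div_le_iff₀ (by linarith)]
    have h6 := hG.le_ratio_sub_one H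
    have h7 := H.shift_le_alpha
    have h8 := H.shift_nonneg
    have h9 : alpha re ri ε ≤ C ^ 2 * (ratio re ri ε - 1) := by
      calc _ ≤ C * √ε := h3
        _ ≤ C * (C * (ratio re ri ε - 1)) := by gcongr
        _ = _ := by ring
    calc L * shift re ri ε * (8 * ratio re ri ε) + L * alpha re ri ε * (9 * (C + 1) ^ 3)
        ≤ L * alpha re ri ε * (8 * C) + L * alpha re ri ε * (9 * (C + 1) ^ 3) := by gcongr
      _ = L * (8 * C + 9 * (C + 1) ^ 3) * alpha re ri ε := by ring
      _ ≤ L * (8 * C + 9 * (C + 1) ^ 3) * (C ^ 2 * (ratio re ri ε - 1)) := by gcongr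
      _ = _ := by ring

/-- Away from `τ = -1` the image sums are bounded, uniformly in `ε`. -/
theorem RayWeight.norm_raySum_le (D : RayWeight re ri ε c B L ζ s A) (hL : 0 ≤ L)
    (hG : GeometryBound re ri C) (H : Admissible re ri ε) {ρ : ℝ} (hρ0 : 0 ≤ ρ) (hρ : ρ < 1)
    (hτρ : -ρ ≤ τ) (hτ : τ ≤ 1) : ‖raySum re ri ε τ ζ s A‖ ≤
      B * (8 * C ^ 2) / √((re - ri) / 2) + 8 * B / (1 - ρ) +
        (L * (8 * C + 9 * (C + 1) ^ 3) * C ^ 2 + 17 * ‖c‖) := by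
  have hC := hG.1
  have hB := D.bound_nonneg
  have hd : 0 < (re - ri) / 2 := by linarith [H.ri_lt]
  have hd' := Real.sqrt_pos.2 hd
  have hτ1 : |τ| ≤ 1 := abs_le.2 ⟨by linarith, hτ⟩
  have t1 : 0 ≤ B * (8 * C ^ 2) / √((re - ri) / 2) := by positivity
  have t2 : 0 ≤ 8 * B / (1 - ρ) := div_nonneg (by positivity) (by linarith)
  have t3 : 0 ≤ L * (8 * C + 9 * (C + 1) ^ 3) * C ^ 2 := by positivity
  have t4 : 0 ≤ 17 * ‖c‖ := by positivity
  -- Three regimes: for small ε, an alternating sum when τ ≥ 0 and a geometric one when τ ≤ 0; for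
  -- large ε, the crude estimate.
  rcases le_total ε ((re - ri) / 2) with hε | hε
  · rcases le_total 0 τ with h0 | h0
    · have h1 := D.norm_raySum_sub_le hL hG H hε hτ1
      have h2 := norm_tsum_rayKernel_alternating_le h0 hτ D.one_le_norm D.ne_zero D.one_le
        H.one_lt_ratio
      have h3 := norm_le_norm_sub_add (raySum re ri ε τ ζ s A) (c * ∑' n : ℕ, (-τ : ℂ) ^ n *
        rayKernel ζ (s * ratio re ri ε ^ n))
      rw [norm_mul c] at h3
      have h4 := mul_le_mul_of_nonneg_left h2 (norm_nonneg c)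
      linarith
    · have h1 : ‖raySum re ri ε τ ζ s A‖ ≤ 8 * B / (1 - ρ) := by
        refine norm_tsum_rayKernel_geometric_le hρ0 hρ (fun n => ?_) D.one_le_norm D.ne_zero
          D.one_le H.one_lt_ratio
        rw [norm_mul, norm_pow, norm_neg, Complex.norm_real, Real.norm_eq_abs, abs_of_nonpos h0,
          mul_comm]
        refine mul_le_mul (D.bound n) (pow_le_pow_left₀ (by linarith) (by linarith) n)
          (pow_nonneg (by linarith) n) hB
      linarith
  · have h1 := D.norm_raySum_le_div hG H hτ1
    have h2 : B * (8 * C ^ 2) / √ε ≤ B * (8 * C ^ 2) / √((re - ri) / 2) := by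
      gcongr
    linarith

theorem kappa_nonneg : 0 ≤ kappa re ri ε :=
  div_nonneg (Real.sqrt_nonneg _) (mul_nonneg (by norm_num) (Real.sqrt_nonneg _))

theorem kappa_le (hd : 0 < re - ri) (hε : (re - ri) / 2 ≤ ε) :
    kappa re ri ε ≤ kappa re ri ((re - ri) / 2) := by
  have hd' : 0 < √((re - ri) / 2) := Real.sqrt_pos.2 (by linarith)
  have : 0 ≤ rStar re ri := Real.sqrt_nonneg _
  rw [kappa, kappa]
  gcongr

/-- The image sums as Laplace transforms. -/
theorem RayWeight.norm_raySum_sub_rayIntegral_le (D : RayWeight re ri ε c B L ζ s A)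
    (hL : 0 ≤ L) (hG : GeometryBound re ri C) (H : Admissible re ri ε) (hτ0 : τ < 0)
    (hτ : -1 < τ) :
    ‖raySum re ri ε τ ζ s A - kappa re ri ε * c *
      rayIntegral ζ 1 (kappa re ri ε * -Real.log |τ|)‖ ≤
      B * (8 * C ^ 2) / √((re - ri) / 2) + kappa re ri ((re - ri) / 2) * (8 * ‖c‖) +
        (L * (8 * C + 9 * (C + 1) ^ 3) * C ^ 2 + ‖c‖ * (17 + 8 * C)) := by
  have hC := hG.1
  have hB := D.bound_nonneg
  have hrl := H.ri_lt
  have hd : 0 < (re - ri) / 2 := by linarith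
  have hd' := Real.sqrt_pos.2 hd
  have hτ1 : |τ| ≤ 1 := abs_le.2 ⟨by linarith, by linarith⟩
  have hρ : 0 < |τ| := abs_pos.2 hτ0.ne
  have hl : 0 ≤ -Real.log |τ| := neg_nonneg.2 (Real.log_nonpos hρ.le hτ1)
  have hκ : 0 ≤ kappa re ri ε := kappa_nonneg
  have t1 : 0 ≤ B * (8 * C ^ 2) / √((re - ri) / 2) := by positivity
  have t2 : 0 ≤ kappa re ri ((re - ri) / 2) * (8 * ‖c‖) := mul_nonneg kappa_nonneg (by positivity)
  have t3 : 0 ≤ L * (8 * C + 9 * (C + 1) ^ 3) * C ^ 2 := by positivity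
  have t4 : 0 ≤ ‖c‖ * (17 + 8 * C) := by positivity
  rcases le_total ε ((re - ri) / 2) with hε | hε
  · have h1 := D.norm_raySum_sub_le hL hG H hε hτ1
    obtain ⟨-, -, h2⟩ := hG.2 ε H
    obtain ⟨-, -, -, h4⟩ := h2 hε
    have hh := Real.log_pos H.one_lt_ratio
    have hexp : Real.exp (Real.log (ratio re ri ε)) = ratio re ri ε := Real.exp_log H.ratio_pos
    set h := Real.log (ratio re ri ε) with hh_def
    -- The exponent is chosen with e^{-βh} = |τ| = -τ, so the weights of the Riemann sum are exactly
    -- (-τ)ⁿ.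
    have h5 := norm_tsum_sub_rayIntegral_le (β := 1 / h * -Real.log |τ|) hh D.one_le_norm
      D.ne_zero D.one_le (by rw [hexp]; exact D.le_ratio) (by positivity)
    have e1 : Real.exp (-(1 / h * -Real.log |τ| * h)) = -τ := by
      rw [show -(1 / h * -Real.log |τ| * h) = Real.log |τ| by field_simp, Real.exp_log hρ,
        abs_of_neg hτ0]
    rw [hexp, e1, Complex.ofReal_neg] at h5
    set S := ∑' n : ℕ, (-τ : ℂ) ^ n * rayKernel ζ (s * ratio re ri ε ^ n)
    have h6 := norm_rayIntegral_sub_le (κ := kappa re ri ε) (κ' := 1 / h) hκ (by positivity) hl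
      D.one_le_norm D.ne_zero le_rfl
    set J := rayIntegral ζ 1 (1 / h * -Real.log |τ|)
    set J' := rayIntegral ζ 1 (kappa re ri ε * -Real.log |τ|)
    have hhc : (h : ℂ) ≠ 0 := Complex.ofReal_ne_zero.2 hh.ne'
    have h7 : ‖S - ((1 / h : ℝ) : ℂ) * J‖ ≤ 17 := by
      have e2 : (h : ℂ) * S - J = h * (S - ((1 / h : ℝ) : ℂ) * J) := by
        push_cast; field_simp
      rw [e2, norm_mul, Complex.norm_real, Real.norm_of_nonneg hh.le] at h5
      exact le_of_mul_le_mul_left (by linarith) hh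
    have h8 : 8 * |1 / h - kappa re ri ε| ≤ 8 * C := by rw [kappa]; linarith
    -- Three errors: freezing the weights at `c`, passing from the sum to the integral, and
    -- replacing 1/h by κ.
    have e3 : raySum re ri ε τ ζ s A - kappa re ri ε * c * J' =
        (raySum re ri ε τ ζ s A - c * S) + c * ((S - ((1 / h : ℝ) : ℂ) * J) +
          (((1 / h : ℝ) : ℂ) * J - kappa re ri ε * J')) := by ring
    rw [e3]
    have h9 : ‖c * ((S - ((1 / h : ℝ) : ℂ) * J) +
        (((1 / h : ℝ) : ℂ) * J - kappa re ri ε * J'))‖ ≤ ‖c‖ * (17 + 8 * C) := by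
      rw [norm_mul]
      refine mul_le_mul_of_nonneg_left ((norm_add_le _ _).trans ?_) (norm_nonneg c)
      linarith
    linarith [norm_add_le (raySum re ri ε τ ζ s A - c * S) (c * ((S - ((1 / h : ℝ) : ℂ) * J) +
        (((1 / h : ℝ) : ℂ) * J - kappa re ri ε * J')))]
  · have h1 := D.norm_raySum_le_div hG H hτ1
    have h2 : B * (8 * C ^ 2) / √ε ≤ B * (8 * C ^ 2) / √((re - ri) / 2) := by
      gcongr
    have h3 : ‖(kappa re ri ε : ℂ) * c * rayIntegral ζ 1 (kappa re ri ε * -Real.log |τ|)‖ ≤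
        kappa re ri ((re - ri) / 2) * (8 * ‖c‖) := by
      rw [norm_mul, norm_mul, Complex.norm_real, Real.norm_of_nonneg hκ, mul_assoc,
        mul_comm ‖c‖]
      have h4 := norm_rayIntegral_le (β := kappa re ri ε * -Real.log |τ|) D.one_le_norm D.ne_zero
        le_rfl (by positivity)
      have h5 : 8 / (kappa re ri ε * -Real.log |τ| + 1) ≤ 8 :=
        div_le_self (by norm_num) (le_add_of_nonneg_left (by positivity))
      have h6 := kappa_le (by linarith : 0 < re - ri) hε
      have : 0 ≤ kappa re ri ((re - ri) / 2) := kappa_nonneg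
      gcongr
      linarith
    linarith [norm_sub_le (raySum re ri ε τ ζ s A)
      (kappa re ri ε * c * rayIntegral ζ 1 (kappa re ri ε * -Real.log |τ|))]

/-- κ is O(1/√ε), and the shift of the ray is at most log `levelI` = O(√ε) for small ε; for large ε
the integrals are bounded and so is κ. -/
theorem kappa_mul_norm_shift_le {β : ℝ} (hG : GeometryBound re ri C) (H : Admissible re ri ε)
    (hζ : 1 ≤ ‖ζ‖) (hζ1 : 1 + ζ ≠ 0) (hs : 1 ≤ s) (hsI : s ≤ levelI re ri ε) (hβ : 0 ≤ β) :
    kappa re ri ε * ‖rayIntegral ζ s β - rayIntegral ζ 1 β‖ ≤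
      9 * C * rStar re ri / 4 + 16 * kappa re ri ((re - ri) / 2) := by
  have hrl := H.ri_lt
  have hC := hG.1
  have hκ : 0 ≤ kappa re ri ε := kappa_nonneg
  have hκ' : 0 ≤ kappa re ri ((re - ri) / 2) := kappa_nonneg
  have hr : 0 ≤ rStar re ri := Real.sqrt_nonneg _
  have t1 : 0 ≤ 9 * C * rStar re ri / 4 := by positivity
  rcases le_total ε ((re - ri) / 2) with hε | hε
  · have h1 := norm_rayIntegral_shift_le hζ hζ1 hs hβ
    have h2 := ((hG.2 ε H).2.2 hε).2.1
    have h3 : Real.log s ≤ Real.log (levelI re ri ε) := Real.log_le_log (by linarith) hsI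
    have hη := H.sqrt_eps_pos
    have h4 : kappa re ri ε * ‖rayIntegral ζ s β - rayIntegral ζ 1 β‖ ≤
        kappa re ri ε * (9 * (C * √ε)) := mul_le_mul_of_nonneg_left (by linarith) hκ
    have h5 : kappa re ri ε * (9 * (C * √ε)) = 9 * C * rStar re ri / 4 := by
      rw [kappa]; field_simp
    linarith
  · have h1 := kappa_le (by linarith : 0 < re - ri) hε
    have h2 : 8 / (β + 1) ≤ 8 := div_le_self (by norm_num) (by linarith)
    have h3 : ‖rayIntegral ζ s β - rayIntegral ζ 1 β‖ ≤ 16 := by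
      linarith [norm_sub_le (rayIntegral ζ s β) (rayIntegral ζ 1 β),
        norm_rayIntegral_le hζ hζ1 hs hβ, norm_rayIntegral_le hζ hζ1 le_rfl hβ]
    have h4 := mul_le_mul h1 h3 (norm_nonneg _) hκ'
    linarith

end Bounds

/-! ### The gradient as a combination of image sums -/

theorem norm_bipolarPoint {a : ℝ} (ha : 0 ≤ a) (ω : ℂ) :
    ‖bipolarPoint a ω‖ = a * (‖1 - ω‖ / ‖1 + ω‖) := by
  rw [bipolarPoint, norm_div, norm_mul, Complex.norm_real, Real.norm_of_nonneg ha, norm_sub_rev,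
    add_comm ω, mul_div_assoc]

section Expansion

variable {re ri ε τ B L : ℝ} {c : ℂ} {Φ : ℂ → ℂ} {x : ℂ}

/-- The point with bipolar coordinate v has modulus α |1 - v|/|1 + v|, so the Lipschitz estimate for
`Φ` at 0 becomes the approximation condition. -/
theorem rayWeight_of_tmap (H : Admissible re ri ε) {ζ : ℂ} {s : ℝ} {y : ℕ → ℂ}
    (hL : 0 ≤ L) (hB : ∀ x ∈ Om re, ‖Φ x‖ ≤ B) (hLip : ∀ x ∈ Om re, ‖Φ x - c‖ ≤ L * ‖x‖)
    (hζ : 1 ≤ ‖ζ‖) (hζ1 : 1 + ζ ≠ 0) (hE : levelE re ri ε ≤ ‖ζ‖ ^ 2) (hs : 1 ≤ s)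
    (hs' : s ≤ ratio re ri ε) (hy : ∀ n, y n ∈ Om re)
    (hyb : ∀ n, y n + shift re ri ε =
      bipolarPoint (alpha re ri ε) (((s * ratio re ri ε ^ n : ℝ) : ℂ) * ζ)) :
    RayWeight re ri ε c B L ζ s (fun n => Φ (y n)) where
  one_le_norm := hζ
  ne_zero := hζ1
  level := hE
  one_le := hs
  le_ratio := hs'
  bound n := hB _ (hy n)
  approx n := by
    refine (hLip _ (hy n)).trans (mul_le_mul_of_nonneg_left ?_ hL)
    have h1 := norm_sub_le (y n + (shift re ri ε : ℂ)) (shift re ri ε)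
    rw [add_sub_cancel_right, hyb n, norm_bipolarPoint H.alpha_pos.le, Complex.norm_real,
      Real.norm_of_nonneg H.shift_nonneg] at h1
    linarith

namespace Admissible

theorem one_add_pow_mul_ne_zero (H : Admissible re ri ε) {ζ : ℂ} (hζ : 1 ≤ ‖ζ‖)
    (hζ1 : 1 + ζ ≠ 0) (n : ℕ) : 1 + ((ratio re ri ε ^ n : ℝ) : ℂ) * ζ ≠ 0 :=
  one_add_mul_ne_zero hζ hζ1 (H.one_le_ratio_pow n)

theorem tmap_add_shift (H : Admissible re ri ε) (hx : x ∈ Om re)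
    (hp : x + (shift re ri ε : ℂ) ≠ (alpha re ri ε : ℂ)) (n : ℕ) :
    tmap re ri ε n x + shift re ri ε = bipolarPoint (alpha re ri ε)
      (((ratio re ri ε ^ n : ℝ) : ℂ) * expBipolar re ri ε x) := by
  have hζ1 := (H.one_add_expBipolar hp).2
  rw [tmap, sub_add_cancel, H.bipolarPoint_expBipolar hp, mob_bipolarPoint H.alpha_pos.ne' hζ1
    (H.one_add_pow_mul_ne_zero (H.one_le_norm_expBipolar hx hp) hζ1 n)]

/-- The derivative of the iterate is Q(1+ζ)²/(1+Qζ)² with Q = qⁿ. Multiplied by the unit vector it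
moves the kernel outwards along the same ray, which reduces the vector problem to a scalar one. -/
theorem tmapDeriv_mul_rayKernel (H : Admissible re ri ε) (hx : x ∈ Om re)
    (hp : x + (shift re ri ε : ℂ) ≠ (alpha re ri ε : ℂ)) (n : ℕ) :
    tmapDeriv re ri ε n x * rayKernel (expBipolar re ri ε x) 1 =
      rayKernel (expBipolar re ri ε x) (ratio re ri ε ^ n) := by
  have hζ := H.one_le_norm_expBipolar hx hp
  have hζ1 := (H.one_add_expBipolar hp).2
  have hq := H.one_add_pow_mul_ne_zero hζ hζ1 n
  rw [tmapDeriv, H.bipolarPoint_expBipolar hp, mobDeriv_bipolarPoint H.alpha_pos.ne' hζ1 hq,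
    rayKernel, rayKernel]
  push_cast at hq ⊢
  rw [one_mul]
  field_simp

/-- The `D`-part of the field. -/
theorem fieldSeriesDeriv_mul_rayKernel (H : Admissible re ri ε) (hx : x ∈ Om re)
    (hp : x + (shift re ri ε : ℂ) ≠ (alpha re ri ε : ℂ)) :
    fieldSeriesDeriv re ri ε τ Φ x * rayKernel (expBipolar re ri ε x) 1 =
      raySum re ri ε τ (expBipolar re ri ε x) 1 (fun n => Φ (tmap re ri ε n x)) := by
  rw [fieldSeriesDeriv, raySum, ← tsum_mul_right]
  refine tsum_congr fun n => ?_
  rw [one_mul, ← H.tmapDeriv_mul_rayKernel hx hp n]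
  ring

theorem rayWeight_incl (H : Admissible re ri ε) (hL : 0 ≤ L) (hB : ∀ x ∈ Om re, ‖Φ x‖ ≤ B)
    (hLip : ∀ x ∈ Om re, ‖Φ x - c‖ ≤ L * ‖x‖) (hx : x ∈ Om re)
    (hp : x + (shift re ri ε : ℂ) ≠ (alpha re ri ε : ℂ)) :
    RayWeight re ri ε c B L (expBipolar re ri ε x) 1 (fun n => Φ (tmap re ri ε n x)) :=
  rayWeight_of_tmap H hL hB hLip (H.one_le_norm_expBipolar hx hp) (H.one_add_expBipolar hp).2
    (H.levelE_lt_norm_sq hx hp).le le_rfl H.one_lt_ratio.le (H.tmap_mem hx) fun n => by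
      rw [H.tmap_add_shift hx hp, one_mul]

theorem fieldSeriesDeriv_tmap_mul_rayKernel (H : Admissible re ri ε) (hx : x ∈ Om re)
    (hp : x + (shift re ri ε : ℂ) ≠ (alpha re ri ε : ℂ)) :
    fieldSeriesDeriv re ri ε τ Φ (tmap re ri ε 1 x) * tmapDeriv re ri ε 1 x *
      rayKernel (expBipolar re ri ε x) 1 =
      raySum re ri ε τ (expBipolar re ri ε x) (ratio re ri ε)
        (fun n => Φ (tmap re ri ε (n + 1) x)) := by
  have hx' := ball_subset_closedBall hx
  rw [fieldSeriesDeriv, raySum, ← tsum_mul_right, ← tsum_mul_right]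
  refine tsum_congr fun n => ?_
  rw [← pow_succ', ← H.tmapDeriv_mul_rayKernel hx hp, ← H.tmapDeriv_mul hx' n, H.tmap_tmap hx']
  ring

theorem rayWeight_shell (H : Admissible re ri ε) (hL : 0 ≤ L) (hB : ∀ x ∈ Om re, ‖Φ x‖ ≤ B)
    (hLip : ∀ x ∈ Om re, ‖Φ x - c‖ ≤ L * ‖x‖) (hx : x ∈ Om re)
    (hp : x + (shift re ri ε : ℂ) ≠ (alpha re ri ε : ℂ)) :
    RayWeight re ri ε c B L (expBipolar re ri ε x) (ratio re ri ε)
      (fun n => Φ (tmap re ri ε (n + 1) x)) :=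
  rayWeight_of_tmap H hL hB hLip (H.one_le_norm_expBipolar hx hp) (H.one_add_expBipolar hp).2
    (H.levelE_lt_norm_sq hx hp).le H.one_lt_ratio.le le_rfl (fun n => H.tmap_mem hx (n + 1))
    fun n => by rw [H.tmap_add_shift hx hp, pow_succ']

/-- The scale of the reflected point relative to `e^{ξ + iθ}`. -/
noncomputable def _root_.CoreShell.reflScale (re ri ε : ℝ) (x : ℂ) : ℝ :=
  levelI re ri ε / ‖expBipolar re ri ε x‖ ^ 2

theorem one_le_reflScale (H : Admissible re ri ε) (hxO : x ∈ Om re) (hx : x ∉ Incl ri ε) :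
    1 ≤ reflScale re ri ε x := by
  have h1 := H.one_le_norm_expBipolar hxO (H.ne_pole_of_not_mem hx)
  rw [reflScale, one_le_div (by positivity)]
  exact H.norm_sq_le_levelI hx

theorem reflScale_le_ratio (H : Admissible re ri ε) (hxO : x ∈ Om re) (hx : x ∉ Incl ri ε) :
    reflScale re ri ε x ≤ ratio re ri ε := by
  have h1 := H.levelE_lt_norm_sq hxO (H.ne_pole_of_not_mem hx)
  have h2 := H.one_lt_levelE
  have h3 := H.one_lt_levelI
  rw [reflScale, ratio]
  gcongr

/-- Inversion in ∂D preserves θ and sends ξ to 2ξᵢ - ξ, so the reflected point is on the ray of `x`.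
-/
theorem reflScale_mul (H : Admissible re ri ε) (hxO : x ∈ Om re) (hx : x ∉ Incl ri ε) :
    (reflScale re ri ε x : ℂ) * expBipolar re ri ε x =
      conj ((levelI re ri ε : ℂ) / expBipolar re ri ε x) := by
  have h1 := H.one_le_norm_expBipolar hxO (H.ne_pole_of_not_mem hx)
  have h0 : expBipolar re ri ε x ≠ 0 := by rw [← norm_pos_iff]; linarith
  have h0' : conj (expBipolar re ri ε x) ≠ 0 := (map_ne_zero _).2 h0
  have h2 : (‖expBipolar re ri ε x‖ : ℂ) ^ 2 =
      expBipolar re ri ε x * conj (expBipolar re ri ε x) := by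
    rw [Complex.mul_conj, Complex.normSq_eq_norm_sq]; push_cast; rfl
  rw [reflScale, map_div₀, Complex.conj_ofReal]
  push_cast
  rw [h2]
  field_simp

theorem expBipolar_add_levelI_ne_zero (H : Admissible re ri ε) (hxO : x ∈ Om re)
    (hx : x ∉ Incl ri ε) : expBipolar re ri ε x + levelI re ri ε ≠ 0 := by
  have hp := H.ne_pole_of_not_mem hx
  have hζ := H.one_le_norm_expBipolar hxO hp
  have h0 : expBipolar re ri ε x ≠ 0 := by rw [← norm_pos_iff]; linarith
  have h1 := one_add_mul_ne_zero hζ (H.one_add_expBipolar hp).2 (H.one_le_reflScale hxO hx)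
  rw [H.reflScale_mul hxO hx] at h1
  intro h
  apply h1
  rw [show (levelI re ri ε : ℂ) = -expBipolar re ri ε x by linear_combination h, neg_div,
    div_self h0]
  simp

theorem conj_reflConj_add_shift (H : Admissible re ri ε) (hxO : x ∈ Om re)
    (hx : x ∉ Incl ri ε) : conj (reflConj (ri + ε) ri x) + shift re ri ε =
      bipolarPoint (alpha re ri ε) (reflScale re ri ε x * expBipolar re ri ε x) := by
  have hp := H.ne_pole_of_not_mem hx
  have hζ := H.one_le_norm_expBipolar hxO hp
  have hζ1 := (H.one_add_expBipolar hp).2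
  have h0 : expBipolar re ri ε x ≠ 0 := by rw [← norm_pos_iff]; linarith
  have hadd := H.expBipolar_add_levelI_ne_zero hxO hx
  have ha : (alpha re ri ε : ℂ) ≠ 0 := Complex.ofReal_ne_zero.2 H.alpha_pos.ne'
  have e : mob (alpha re ri ε) (levelI re ri ε) (-(x + shift re ri ε)) =
      bipolarPoint (alpha re ri ε) (levelI re ri ε / expBipolar re ri ε x) := by
    rw [H.bipolarPoint_expBipolar hp]
    generalize expBipolar re ri ε x = ζ at *
    rw [add_comm] at hζ1
    have e1 : ((levelI re ri ε : ℂ) + 1) * alpha re ri ε +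
        (levelI re ri ε - 1) * (-(alpha re ri ε * (ζ - 1) / (ζ + 1))) =
        2 * alpha re ri ε * (ζ + levelI re ri ε) / (ζ + 1) := by
      field_simp; ring
    have e2 : (levelI re ri ε : ℂ) / ζ + 1 = (ζ + levelI re ri ε) / ζ := by
      field_simp; ring
    rw [mob, bipolarPoint, e1, bipolarPoint, e2]
    field_simp
    ring
  have h1 := congrArg conj (H.reflConj_incl (H.sub_center_ne_zero hx))
  rw [e, map_add, Complex.conj_ofReal] at h1
  rw [h1, H.reflScale_mul hxO hx]
  simp [bipolarPoint]

theorem conj_reflConj_deriv (H : Admissible re ri ε) (hxO : x ∈ Om re) (hx : x ∉ Incl ri ε) :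
    -((ri : ℂ) ^ 2) / (x - ((ri + ε : ℝ) : ℂ)) ^ 2 =
      -(levelI re ri ε * (1 + expBipolar re ri ε x) ^ 2) /
        (expBipolar re ri ε x + levelI re ri ε) ^ 2 := by
  have hp := H.ne_pole_of_not_mem hx
  have hζ1 := (H.one_add_expBipolar hp).2
  have hadd := H.expBipolar_add_levelI_ne_zero hxO hx
  have hca : ((ci re ri ε : ℂ) - alpha re ri ε) ≠ 0 := by
    rw [← Complex.ofReal_sub]
    exact Complex.ofReal_ne_zero.2 (by linarith [H.alpha_lt_ci])
  have e1 : x - ((ri + ε : ℝ) : ℂ) = (x + shift re ri ε) - ci re ri ε := by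
    rw [shift, ce]; push_cast; ring
  have hlev : (levelI re ri ε : ℂ) * (ci re ri ε - alpha re ri ε) =
      ci re ri ε + alpha re ri ε := by
    rw [levelI]; push_cast; field_simp
  have hri : (ri : ℂ) ^ 2 = levelI re ri ε * (ci re ri ε - alpha re ri ε) ^ 2 := by
    rw [sq (_ - _), ← mul_assoc, hlev, ← Complex.ofReal_pow, H.ri_sq]; push_cast; ring
  have e2 : (x + shift re ri ε) - (ci re ri ε : ℂ) = -((ci re ri ε - alpha re ri ε) *
      (expBipolar re ri ε x + levelI re ri ε)) / (1 + expBipolar re ri ε x) := by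
    rw [H.bipolarPoint_expBipolar hp, bipolarPoint, mul_add, mul_comm _ (levelI re ri ε : ℂ), hlev]
    have : expBipolar re ri ε x + 1 ≠ 0 := by rwa [add_comm]
    field_simp
    ring
  rw [e1, e2, hri]
  field_simp

/-- The conjugate reflects the antiholomorphy of the inversion, and the minus sign the reversal of
e_ξ. This sign produces the cancellation in the shell. -/
theorem reflected_mul_rayKernel (H : Admissible re ri ε) (hxO : x ∈ Om re)
    (hx : x ∉ Incl ri ε) :
    conj (fieldSeriesDeriv re ri ε τ Φ (conj (reflConj (ri + ε) ri x))) *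
      (-((ri : ℂ) ^ 2) / (x - ((ri + ε : ℝ) : ℂ)) ^ 2) * rayKernel (expBipolar re ri ε x) 1 =
      -conj (raySum re ri ε τ (expBipolar re ri ε x) (reflScale re ri ε x)
        (fun n => Φ (tmap re ri ε n (conj (reflConj (ri + ε) ri x))))) := by
  have hp := H.ne_pole_of_not_mem hx
  have hζ := H.one_le_norm_expBipolar hxO hp
  have hζ1 := (H.one_add_expBipolar hp).2
  have h0 : expBipolar re ri ε x ≠ 0 := by rw [← norm_pos_iff]; linarith
  have hadd := H.expBipolar_add_levelI_ne_zero hxO hx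
  have hs1 := H.one_le_reflScale hxO hx
  have hs := H.reflScale_mul hxO hx
  have hω := one_add_mul_ne_zero hζ hζ1 hs1
  rw [fieldSeriesDeriv, raySum, Complex.conj_tsum, Complex.conj_tsum, ← tsum_mul_right,
    ← tsum_mul_right, ← tsum_neg]
  refine tsum_congr fun n => ?_
  have hqω : 1 + ((ratio re ri ε ^ n : ℝ) : ℂ) *
      (reflScale re ri ε x * expBipolar re ri ε x) ≠ 0 := by
    have := one_add_mul_ne_zero hζ hζ1 (one_le_mul_pow hs1 H.one_lt_ratio n)
    push_cast at this ⊢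
    rwa [mul_left_comm, ← mul_assoc]
  have e1 : conj (tmapDeriv re ri ε n (conj (reflConj (ri + ε) ri x))) =
      (ratio re ri ε ^ n : ℝ) * (1 + levelI re ri ε / expBipolar re ri ε x) ^ 2 /
        (1 + (ratio re ri ε ^ n : ℝ) * (levelI re ri ε / expBipolar re ri ε x)) ^ 2 := by
    rw [tmapDeriv, H.conj_reflConj_add_shift hxO hx, mobDeriv_bipolarPoint H.alpha_pos.ne' hω hqω,
      hs]
    simp
  have e2 : conj (rayKernel (expBipolar re ri ε x) (reflScale re ri ε x * ratio re ri ε ^ n)) =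
      ((‖1 + expBipolar re ri ε x‖ ^ 2 / ‖expBipolar re ri ε x‖ : ℝ) : ℂ) *
        ((ratio re ri ε ^ n : ℝ) * (levelI re ri ε / expBipolar re ri ε x) /
          (1 + (ratio re ri ε ^ n : ℝ) * (levelI re ri ε / expBipolar re ri ε x)) ^ 2) := by
    have e3 : ((reflScale re ri ε x * ratio re ri ε ^ n : ℝ) : ℂ) * expBipolar re ri ε x =
        (ratio re ri ε ^ n : ℝ) * conj (levelI re ri ε / expBipolar re ri ε x) := by
      rw [← hs]; push_cast; ring
    rw [rayKernel, e3]
    simp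
  have hqω' : 1 + ((ratio re ri ε ^ n : ℝ) : ℂ) *
      ((levelI re ri ε : ℂ) / expBipolar re ri ε x) ≠ 0 := by
    intro h
    apply hqω
    rw [hs, ← Complex.conj_ofReal (ratio re ri ε ^ n), ← map_mul, ← map_one (starRingEnd ℂ),
      ← map_add, h, map_zero]
  rw [map_mul, map_mul, map_mul, map_mul, e1, e2, H.conj_reflConj_deriv hxO hx, rayKernel,
    Complex.ofReal_one, one_mul]
  generalize (‖1 + expBipolar re ri ε x‖ ^ 2 / ‖expBipolar re ri ε x‖ : ℝ) = N at *
  generalize expBipolar re ri ε x = ζ at *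
  generalize (ratio re ri ε ^ n : ℝ) = Q at *
  generalize (levelI re ri ε : ℂ) = l at *
  have e5 : 1 + l / ζ = (ζ + l) / ζ := by field_simp
  rw [e5]
  generalize 1 + (Q : ℂ) * (l / ζ) = W at *
  generalize 1 + ζ = Z at *
  generalize hV : ζ + l = V at *
  field_simp

theorem rayWeight_reflected (H : Admissible re ri ε) (hL : 0 ≤ L)
    (hB : ∀ x ∈ Om re, ‖Φ x‖ ≤ B) (hLip : ∀ x ∈ Om re, ‖Φ x - c‖ ≤ L * ‖x‖) (hxO : x ∈ Om re)
    (hx : x ∉ Incl ri ε) :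
    RayWeight re ri ε c B L (expBipolar re ri ε x) (reflScale re ri ε x)
      (fun n => Φ (tmap re ri ε n (conj (reflConj (ri + ε) ri x)))) := by
  have hp := H.ne_pole_of_not_mem hx
  have hζ := H.one_le_norm_expBipolar hxO hp
  have hζ1 := (H.one_add_expBipolar hp).2
  have hs1 := H.one_le_reflScale hxO hx
  refine rayWeight_of_tmap H hL hB hLip hζ hζ1 (H.levelE_lt_norm_sq hxO hp).le hs1
    (H.reflScale_le_ratio hxO hx) (H.tmap_mem (conj_reflConj_mem H hx)) fun n => ?_
  have e : ((reflScale re ri ε x * ratio re ri ε ^ n : ℝ) : ℂ) * expBipolar re ri ε x =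
      ((ratio re ri ε ^ n : ℝ) : ℂ) * (reflScale re ri ε x * expBipolar re ri ε x) := by
    push_cast; ring
  have h1 := one_add_mul_ne_zero hζ hζ1 (one_le_mul_pow hs1 H.one_lt_ratio n)
  rw [e] at h1
  rw [tmap, sub_add_cancel, H.conj_reflConj_add_shift hxO hx, mob_bipolarPoint H.alpha_pos.ne'
    (one_add_mul_ne_zero hζ hζ1 hs1) h1, e]

theorem shellDeriv_mul_rayKernel (H : Admissible re ri ε) (hxO : x ∈ Om re) (hx : x ∉ Incl ri ε) :
    shellDeriv re ri ε τ Φ x * rayKernel (expBipolar re ri ε x) 1 =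
      Φ x * rayKernel (expBipolar re ri ε x) 1 -
      τ * raySum re ri ε τ (expBipolar re ri ε x) (ratio re ri ε)
        (fun n => Φ (tmap re ri ε (n + 1) x)) +
      τ * conj (raySum re ri ε τ (expBipolar re ri ε x) (reflScale re ri ε x)
        (fun n => Φ (tmap re ri ε n (conj (reflConj (ri + ε) ri x))))) := by
  have h := H.reflected_mul_rayKernel (τ := τ) (Φ := Φ) hxO hx
  rw [← H.fieldSeriesDeriv_tmap_mul_rayKernel hxO (H.ne_pole_of_not_mem hx), shellDeriv]
  linear_combination (-τ : ℂ) * h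

end Admissible

end Expansion

/-! ### The gradient of the solution -/

theorem abs_tau_lt_one {k : ℝ} (hk : 0 < k) : |tau k| < 1 := by
  rw [tau, abs_div, abs_of_pos (by linarith : 0 < k + 1), div_lt_one (by linarith), abs_lt]
  constructor <;> linarith

theorem tau_neg {k : ℝ} (hk : 0 < k) (hk1 : k < 1) : tau k < 0 :=
  div_neg_of_neg_of_pos (by linarith) (by linarith)

theorem tau_mono {k k₀ : ℝ} (hk₀ : 0 < k₀) (h : k₀ ≤ k) : tau k₀ ≤ tau k := by
  rw [tau, tau, div_le_div_iff₀ (by linarith) (by linarith)]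
  linarith

/-- The gradient of any solution, in terms of the image sums. -/
theorem IsSolution.gradient_eq_conj {re ri ε k δ B : ℝ} {g u : ℂ → ℝ} (H : Admissible re ri ε)
    (hk : 0 < k) (hg : IsC1Holder re δ g) (hg0 : IsMeanZero re g)
    (hB : ∀ x ∈ Om re, ‖cauchyField re g x‖ ≤ B) (hu : IsSolution re ri ε k g u) :
    (∀ x ∈ Incl ri ε, gradient u x =
      conj (((1 - tau k : ℝ) : ℂ) * fieldSeriesDeriv re ri ε (tau k) (cauchyField re g) x)) ∧
    (∀ x ∈ Shell re ri ε, gradient u x =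
      conj (shellDeriv re ri ε (tau k) (cauchyField re g) x)) := by
  have hτ := abs_tau_lt_one hk
  have hF : ∀ x ∈ Om re, HasDerivAt (complexField re g) (cauchyField re g x) x :=
    fun x hx => hasDerivAt_complexField hg.1.continuous hx
  obtain ⟨h, hhc, hh⟩ := (exists_bound_of_hasDerivAt H.re_pos hF hB).1
  have hsol := isSolution_imageSolution H hk rfl hτ hF hB hh hhc
    fun x hx => tendsto_re_cauchyField_normal H.re_pos hg hg0 hx
  refine ⟨fun x hx => ?_, fun x hx => ?_⟩
  · rw [hu.gradient_eq H.ri_pos H.eps_pos H.eps_lt hk hsol (Or.inl hx)]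
    exact (hasGradientAt_imageSolution_incl H hτ hF hB hx).gradient
  · rw [hu.gradient_eq H.ri_pos H.eps_pos H.eps_lt hk hsol (Or.inr hx)]
    exact (hasGradientAt_imageSolution_shell H hτ hF hB hh hx).gradient

section Field

variable {re ri ε τ B L C : ℝ} {c : ℂ} {Φ : ℂ → ℂ} {x : ℂ}

theorem mem_Om_of_mem_Incl (H : Admissible re ri ε) (hx : x ∈ Incl ri ε) : x ∈ Om re :=
  closedBall_incl_subset H.eps_pos H.eps_lt (ball_subset_closedBall hx)

/-- A bound on the image sums gives a bound on the field in `D`. -/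
theorem norm_fieldSeriesDeriv_le_of_raySum (H : Admissible re ri ε) (hL : 0 ≤ L)
    (hB : ∀ x ∈ Om re, ‖Φ x‖ ≤ B) (hLip : ∀ x ∈ Om re, ‖Φ x - c‖ ≤ L * ‖x‖) {R : ℝ}
    (hR : ∀ ζ s A, RayWeight re ri ε c B L ζ s A → ‖raySum re ri ε τ ζ s A‖ ≤ R)
    (hcont : ContinuousOn (fieldSeriesDeriv re ri ε τ Φ) (Om re)) (hx : x ∈ Om re) :
    ‖fieldSeriesDeriv re ri ε τ Φ x‖ ≤ R := by
  have hgen : ∀ y ∈ Om re, y + (shift re ri ε : ℂ) ≠ (alpha re ri ε : ℂ) →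
      ‖fieldSeriesDeriv re ri ε τ Φ y‖ ≤ R := fun y hy hp => by
    have h1 := hR _ _ _ (H.rayWeight_incl hL hB hLip hy hp)
    rwa [← H.fieldSeriesDeriv_mul_rayKernel hy hp, norm_mul,
      norm_rayKernel_one (H.one_le_norm_expBipolar hy hp) (H.one_add_expBipolar hp).2,
      mul_one] at h1
  -- At the pole there is no ray; the bound passes to it by continuity.
  by_cases hp : x + (shift re ri ε : ℂ) = (alpha re ri ε : ℂ)
  · have h1 := (hcont.continuousAt (isOpen_ball.mem_nhds hx)).norm.tendsto.mono_left
      (nhdsWithin_le_nhds (s := {x}ᶜ))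
    refine le_of_tendsto h1 ?_
    filter_upwards [self_mem_nhdsWithin, nhdsWithin_le_nhds (isOpen_ball.mem_nhds hx)]
      with y hy hy'
    refine hgen y hy' fun h => hy ?_
    exact add_right_cancel (h.trans hp.symm)
  · exact hgen x hx hp

/-- A bound on the image sums gives a bound on the field in the shell. -/
theorem norm_shellDeriv_le_of_raySum (H : Admissible re ri ε) (hL : 0 ≤ L)
    (hB : ∀ x ∈ Om re, ‖Φ x‖ ≤ B) (hLip : ∀ x ∈ Om re, ‖Φ x - c‖ ≤ L * ‖x‖) {R : ℝ}
    (hR : ∀ ζ s A, RayWeight re ri ε c B L ζ s A → ‖raySum re ri ε τ ζ s A‖ ≤ R)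
    (hτ : |τ| ≤ 1) (hx : x ∈ Om re) (hxI : x ∉ Incl ri ε) :
    ‖shellDeriv re ri ε τ Φ x‖ ≤ B + 2 * R := by
  have hp := H.ne_pole_of_not_mem hxI
  have h1 := hR _ _ _ (H.rayWeight_shell hL hB hLip hx hp)
  have h2 := hR _ _ _ (H.rayWeight_reflected hL hB hLip hx hxI)
  have hn := norm_rayKernel_one (H.one_le_norm_expBipolar hx hp) (H.one_add_expBipolar hp).2
  have h3 := congrArg norm (H.shellDeriv_mul_rayKernel (τ := τ) (Φ := Φ) hx hxI)
  rw [norm_mul, hn, mul_one] at h3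
  rw [h3]
  have hτn : ∀ z : ℂ, ‖(τ : ℂ) * z‖ ≤ ‖z‖ := fun z => by
    rw [norm_mul, Complex.norm_real]
    exact mul_le_of_le_one_left (norm_nonneg _) hτ
  refine (norm_add_le _ _).trans ?_
  have h4 := norm_sub_le (Φ x * rayKernel (expBipolar re ri ε x) 1)
    (τ * raySum re ri ε τ (expBipolar re ri ε x) (ratio re ri ε)
        (fun n => Φ (tmap re ri ε (n + 1) x)))
  rw [norm_mul (Φ x), hn, mul_one] at h4
  have h5 := (hτn (raySum re ri ε τ (expBipolar re ri ε x) (ratio re ri ε)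
        (fun n => Φ (tmap re ri ε (n + 1) x)))).trans h1
  have h6 := (hτn (conj (raySum re ri ε τ (expBipolar re ri ε x) (reflScale re ri ε x)
        (fun n => Φ (tmap re ri ε n (conj (reflConj (ri + ε) ri x))))))).trans
    ((Complex.norm_conj _).le.trans h2)
  linarith [hB x hx]

/-- The bound for the difference between an image sum and its limit form. -/
theorem exists_raySum_bound (hri : 0 < ri) (hre : ri < re) (hL : 0 ≤ L) (c : ℂ) (B : ℝ) :
    ∃ R : ℝ, ∀ ε, Admissible re ri ε → ∀ τ, -1 < τ → τ < 0 → ∀ ζ s A,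
      RayWeight re ri ε c B L ζ s A → ∀ s', 1 ≤ s' → s' ≤ levelI re ri ε →
      ‖raySum re ri ε τ ζ s A - kappa re ri ε * c *
        rayIntegral ζ s' (kappa re ri ε * -Real.log |τ|)‖ ≤ R ∧
      (1 + τ) * (kappa re ri ε * ‖c‖ *
        ‖rayIntegral ζ s' (kappa re ri ε * -Real.log |τ|)‖) ≤ R := by
  obtain ⟨C, hG⟩ := Admissible.exists_geometryBound hri hre
  obtain ⟨R₁, hR₁⟩ : ∃ R₁, R₁ = B * (8 * C ^ 2) / √((re - ri) / 2) +
    kappa re ri ((re - ri) / 2) * (8 * ‖c‖) +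
        (L * (8 * C + 9 * (C + 1) ^ 3) * C ^ 2 + ‖c‖ * (17 + 8 * C)) := ⟨_, rfl⟩
  obtain ⟨R₂, hR₂⟩ : ∃ R₂, R₂ = 9 * C * rStar re ri / 4 + 16 * kappa re ri ((re - ri) / 2) :=
    ⟨_, rfl⟩
  refine ⟨max (R₁ + ‖c‖ * R₂) (8 * ‖c‖), fun ε H τ hτ hτ0 ζ s A D s' hs' hsI => ?_⟩
  have hρ : 0 < |τ| := abs_pos.2 hτ0.ne
  have hτ1 : |τ| ≤ 1 := abs_le.2 ⟨by linarith, by linarith⟩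
  have hl : 0 ≤ -Real.log |τ| := neg_nonneg.2 (Real.log_nonpos hρ.le hτ1)
  have hκ : 0 ≤ kappa re ri ε := kappa_nonneg
  have hβ : 0 ≤ kappa re ri ε * -Real.log |τ| := mul_nonneg hκ hl
  constructor
  · have h1 := D.norm_raySum_sub_rayIntegral_le hL hG H hτ0 hτ
    have h2 := kappa_mul_norm_shift_le hG H D.one_le_norm D.ne_zero hs' hsI hβ
    rw [← hR₁] at h1
    rw [← hR₂] at h2
    refine le_trans ?_ (le_max_left _ _)
    set J := rayIntegral ζ 1 (kappa re ri ε * -Real.log |τ|)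
    set J' := rayIntegral ζ s' (kappa re ri ε * -Real.log |τ|)
    have e : raySum re ri ε τ ζ s A - kappa re ri ε * c * J' =
        (raySum re ri ε τ ζ s A - kappa re ri ε * c * J) - c * (kappa re ri ε * (J' - J)) := by
      ring
    rw [e]
    refine (norm_sub_le _ _).trans (add_le_add h1 ?_)
    rw [norm_mul, norm_mul, Complex.norm_real, Real.norm_of_nonneg hκ]
    exact mul_le_mul_of_nonneg_left h2 (norm_nonneg c)
  · refine le_trans ?_ (le_max_right _ _)
    -- 1 - |τ| ≤ -log|τ|, and κ(-log|τ|) is the exponent β, so the bound 8/(β + 1) of the integral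
    -- compensates the factor κ.
    have h1 : 1 + τ ≤ -Real.log |τ| := by
      have := Real.log_le_sub_one_of_pos hρ
      rw [abs_of_neg hτ0] at this ⊢
      linarith
    have h2 := norm_rayIntegral_le D.one_le_norm D.ne_zero hs' hβ
    set J' := rayIntegral ζ s' (kappa re ri ε * -Real.log |τ|)
    have h3 : kappa re ri ε * -Real.log |τ| * ‖J'‖ ≤ 8 := by
      rw [le_div_iff₀ (by linarith)] at h2
      nlinarith [norm_nonneg J']
    calc (1 + τ) * (kappa re ri ε * ‖c‖ * ‖J'‖)
        ≤ -Real.log |τ| * (kappa re ri ε * ‖c‖ * ‖J'‖) := by gcongr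
      _ = ‖c‖ * (kappa re ri ε * -Real.log |τ| * ‖J'‖) := by ring
      _ ≤ ‖c‖ * 8 := by gcongr
      _ = _ := by ring

theorem beta_eq {k : ℝ} : beta re ri ε k = kappa re ri ε * -Real.log |tau k| := by
  rw [beta, kappa]; ring

/-- The factor `amp` is 2τκ times the weight of the kernel, since r_*/√ε = 4κ and the weight is
2(cosh ξ + cos θ). -/
theorem amp_mul_P {k s : ℝ} {w : ℂ} (H : Admissible re ri ε) (hx : x ∈ Om re)
    (hp : x + (shift re ri ε : ℂ) ≠ (alpha re ri ε : ℂ)) (hs : 1 ≤ s)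
    (hw : w * (s * expBipolar re ri ε x) = 1) :
    (amp re ri ε k x : ℂ) * P w (beta re ri ε k) = 2 * tau k * (kappa re ri ε *
      rayIntegral (expBipolar re ri ε x) s (kappa re ri ε * -Real.log |tau k|)) := by
  rw [← beta_eq, ← weight_mul_P (H.one_le_norm_expBipolar hx hp) (H.one_add_expBipolar hp).2 hs hw,
    ← H.two_mul_cosh_add_cos hx hp, amp, kappa]
  push_cast
  ring

theorem amp_mul_PIncl {k : ℝ} (H : Admissible re ri ε) (hx : x ∈ Om re)
    (hp : x + (shift re ri ε : ℂ) ≠ (alpha re ri ε : ℂ)) :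
    (amp re ri ε k x : ℂ) * PIncl re ri ε k x = 2 * tau k * (kappa re ri ε *
      rayIntegral (expBipolar re ri ε x) (levelI re ri ε)
        (kappa re ri ε * -Real.log |tau k|)) := by
  refine amp_mul_P H hx hp H.one_lt_levelI.le ?_
  rw [← H.exp_two_mul_xii, ← H.exp_xi_theta hx hp, ← Complex.exp_add, ← Complex.exp_add,
    ← Complex.exp_zero]
  congr 1
  push_cast
  ring

theorem amp_mul_PShell {k : ℝ} (H : Admissible re ri ε) (hx : x ∈ Om re) (hxI : x ∉ Incl ri ε) :
    (amp re ri ε k x : ℂ) * PShell re ri ε k x = 2 * tau k * (kappa re ri ε *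
      rayIntegral (expBipolar re ri ε x) (reflScale re ri ε x)
        (kappa re ri ε * -Real.log |tau k|)) := by
  have hp := H.ne_pole_of_not_mem hxI
  refine amp_mul_P H hx hp (H.one_le_reflScale hx hxI) ?_
  have hζ := H.one_le_norm_expBipolar hx hp
  have e : (reflScale re ri ε x : ℂ) =
      Complex.exp (((2 * xii re ri ε : ℝ) : ℂ) - ((2 * xi re ri ε x : ℝ) : ℂ)) := by
    rw [Complex.exp_sub, H.exp_two_mul_xii, reflScale, xi, ← Complex.ofReal_exp, two_mul,
      Real.exp_add, Real.exp_log (by linarith)]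
    push_cast
    rw [sq]
  rw [e, ← H.exp_xi_theta hx hp, ← Complex.exp_add, ← Complex.exp_add, ← Complex.exp_zero]
  congr 1
  push_cast
  ring

theorem abs_re_sub_le_of_norm {a b : ℂ} {R : ℝ} (h : ‖a - b‖ ≤ R) : |a.re - b.re| ≤ R := by
  rw [← Complex.sub_re]; exact (Complex.abs_re_le_norm _).trans h

theorem abs_im_sub_le_of_norm {a b : ℂ} {R : ℝ} (h : ‖a - b‖ ≤ R) : |a.im - b.im| ≤ R := by
  rw [← Complex.sub_im]; exact (Complex.abs_im_le_norm _).trans h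

theorem inner_conj_eXi (H : Admissible re ri ε) (hx : x ∈ Om re)
    (hp : x + (shift re ri ε : ℂ) ≠ (alpha re ri ε : ℂ)) (U : ℂ) :
    inner ℝ (conj U) (eXi re ri ε x) = (U * rayKernel (expBipolar re ri ε x) 1).re := by
  rw [H.eXi_eq hx hp, inner_conj_left]

theorem inner_conj_eTheta (H : Admissible re ri ε) (hx : x ∈ Om re)
    (hp : x + (shift re ri ε : ℂ) ≠ (alpha re ri ε : ℂ)) (U : ℂ) :
    inner ℝ (conj U) (eTheta re ri ε x) = -(U * rayKernel (expBipolar re ri ε x) 1).im := by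
  rw [H.eTheta_eq hx hp, inner_conj_left, mul_left_comm, Complex.I_mul_re]

/-- The combinations of `Re P` and `Im P` in terms of `c = C₁ - i C₂`. -/
theorem re_amp_mul {a : ℝ} (c z : ℂ) :
    (c * ((a : ℂ) * z)).re = a * (c.re * z.re + (-c.im) * z.im) ∧
    (c * ((a : ℂ) * z)).im = a * (c.re * z.im - (-c.im) * z.re) := by
  simp only [Complex.mul_re, Complex.mul_im, Complex.ofReal_re, Complex.ofReal_im]
  constructor <;> ring

/-- The asymptotic formula in `D`. -/
theorem norm_incl_add_le {k R : ℝ} (H : Admissible re ri ε) (hL : 0 ≤ L)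
    (hB : ∀ x ∈ Om re, ‖Φ x‖ ≤ B) (hLip : ∀ x ∈ Om re, ‖Φ x - c‖ ≤ L * ‖x‖) (hk : 0 < k)
    (hk1 : k < 1) (hR : ∀ ζ s A, RayWeight re ri ε c B L ζ s A → ∀ s', 1 ≤ s' →
      s' ≤ levelI re ri ε → ‖raySum re ri ε (tau k) ζ s A - kappa re ri ε * c *
        rayIntegral ζ s' (kappa re ri ε * -Real.log |tau k|)‖ ≤ R ∧
      (1 + tau k) * (kappa re ri ε * ‖c‖ *
        ‖rayIntegral ζ s' (kappa re ri ε * -Real.log |tau k|)‖) ≤ R) (hx : x ∈ Om re)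
    (hp : x + (shift re ri ε : ℂ) ≠ (alpha re ri ε : ℂ)) :
    ‖((1 - tau k : ℝ) : ℂ) * fieldSeriesDeriv re ri ε (tau k) Φ x *
      rayKernel (expBipolar re ri ε x) 1 -
      -(c * ((amp re ri ε k x : ℂ) * PIncl re ri ε k x))‖ ≤ 3 * R := by
  obtain ⟨h1, h2⟩ := hR _ _ _ (H.rayWeight_incl hL hB hLip hx hp) _ H.one_lt_levelI.le le_rfl
  have hτ := abs_lt.1 (abs_tau_lt_one hk)
  rw [mul_assoc, H.fieldSeriesDeriv_mul_rayKernel hx hp, amp_mul_PIncl H hx hp]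
  set J := rayIntegral (expBipolar re ri ε x) (levelI re ri ε)
    (kappa re ri ε * -Real.log |tau k|)
  set W := raySum re ri ε (tau k) (expBipolar re ri ε x) 1 fun n => Φ (tmap re ri ε n x)
  -- The exact coefficient is 1 - τ, the one in the formula is -2τ; the difference 1 + τ is small
  -- enough to offset κ, by the second half of `hR`.
  have e : ((1 - tau k : ℝ) : ℂ) * W - -(c * (2 * tau k * (kappa re ri ε * J))) =
      ((1 - tau k : ℝ) : ℂ) * (W - kappa re ri ε * c * J) +
      ((1 + tau k : ℝ) : ℂ) * (kappa re ri ε * c * J) := by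
    push_cast; ring
  rw [e]
  refine (norm_add_le _ _).trans ?_
  rw [norm_mul, norm_mul _ (_ * c * J), norm_mul _ J, norm_mul, Complex.norm_real,
    Complex.norm_real, Complex.norm_real, Real.norm_of_nonneg (by linarith),
    Real.norm_of_nonneg (by linarith), Real.norm_of_nonneg kappa_nonneg]
  nlinarith [norm_nonneg (W - kappa re ri ε * c * J)]

/-- The asymptotic formula in the shell. -/
theorem norm_shell_sub_le {k R : ℝ} (H : Admissible re ri ε) (hL : 0 ≤ L)
    (hB : ∀ x ∈ Om re, ‖Φ x‖ ≤ B) (hLip : ∀ x ∈ Om re, ‖Φ x - c‖ ≤ L * ‖x‖) (hk : 0 < k)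
    (hR : ∀ ζ s A, RayWeight re ri ε c B L ζ s A → ∀ s', 1 ≤ s' →
      s' ≤ levelI re ri ε → ‖raySum re ri ε (tau k) ζ s A - kappa re ri ε * c *
        rayIntegral ζ s' (kappa re ri ε * -Real.log |tau k|)‖ ≤ R) (hx : x ∈ Om re)
    (hxI : x ∉ Incl ri ε) :
    ‖shellDeriv re ri ε (tau k) Φ x * rayKernel (expBipolar re ri ε x) 1 -
      ((-(c * ((amp re ri ε k x : ℂ) * PShell re ri ε k x)).im : ℝ) : ℂ) * Complex.I‖ ≤
      B + 2 * R := by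
  have hp := H.ne_pole_of_not_mem hxI
  have hτ := (abs_tau_lt_one hk).le
  have hn := norm_rayKernel_one (H.one_le_norm_expBipolar hx hp) (H.one_add_expBipolar hp).2
  have hs := H.one_le_reflScale hx hxI
  have hsI : reflScale re ri ε x ≤ levelI re ri ε :=
    (H.reflScale_le_ratio hx hxI).trans
      (div_le_self (by linarith [H.one_lt_levelI]) H.one_lt_levelE.le)
  have h1 := hR _ _ _ (H.rayWeight_shell hL hB hLip hx hp) _ hs hsI
  have h2 := hR _ _ _ (H.rayWeight_reflected hL hB hLip hx hxI) _ hs hsI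
  rw [H.shellDeriv_mul_rayKernel hx hxI, amp_mul_PShell H hx hxI]
  set J := rayIntegral (expBipolar re ri ε x) (reflScale re ri ε x)
    (kappa re ri ε * -Real.log |tau k|)
  set W := raySum re ri ε (tau k) (expBipolar re ri ε x) (ratio re ri ε)
    fun n => Φ (tmap re ri ε (n + 1) x)
  set V := raySum re ri ε (tau k) (expBipolar re ri ε x) (reflScale re ri ε x)
    fun n => Φ (tmap re ri ε n (conj (reflConj (ri + ε) ri x)))
  set Y : ℂ := kappa re ri ε * c * J with hY
  -- Both image families have the limit form `Y`. Together they give -τ(Y - conj Y), which is purely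
  -- imaginary: no large e_ξ component remains, and the e_θ component receives Im Y twice.
  have e1 : ((-(c * (2 * tau k * (kappa re ri ε * J))).im : ℝ) : ℂ) * Complex.I =
      -(tau k * (Y - conj Y)) := by
    have : c * (2 * tau k * (kappa re ri ε * J)) = ((2 * tau k : ℝ) : ℂ) * Y := by
      rw [hY]; push_cast; ring
    rw [this, Complex.sub_conj, Complex.im_ofReal_mul]
    push_cast
    ring
  have e : Φ x * rayKernel (expBipolar re ri ε x) 1 - tau k * W + tau k * conj V -
      -(tau k * (Y - conj Y)) = Φ x * rayKernel (expBipolar re ri ε x) 1 -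
        tau k * (W - Y) + tau k * conj (V - Y) := by
    rw [map_sub]; ring
  rw [e1, e]
  have hτn : ∀ z : ℂ, ‖(tau k : ℂ) * z‖ ≤ ‖z‖ := fun z => by
    rw [norm_mul, Complex.norm_real]
    exact mul_le_of_le_one_left (norm_nonneg _) hτ
  have h3 := norm_add_le (Φ x * rayKernel (expBipolar re ri ε x) 1 - tau k * (W - Y))
    (tau k * conj (V - Y))
  have h4 := norm_sub_le (Φ x * rayKernel (expBipolar re ri ε x) 1) (tau k * (W - Y))
  rw [norm_mul (Φ x), hn, mul_one] at h4
  have h5 := hτn (W - Y)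
  have h6 := hτn (conj (V - Y))
  rw [Complex.norm_conj] at h6
  linarith [hB x hx]

/-- The gradient is bounded as long as the image sums are. -/
theorem IsSolution.norm_gradient_le {k δ R : ℝ} {g u : ℂ → ℝ} (H : Admissible re ri ε)
    (hk : 0 < k) (hg : IsC1Holder re δ g) (hg0 : IsMeanZero re g) (hL : 0 ≤ L)
    (hB : ∀ x ∈ Om re, ‖cauchyField re g x‖ ≤ B)
    (hLip : ∀ x ∈ Om re, ‖cauchyField re g x - c‖ ≤ L * ‖x‖)
    (hR : ∀ ζ s A, RayWeight re ri ε c B L ζ s A → ‖raySum re ri ε (tau k) ζ s A‖ ≤ R)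
    (hu : IsSolution re ri ε k g u) (hx : x ∈ Incl ri ε ∪ Shell re ri ε) :
    ‖gradient u x‖ ≤ B + 2 * R := by
  have hτ := abs_tau_lt_one hk
  have hF : ∀ x ∈ Om re, HasDerivAt (complexField re g) (cauchyField re g x) x :=
    fun x hx => hasDerivAt_complexField hg.1.continuous hx
  obtain ⟨hi, hs⟩ := hu.gradient_eq_conj H hk hg hg0 hB
  rcases hx with hx | hx
  · have hxO := mem_Om_of_mem_Incl H hx
    have h1 := norm_fieldSeriesDeriv_le_of_raySum H hL hB hLip hR
      (continuousOn_fieldSeriesDeriv H hτ hF hB) hxO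
    have h2 : ‖1 - tau k‖ ≤ 2 := by
      rw [Real.norm_eq_abs, abs_le]
      constructor <;> linarith [(abs_lt.1 hτ).1, (abs_lt.1 hτ).2]
    rw [hi x hx, Complex.norm_conj, norm_mul, Complex.norm_real]
    have h3 := mul_le_mul h2 h1 (norm_nonneg _) (by norm_num)
    linarith [(norm_nonneg _).trans (hB x hxO)]
  · rw [hs x hx, Complex.norm_conj]
    exact norm_shellDeriv_le_of_raySum H hL hB hLip hR hτ.le hx.1 (not_mem_Incl_of_mem_Shell hx)

end Field

end CoreShell

/-! ### Assembly of the two statements. -/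

theorem mainTheorem4 (re ri δ : ℝ) (hri : 0 < ri) (hre : ri < re) (hδ : 1 / 2 < δ)
    (g : ℂ → ℝ) (hg : IsC1Holder re δ g) (hg0 : IsMeanZero re g) :
    -- the gradient can blow up only in the joint limit `ε → 0`, `k → 0`
    (∀ ε₀ k₀ : ℝ, 0 < ε₀ → 0 < k₀ → ∃ C : ℝ,
      ∀ ε k : ℝ, 0 < ε → ε < re - ri → 0 < k → (ε₀ ≤ ε ∨ k₀ ≤ k) →
      ∀ u : ℂ → ℝ, IsSolution re ri ε k g u →
      ∀ x ∈ Incl ri ε ∪ Shell re ri ε, ‖gradient u x‖ ≤ C) ∧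
    -- `C₁` and `C₂` are the partial derivatives of `H` at the origin, a point of `∂Ω`
    ∃ C₁ C₂ : ℝ,
      Tendsto (fun x => gradient (bgField re g) x) (𝓝[Om re] 0)
        (𝓝 ((C₁ : ℂ) + (C₂ : ℂ) * Complex.I)) ∧
      ∃ C : ℝ, ∀ ε k : ℝ, 0 < ε → ε < re - ri → 0 < k → k < 1 →
        ∀ u : ℂ → ℝ, IsSolution re ri ε k g u →
        -- the two components in `D` (away from the pole of the coordinates)
        (∀ x ∈ Incl ri ε, x + (shift re ri ε : ℂ) ≠ (alpha re ri ε : ℂ) →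
          |inner ℝ (gradient u x) (eXi re ri ε x) -
            -(amp re ri ε k x *
              (C₁ * (PIncl re ri ε k x).re + C₂ * (PIncl re ri ε k x).im))| ≤ C ∧
          |inner ℝ (gradient u x) (eTheta re ri ε x) -
            amp re ri ε k x *
              (C₁ * (PIncl re ri ε k x).im - C₂ * (PIncl re ri ε k x).re)| ≤ C) ∧
        -- the two components in `Ω` minus the closure of `D`
        (∀ x ∈ Shell re ri ε,
          |inner ℝ (gradient u x) (eXi re ri ε x)| ≤ C ∧
          |inner ℝ (gradient u x) (eTheta re ri ε x) -
            amp re ri ε k x *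
              (C₁ * (PShell re ri ε k x).im - C₂ * (PShell re ri ε k x).re)| ≤ C) := by
  have hre0 : 0 < re := hri.trans hre
  obtain ⟨c, L, B, hL, hB0, hB, hLip, hlim⟩ :=
    exists_background hre0 (by linarith : 0 < δ) hg hg0
  obtain ⟨G, hG⟩ := Admissible.exists_geometryBound hri hre
  -- The gradient of `H` is the conjugate of `Φ`, and `c` is the limit of `Φ`, so C₁ + iC₂ is the
  -- conjugate of `c`.
  refine ⟨fun ε₀ k₀ hε₀ hk₀ => ?_, c.re, -c.im, ?_, ?_⟩
  -- k ≥ k₀ keeps τ at or above `tau k₀` > -1, which is the distance from -1 that the uniform bound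
  -- on the sums needs.
  · have hρ : max 0 (-tau k₀) < 1 :=
      max_lt one_pos (by linarith [(abs_lt.1 (abs_tau_lt_one hk₀)).1])
    refine ⟨max (B + 2 * (B * (8 * G ^ 2) / √ε₀)) (B + 2 * (B * (8 * G ^ 2) / √((re - ri) / 2) +
      8 * B / (1 - max 0 (-tau k₀)) + (L * (8 * G + 9 * (G + 1) ^ 3) * G ^ 2 + 17 * ‖c‖))),
      fun ε k hε hε' hk h u hu x hx => ?_⟩
    have H : Admissible re ri ε := ⟨hri, hre, hε, hε'⟩
    have hτ := abs_tau_lt_one hk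
    rcases h with h | h
    · refine (hu.norm_gradient_le H hk hg hg0 hL hB hLip (fun ζ s A D => ?_) hx).trans
        (le_max_left _ _)
      refine (D.norm_raySum_le_div hG H hτ.le).trans ?_
      gcongr
    · refine (hu.norm_gradient_le H hk hg hg0 hL hB hLip (fun ζ s A D => ?_) hx).trans
        (le_max_right _ _)
      refine D.norm_raySum_le hL hG H (le_max_left _ _) hρ ?_ (abs_le.1 hτ.le).2
      have h1 := tau_mono hk₀ h
      have h2 := le_max_right 0 (-tau k₀)
      linarith
  · convert hlim using 2
    apply Complex.ext <;> simp
  · obtain ⟨R, hR⟩ := exists_raySum_bound hri hre hL c B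
    refine ⟨max (3 * R) (B + 2 * R), fun ε k hε hε' hk hk1 u hu => ?_⟩
    have H : Admissible re ri ε := ⟨hri, hre, hε, hε'⟩
    have hR' := hR ε H (tau k) (abs_lt.1 (abs_tau_lt_one hk)).1 (tau_neg hk hk1)
    obtain ⟨hi, hs⟩ := hu.gradient_eq_conj H hk hg hg0 hB
    refine ⟨fun x hx hp => ?_, fun x hx => ?_⟩
    · have hxO := mem_Om_of_mem_Incl H hx
      have h1 := (norm_incl_add_le H hL hB hLip hk hk1 hR' hxO hp).trans
        (le_max_left _ (B + 2 * R))
      have h2 := abs_re_sub_le_of_norm h1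
      have h3 := abs_im_sub_le_of_norm h1
      rw [Complex.neg_re, (re_amp_mul _ _).1] at h2
      rw [Complex.neg_im, (re_amp_mul _ _).2] at h3
      rw [hi x hx, inner_conj_eXi H hxO hp, inner_conj_eTheta H hxO hp]
      refine ⟨h2, ?_⟩
      rw [← abs_neg]
      convert h3 using 2
      ring
    · have hxI := not_mem_Incl_of_mem_Shell hx
      have hp := H.ne_pole_of_not_mem hxI
      have h1 := (norm_shell_sub_le H hL hB hLip hk
        (fun ζ s A D s' h h' => (hR' ζ s A D s' h h').1) hx.1 hxI).trans
        (le_max_right (3 * R) _)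
      have h2 := abs_re_sub_le_of_norm h1
      have h3 := abs_im_sub_le_of_norm h1
      rw [Complex.re_ofReal_mul, Complex.I_re, mul_zero, sub_zero] at h2
      rw [Complex.im_ofReal_mul, Complex.I_im, mul_one, (re_amp_mul _ _).2] at h3
      rw [hs x hx, inner_conj_eXi H hx.1 hp, inner_conj_eTheta H hx.1 hp]
      refine ⟨h2, ?_⟩
      rw [← abs_neg]
      convert h3 using 2
      ring
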